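/- Let $G$ be a connected simple graph with $n$ nodes. The connectivity $k$ of a finite graph is the least number of nodes whose removal leaves a graph that is disconnected or has at most one node (so it is $m-1$ for the complete graph on $m$ nodes). **Tubings and cores.** A tube of $G$ is a nonempty proper subset of nodes whose induced graph is connected. Two tubes are compatible if one properly contains the other, or if they are disjoint and no edge of $G$ joins them. A tubing is a set of pairwise compatible tubes; tubings are ordered by $T\preceq T'$ if $T\supseteq T'$. The whole node set is called the universal tube (it is not a tube). For a tubing $T$ and $t\in T$ or $t$ universal, the core of $t$ in $T$ is the graph whose nodes are the nodes of $t$ lying in no $t'\in T$ with $t'\subsetneq t$, two of them being joined if they are adjacent in $G$ or connected by a path through some $t'\in T$, $t'\subsetneq t$. **Color templates.** A color palette is a multiset of $n-1$ colors. It is monochrome if all its colors are equal, and full if they are distinct. A color template $(T,\mathcal O)$ is a tubing $T$ with a partition $\mathcal O$ of the palette among the tubes of $T$ and the universal tube, in which a tube $t$ whose core has $m_t$ nodes and connectivity $k_t$ receives a sequence of blocks: first one color, the color of $t$ (omitted for the universal tube); then $k_t-1$ outer blocks of one color each; last an unordered inner block with the remaining $m_t-k_t$ colors (there are no outer and no inner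 colors if $m_t=1$). **Order.** Let $T=T'\cup\{t\}$ with $t\notin T'$, and let $t_*$ be the smallest tube of $T'$ that properly contains $t$, or the universal tube if there is none. Put $(T,\mathcal O)\prec(T',\mathcal O')$ if all tubes other than $t$ and $t_*$ have the same blocks in both, and the colors of $t_*$ in $\mathcal O'$ can be listed in block order, with the inner colors last in an arbitrary order, such that an initial segment of the list is a listing in this sense of the colors of $t_*$ in $\mathcal O$ and the remaining segment is one of the colors of $t$ in $\mathcal O$. The order on color templates is the reflexive transitive closure of this relation. The colorful graph associahedron $\mathcal K^{c}G$ is the collection of the connected components of this poset, each with a least face $f_\emptyset$ adjoined. **Abstract polytopes.** A poset is an abstract polytope of rank $d$ if it has a least and a greatest element, each flag (maximal chain) has exactly $d+2$ elements, it is strongly flag-connected (any two flags $\Phi,\Psi$ are joined by a sequence of flags, each differing from the next in precisely one element, all of which contain $\Phi\cap\Psi$), and whenever $f\prec h$ have ranks $j-1$ and $j+1$ there are precisely two elements strictly between them. Here the rank of $f$ is $j-2$, where $j$ is the maximal number of elements of a chain with greatest element $f$. **Corollary.** 1. For a monochrome palette, $(T,\mathcal O)\mapsto T$ is an isomorphism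 from the poset of color templates of $G$ onto the poset of tubings of $G$. That is, $\mathcal K^{c}G$ is the classical graph associahedron. 2. For a full palette of $n-1$ distinct colors, $\mathcal K^{c}G$ consists of exactly $(n-1)!/(n-k)!$ posets, where $k$ is the connectivity of $G$. Each of them is an abstract polytope of rank $n-1$, and any two of them are isomorphic. (For $n=1$, $k=0$ the quotient is $0!/1!=1$.) -/

import Mathlib

/-! ### Connectivity, tubes, tubings and cores -/

namespace SimpleGraph

/-- The (vertex) connectivity of a finite graph: the least number of nodes whose removal leaves a
graph that is disconnected or has at most one node. For a graph that is not complete this is the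
least number of nodes whose removal disconnects it; for the complete graph on `m ≥ 1` nodes it is
`m - 1`. -/
noncomputable def vertexConnectivity {W : Type*} [Fintype W] (H : SimpleGraph W) : ℕ :=
  sInf {k : ℕ | ∃ S : Finset W, S.card = k ∧
    (¬ (H.induce {v : W | v ∉ S}).Preconnected ∨ Fintype.card W ≤ S.card + 1)}

variable {V : Type*} [Fintype V] [DecidableEq V] (G : SimpleGraph V)

/-- A tube is a proper set of nodes whose induced graph is connected (in particular nonempty). -/
def IsTube (t : Finset V) : Prop :=
  t ≠ Finset.univ ∧ (G.induce (t : Set V)).Connected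

/-- Two tubes are compatible if one properly contains the other, or if they are disjoint and
not joined by an edge. -/
def TubesCompatible (s t : Finset V) : Prop :=
  s ⊂ t ∨ t ⊂ s ∨ (Disjoint s t ∧ ∀ a ∈ s, ∀ b ∈ t, ¬ G.Adj a b)

/-- A tubing is a set of pairwise compatible tubes. -/
@[ext]
structure Tubing where
  tubes : Finset (Finset V)
  isTube : ∀ t ∈ tubes, G.IsTube t
  compatible : ∀ s ∈ tubes, ∀ t ∈ tubes, s ≠ t → G.TubesCompatible s t

/-- The face order of the classical graph associahedron: `T ≤ T'` if `T` is obtained from `T'`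
by adding tubes. The poset `Tubing G` is the poset of nonempty faces of the polytope. -/
instance : PartialOrder (Tubing G) where
  le T T' := T'.tubes ⊆ T.tubes
  le_refl _ := Finset.Subset.refl _
  le_trans _ _ _ h h' := Finset.Subset.trans h' h
  le_antisymm _ _ h h' := Tubing.ext (Finset.Subset.antisymm h' h)

/-- The nodes of the core of `t` in a set of tubes `T`: those of `t` not contained in any
`t' ∈ T` with `t' ⊂ t`. The universal tube is `t = Finset.univ`. -/
def coreNodes (T : Finset (Finset V)) (t : Finset V) : Finset V :=
  t.filter fun v => ∀ t' ∈ T, t' ⊂ t → v ∉ t'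

/-- The core graph of `t` in `T`: two of its nodes are joined if they are adjacent in `G`, or if
they are connected through some `t' ∈ T` with `t' ⊂ t`, that is, each of them is adjacent to a node
of `t'` (tubes are connected). -/
def coreGraph (T : Finset (Finset V)) (t : Finset V) :
    SimpleGraph {v : V // v ∈ coreNodes T t} where
  Adj u v := u ≠ v ∧ (G.Adj u v ∨
    ∃ t' ∈ T, t' ⊂ t ∧ (∃ a ∈ t', G.Adj u a) ∧ (∃ b ∈ t', G.Adj v b))
  symm := ⟨by
    rintro u v ⟨hne, h | ⟨t', hT, ht, hu, hv⟩⟩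
    · exact ⟨hne.symm, Or.inl h.symm⟩
    · exact ⟨hne.symm, Or.inr ⟨t', hT, ht, hv, hu⟩⟩⟩
  loopless := ⟨fun _ h => h.1 rfl⟩

/-- The connectivity of the core of `t` in `T`. -/
noncomputable def coreConnectivity (T : Finset (Finset V)) (t : Finset V) : ℕ :=
  (G.coreGraph T t).vertexConnectivity

end SimpleGraph

/-! ### Color templates and the colorful graph associahedron -/

/-- The color blocks attached to a tube: the block with the color of the tube itself (`none` for
the universal tube, which is uncolored), the ordered sequence of outer blocks (one color each), and
the unordered inner block. -/
@[ext]
structure ColorBlocks (C : Type*) where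
  color : Option C
  outer : List C
  inner : Multiset C

namespace ColorBlocks

variable {C : Type*}

/-- No colors at all. -/
def empty : ColorBlocks C := ⟨none, [], 0⟩

/-- All colors in the blocks, with multiplicity. -/
def colors (b : ColorBlocks C) : Multiset C :=
  (b.color.toList : Multiset C) + (b.outer : Multiset C) + b.inner

/-- `ℓ` lists all the colors of `b` in an order that respects the order of the blocks; the colors
of the inner block come last, in an arbitrary order. -/
def IsListing (b : ColorBlocks C) (ℓ : List C) : Prop :=
  ∃ m : List C, (m : Multiset C) = b.inner ∧ ℓ = b.color.toList ++ b.outer ++ m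

end ColorBlocks

namespace SimpleGraph

variable {V : Type*} [Fintype V] [DecidableEq V] (G : SimpleGraph V) {C : Type*}

/-- A color template: a tubing `T` with a partition of the palette `P` among the tubes of `T` and
the universal tube. If the core of `t` in `T` has `m` nodes and connectivity `k`, then `t` carries
its own color (unless it is the universal tube), `k - 1` outer blocks of one color each, and an
inner block with the remaining `(m - 1) - (k - 1)` colors (which is `m - k` if `k ≥ 1`; for a core
with a single node there are no outer and no inner colors). -/
@[ext]
structure ColorTemplate (P : Multiset C) where
  tubing : G.Tubing
  blocks : Finset V → ColorBlocks C
  /-- Sets that are not tubes of the template carry no blocks. -/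
  blocks_eq_empty : ∀ t, t ∉ insert Finset.univ tubing.tubes → blocks t = ColorBlocks.empty
  color_univ : (blocks Finset.univ).color = none
  color_tube : ∀ t ∈ tubing.tubes, (blocks t).color.isSome
  length_outer : ∀ t ∈ insert Finset.univ tubing.tubes,
    (blocks t).outer.length = G.coreConnectivity tubing.tubes t - 1
  card_inner : ∀ t ∈ insert Finset.univ tubing.tubes,
    (blocks t).inner.card =
      ((coreNodes tubing.tubes t).card - 1) - (G.coreConnectivity tubing.tubes t - 1)
  sum_colors : ∑ t ∈ insert Finset.univ tubing.tubes, (blocks t).colors = P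

namespace ColorTemplate

variable {G} {P : Multiset C}

/-- Compatibility of templates `x ≺ y` whose tubings differ by one tube `t`, added to the tubing
of `y`. Here `s` is the smallest tube of `y` that contains `t`, or else the universal tube.
All other tubes keep their blocks. The colors of `s` in `y` are listed in an order compatible with
their blocks (the inner ones in any order); an initial segment `ℓ₁` of this list, as long as the
number of colors of `s` in `x`, is distributed in this order to the blocks of `s` in `x`, and the
rest `ℓ₂` is distributed in this order to the blocks of `t` in `x`. -/
def Step (x y : G.ColorTemplate P) : Prop :=
  ∃ t s : Finset V,
    t ∉ y.tubing.tubes ∧ x.tubing.tubes = insert t y.tubing.tubes ∧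
    s ∈ insert Finset.univ y.tubing.tubes ∧ t ⊂ s ∧
    (∀ r ∈ insert Finset.univ y.tubing.tubes, t ⊂ r → s ⊆ r) ∧
    (∀ r, r ≠ t → r ≠ s → x.blocks r = y.blocks r) ∧
    ∃ ℓ₁ ℓ₂ : List C, (y.blocks s).IsListing (ℓ₁ ++ ℓ₂) ∧
      (x.blocks s).IsListing ℓ₁ ∧ (x.blocks t).IsListing ℓ₂

theorem Step.card_lt {x y : G.ColorTemplate P} (h : Step x y) :
    y.tubing.tubes.card < x.tubing.tubes.card := by
  obtain ⟨t, s, ht, hx, -⟩ := h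
  rw [hx, Finset.card_insert_of_notMem ht]
  exact Nat.lt_succ_self _

theorem eq_or_card_lt {x y : G.ColorTemplate P} (h : Relation.ReflTransGen Step x y) :
    x = y ∨ y.tubing.tubes.card < x.tubing.tubes.card := by
  induction h with
  | refl => exact Or.inl rfl
  | tail _ hs ih =>
    rcases ih with rfl | ih
    · exact Or.inr hs.card_lt
    · exact Or.inr (hs.card_lt.trans ih)

/-- The order on color templates, obtained by iterating the one-tube compatibility. The poset
`G.ColorTemplate P` consists of all faces of the colorful graph associahedron, except for the
least faces. -/
instance : PartialOrder (G.ColorTemplate P) where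
  le := Relation.ReflTransGen Step
  le_refl _ := Relation.ReflTransGen.refl
  le_trans _ _ _ := Relation.ReflTransGen.trans
  le_antisymm x y h h' := by
    rcases eq_or_card_lt h with h | h
    · exact h
    · rcases eq_or_card_lt h' with h' | h'
      · exact h'.symm
      · exact absurd h (lt_asymm h')

end ColorTemplate

/-- The connected components of the poset of color templates: the index set of the collection of
posets that makes up the colorful graph associahedron. -/
def ColorfulComponent (P : Multiset C) : Type _ :=
  Quot fun x y : G.ColorTemplate P => x ≤ y

variable {G} in
/-- The poset of the collection with index `c`: the color templates in the component `c`, with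
the induced order, together with a least face. -/
abbrev ColorfulComponent.Faces {P : Multiset C} (c : G.ColorfulComponent P) : Type _ :=
  WithBot {x : G.ColorTemplate P // (Quot.mk _ x : G.ColorfulComponent P) = c}

end SimpleGraph

/-! ### Abstract polytopes -/

/-- Two flags are adjacent if they differ in precisely one face. -/
def Flag.IsAdjacent {α : Type*} [PartialOrder α] (A B : Flag α) : Prop :=
  ((A : Set α) \ (B : Set α)).ncard = 1 ∧ ((B : Set α) \ (A : Set α)).ncard = 1

/-- A poset is an abstract polytope of rank `n`. The rank of a face `f` is `Order.height f - 1`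
(so that the least face has rank `-1`); hence faces of ranks `j - 1` and `j + 1` are faces whose
heights differ by two. -/
structure IsAbstractPolytope (α : Type*) [PartialOrder α] (n : ℕ) : Prop where
  exists_least : ∃ a : α, IsBot a
  exists_greatest : ∃ a : α, IsTop a
  ncard_flag : ∀ A : Flag α, (A : Set α).ncard = n + 2
  /-- strong flag-connectedness -/
  strongly_flag_connected : ∀ A B : Flag α,
    Relation.ReflTransGen
      (fun X Y : Flag α => X.IsAdjacent Y ∧ (A : Set α) ∩ (B : Set α) ⊆ (Y : Set α)) A B
  /-- the diamond condition -/
  diamond : ∀ f h : α, f < h → Order.height h = Order.height f + 2 →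
    {g : α | f < g ∧ g < h}.ncard = 2

set_option linter.unusedSectionVars false

/-! Let `U` be the set of core nodes of a tube `s`, universal or not. Proper subtubes are connected,
so deleting core nodes from the core separates two of its nodes exactly when deleting them from `s`
does. Hence the connectivity of a core depends only on `U` and `s` (`coreConnectivity_eq`). Adding a
tube `t` with parent `s` splits `U` into `U \ t`, the core of `s`, and `U ∩ t`, the core of `t`, and
touches no other core. The prescribed numbers of colors add up accordingly, so tubes can be added to
and removed from templates.

Adding a tube involves a choice of inner colors, but removing one does not. Two inequalities between
connectivities (`relConn_le_parent`, `relConn_le_add`) show that the outer colors of the parent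
after a removal are forced, so different listings of inner colors give the same result
(`StepVia.isListing`, `StepVia.right_unique`). Removals also commute (`StepVia.confluent`). The only
delicate case is two tubes with the same parent, where the core nodes outside both tubes form a cut,
which bounds the number of outer colors (`relConn_le_of_disjoint`). So the faces above a template
correspond to the subsets of its tubes (`eq_of_tubes_eq`, `le_of_tubes_subset`). In particular each
component has a single greatest face, the one without tubes.

Three claims follow quickly. For a monochrome palette the tubing determines the template. For a full
palette the greatest faces are counted by their sequences of `k - 1` distinct outer colors. A
permutation of the colors carries any greatest face to any other, and so one component onto the
other.

It remains to see that a component is an abstract polytope. The number of tubes gives a grading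
(`card_tubes_add_sum`), and in a bounded graded poset strong flag-connectedness follows from
connectedness of the long open intervals (`IsBoundedGrading.strongly_flag_connected`). Intervals
between templates are Boolean, so the substance is that the proper faces of a face `h` of rank at
least two are connected (`linked_of_lt`). Facets of `h` at different cores have a common face. At
one core with at least three nodes, every facet can be moved to a facet whose tube `ta` is the
component of `s` without a nonseparating core node `a` that contains the other core nodes. Then the
distribution of colors must be adjusted. If the connectivity is at least two, taking `a` in a
minimum cut lowers it, and the outer colors of `h` leave only one such facet. If it is one, a node
`v` separates two nonseparating nodes `a` and `b`. A prescribed color is then put on the component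
of `b`, carried by exchanges of tubes to the tube `tb` that avoids `b`, and brought back to `ta`. -/

/-! ### Reachability inside a set of nodes -/

namespace SimpleGraph

variable {V : Type*} [Fintype V] [DecidableEq V] (G : SimpleGraph V)

/-- `v` can be reached from `u` by a path inside `R`. -/
def ReachIn (R : Finset V) (u v : V) : Prop :=
  Relation.ReflTransGen (fun a b => a ∈ R ∧ b ∈ R ∧ G.Adj a b) u v

/-- `R` is nonempty and connected. -/
def IsConn (R : Finset V) : Prop :=
  R.Nonempty ∧ ∀ u ∈ R, ∀ v ∈ R, G.ReachIn R u v

variable {G}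

theorem ReachIn.refl {R : Finset V} (u : V) : G.ReachIn R u u := Relation.ReflTransGen.refl

theorem ReachIn.trans {R : Finset V} {u v w : V} (h : G.ReachIn R u v) (h' : G.ReachIn R v w) :
    G.ReachIn R u w := Relation.ReflTransGen.trans h h'

theorem ReachIn.single {R : Finset V} {u v : V} (hu : u ∈ R) (hv : v ∈ R) (h : G.Adj u v) :
    G.ReachIn R u v := Relation.ReflTransGen.single ⟨hu, hv, h⟩

theorem ReachIn.symm {R : Finset V} {u v : V} (h : G.ReachIn R u v) : G.ReachIn R v u := by
  induction h with
  | refl => exact ReachIn.refl _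
  | tail _ h ih => exact (ReachIn.single h.2.1 h.1 h.2.2.symm).trans ih

theorem ReachIn.mono {R R' : Finset V} (hR : R ⊆ R') {u v : V} (h : G.ReachIn R u v) :
    G.ReachIn R' u v :=
  Relation.ReflTransGen.mono (fun _ _ h => ⟨hR h.1, hR h.2.1, h.2.2⟩) _ _ h

/-- A path either stays in `X` or leaves it. -/
theorem ReachIn.stay_or_exit {R : Finset V} (X : Finset V) {u w : V} (h : G.ReachIn R u w)
    (hu : u ∈ X) : (w ∈ X ∧ G.ReachIn (R ∩ X) u w) ∨
      ∃ p ∈ X, ∃ q, q ∉ X ∧ p ∈ R ∧ q ∈ R ∧ G.Adj p q ∧ G.ReachIn (R ∩ X) u p := by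
  induction h with
  | refl => exact Or.inl ⟨hu, ReachIn.refl _⟩
  | @tail b c _ h ih =>
    rcases ih with ⟨hb, ih⟩ | ih
    · by_cases hc : c ∈ X
      · exact Or.inl ⟨hc, ih.trans (ReachIn.single (Finset.mem_inter.2 ⟨h.1, hb⟩)
          (Finset.mem_inter.2 ⟨h.2.1, hc⟩) h.2.2)⟩
      · exact Or.inr ⟨b, hb, c, hc, h.1, h.2.1, h.2.2, ih⟩
    · exact Or.inr ih

theorem ReachIn.mem_of_closed {R X : Finset V} {u w : V} (h : G.ReachIn R u w) (hu : u ∈ X)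
    (hX : ∀ p ∈ X, ∀ q ∈ R, p ∈ R → G.Adj p q → q ∈ X) : w ∈ X := by
  rcases h.stay_or_exit X hu with h | ⟨p, hp, q, hq, hpR, hqR, hpq, -⟩
  · exact h.1
  · exact absurd (hX p hp q hqR hpR hpq) hq

theorem reachable_induce_iff {R : Finset V} {u v : V} (hu : u ∈ (R : Set V))
    (hv : v ∈ (R : Set V)) :
    (G.induce (R : Set V)).Reachable ⟨u, hu⟩ ⟨v, hv⟩ ↔ G.ReachIn R u v := by
  rw [reachable_iff_reflTransGen]
  constructor
  · intro h
    exact Relation.ReflTransGen.lift (fun x : (R : Set V) => (x : V))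
      (fun a b hab => ⟨a.2, b.2, hab⟩) _ _ h
  · intro h
    induction h with
    | refl => exact Relation.ReflTransGen.refl
    | tail _ h ih => exact (ih h.1).tail h.2.2

theorem isConn_iff {R : Finset V} : G.IsConn R ↔ (G.induce (R : Set V)).Connected := by
  rw [connected_iff]
  constructor
  · rintro ⟨⟨x, hx⟩, h⟩
    exact ⟨fun u v => (reachable_induce_iff u.2 v.2).2 (h u u.2 v v.2), ⟨x, hx⟩⟩
  · rintro ⟨h, ⟨x, hx⟩⟩
    exact ⟨⟨x, hx⟩, fun u hu v hv => (reachable_induce_iff hu hv).1 (h ⟨u, hu⟩ ⟨v, hv⟩)⟩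

theorem isTube_iff {t : Finset V} : G.IsTube t ↔ t ≠ Finset.univ ∧ G.IsConn t := by
  rw [IsTube, isConn_iff]

theorem isConn_univ (hG : G.Connected) : G.IsConn (Finset.univ : Finset V) := by
  obtain ⟨x⟩ := hG.nonempty
  refine ⟨⟨x, Finset.mem_univ _⟩, fun u _ v _ => ?_⟩
  have h := hG.preconnected u v
  rw [reachable_iff_reflTransGen] at h
  exact Relation.ReflTransGen.mono (fun a b h => ⟨Finset.mem_univ _, Finset.mem_univ _, h⟩) _ _ h

theorem IsConn.exists_adj {s X : Finset V} (hs : G.IsConn s) (hX : (s ∩ X).Nonempty)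
    (hsX : ¬ s ⊆ X) : ∃ p ∈ s, p ∈ X ∧ ∃ q ∈ s, q ∉ X ∧ G.Adj p q := by
  obtain ⟨u, hu⟩ := hX
  obtain ⟨w, hw, hwX⟩ := Finset.not_subset.1 hsX
  rw [Finset.mem_inter] at hu
  rcases (hs.2 u hu.1 w hw).stay_or_exit X hu.2 with h | ⟨p, hp, q, hq, hpR, hqR, hpq, -⟩
  · exact absurd h.1 hwX
  · exact ⟨p, hpR, hp, q, hqR, hq, hpq⟩

/-! ### Components inside a set of nodes -/

variable (G) in
/-- The connected component of `u` inside `R`. -/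
noncomputable def comp (R : Finset V) (u : V) : Finset V :=
  open Classical in R.filter fun v => G.ReachIn R u v

theorem mem_comp {R : Finset V} {u v : V} : v ∈ G.comp R u ↔ v ∈ R ∧ G.ReachIn R u v := by
  simp [comp]

theorem comp_subset {R : Finset V} {u : V} : G.comp R u ⊆ R := fun _ h => (mem_comp.1 h).1

theorem self_mem_comp {R : Finset V} {u : V} (hu : u ∈ R) : u ∈ G.comp R u :=
  mem_comp.2 ⟨hu, ReachIn.refl _⟩

theorem comp_closed {R : Finset V} {u p q : V} (hp : p ∈ G.comp R u) (hq : q ∈ R)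
    (h : G.Adj p q) : q ∈ G.comp R u := by
  rw [mem_comp] at hp ⊢
  exact ⟨hq, hp.2.trans (ReachIn.single hp.1 hq h)⟩

theorem isConn_comp {R : Finset V} {u : V} (hu : u ∈ R) : G.IsConn (G.comp R u) := by
  have key : ∀ v ∈ G.comp R u, G.ReachIn (G.comp R u) u v := by
    intro v hv
    rcases (mem_comp.1 hv).2.stay_or_exit (G.comp R u) (self_mem_comp hu) with
      h | ⟨p, hp, q, hq, -, hqR, hpq, -⟩
    · exact h.2.mono Finset.inter_subset_right
    · exact absurd (comp_closed hp hqR hpq) hq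
  exact ⟨⟨u, self_mem_comp hu⟩, fun a ha b hb => (key a ha).symm.trans (key b hb)⟩

theorem IsConn.subset_comp {R X : Finset V} {u p : V} (hX : G.IsConn X) (hXR : X ⊆ R)
    (hp : p ∈ X) (hpu : p ∈ G.comp R u) : X ⊆ G.comp R u := fun q hq =>
  mem_comp.2 ⟨hXR hq, (mem_comp.1 hpu).2.trans ((hX.2 p hp q hq).mono hXR)⟩

theorem comp_eq_of_mem {R : Finset V} {u v : V} (h : v ∈ G.comp R u) :
    G.comp R v = G.comp R u := by
  ext w
  rw [mem_comp] at h
  simp only [mem_comp]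
  exact ⟨fun hw => ⟨hw.1, h.2.trans hw.2⟩, fun hw => ⟨hw.1, h.2.symm.trans hw.2⟩⟩

/-! ### Tubings as finite sets of node sets -/

variable (G) in
/-- A finite set of pairwise compatible tubes. -/
structure IsTubing (T : Finset (Finset V)) : Prop where
  isTube : ∀ t ∈ T, G.IsTube t
  compatible : ∀ s ∈ T, ∀ t ∈ T, s ≠ t → G.TubesCompatible s t

theorem Tubing.isTubing (T : G.Tubing) : G.IsTubing T.tubes := ⟨T.isTube, T.compatible⟩

theorem TubesCompatible.symm {s t : Finset V} (h : G.TubesCompatible s t) :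
    G.TubesCompatible t s := by
  rcases h with h | h | ⟨h, h'⟩
  · exact Or.inr (Or.inl h)
  · exact Or.inl h
  · exact Or.inr (Or.inr ⟨h.symm, fun a ha b hb hab => h' b hb a ha hab.symm⟩)

theorem IsTubing.mono {T T' : Finset (Finset V)} (h : G.IsTubing T') (hT : T ⊆ T') :
    G.IsTubing T :=
  ⟨fun t ht => h.isTube t (hT ht), fun s hs t ht => h.compatible s (hT hs) t (hT ht)⟩

theorem IsTubing.insert_tube {T : Finset (Finset V)} (h : G.IsTubing T) {t : Finset V}
    (ht : G.IsTube t) (hc : ∀ r ∈ T, r ≠ t → G.TubesCompatible t r) :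
    G.IsTubing (insert t T) := by
  constructor
  · intro r hr
    rcases Finset.mem_insert.1 hr with rfl | hr
    · exact ht
    · exact h.isTube r hr
  · intro r hr r' hr' hne
    rcases Finset.mem_insert.1 hr with h1 | h1 <;> rcases Finset.mem_insert.1 hr' with h2 | h2
    · exact absurd (h1.trans h2.symm) hne
    · subst h1
      exact hc r' h2 hne.symm
    · subst h2
      exact (hc r h1 hne).symm
    · exact h.compatible r h1 r' h2 hne

variable {T : Finset (Finset V)}

theorem IsTubing.univ_notMem (hT : G.IsTubing T) : Finset.univ ∉ T :=
  fun h => (hT.isTube _ h).1 rfl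

theorem IsTubing.compatible' (hT : G.IsTubing T) {s t : Finset V}
    (hs : s ∈ insert Finset.univ T) (ht : t ∈ insert Finset.univ T) (hne : s ≠ t) :
    G.TubesCompatible s t := by
  rcases Finset.mem_insert.1 hs with rfl | hs
  · exact Or.inr (Or.inl ((Finset.subset_univ _).ssubset_of_ne hne.symm))
  · rcases Finset.mem_insert.1 ht with rfl | ht
    · exact Or.inl ((Finset.subset_univ _).ssubset_of_ne hne)
    · exact hT.compatible s hs t ht hne

theorem IsTubing.isConn (hG : G.Connected) (hT : G.IsTubing T) {s : Finset V} (hs : s ∈ insert Finset.univ T) :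
    G.IsConn s := by
  rcases Finset.mem_insert.1 hs with rfl | hs
  · exact isConn_univ hG
  · exact (isTube_iff.1 (hT.isTube s hs)).2

/-- Compatible sets that meet or are joined by an edge are comparable. -/
theorem TubesCompatible.comparable {s t : Finset V} (h : G.TubesCompatible s t)
    {a b : V} (ha : a ∈ s) (hb : b ∈ t) (hab : a = b ∨ G.Adj a b) : s ⊂ t ∨ t ⊂ s := by
  rcases h with h | h | ⟨h, h'⟩
  · exact Or.inl h
  · exact Or.inr h
  · rcases hab with rfl | hab
    · exact absurd hb (Finset.disjoint_left.1 h ha)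
    · exact absurd hab (h' a ha b hb)

/-- `s` is the smallest tube of `T`, or else the universal tube, that properly contains `t`. -/
structure IsParent (T : Finset (Finset V)) (t s : Finset V) : Prop where
  mem : s ∈ insert Finset.univ T
  ssubset : t ⊂ s
  le : ∀ r ∈ insert Finset.univ T, t ⊂ r → s ⊆ r

theorem IsParent.eq {t s s' : Finset V} (h : IsParent T t s) (h' : IsParent T t s') : s = s' :=
  (h.le s' h'.mem h'.ssubset).antisymm (h'.le s h.mem h.ssubset)

/-- The sets of the tubing that properly contain `t` share a node, hence form a chain. One with
fewest nodes is therefore contained in all others. -/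
theorem IsTubing.exists_parent (hT : G.IsTubing T) {t : Finset V} (ht : t.Nonempty)
    (htu : t ≠ Finset.univ) : ∃ s, IsParent T t s := by
  obtain ⟨s, hs, hmin⟩ := Finset.exists_min_image ((insert Finset.univ T).filter (t ⊂ ·))
    Finset.card ⟨Finset.univ, by
      simpa using (Finset.subset_univ t).ssubset_of_ne htu⟩
  simp only [Finset.mem_filter] at hs hmin
  refine ⟨s, hs.1, hs.2, fun r hr htr => ?_⟩
  by_cases hne : s = r
  · exact hne.subset
  obtain ⟨x, hx⟩ := ht
  rcases (hT.compatible' hs.1 hr hne).comparable (hs.2.1 hx) (htr.1 hx) (Or.inl rfl) with h | h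
  · exact h.1
  · exact absurd (Finset.card_lt_card h) (not_lt.2 (hmin r ⟨hr, htr⟩))

/-! ### Nodes of cores -/

theorem mem_coreNodes {s : Finset V} {v : V} :
    v ∈ coreNodes T s ↔ v ∈ s ∧ ∀ t ∈ T, t ⊂ s → v ∉ t := by simp [coreNodes]

theorem coreNodes_subset {s : Finset V} : coreNodes T s ⊆ s := Finset.filter_subset _ _

theorem exists_of_notMem_coreNodes {s : Finset V} {v : V} (hv : v ∈ s)
    (h : v ∉ coreNodes T s) : ∃ t ∈ T, t ⊂ s ∧ v ∈ t := by
  rw [mem_coreNodes] at h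
  push Not at h
  exact h hv

/-- A node outside the core lies in a maximal proper subtube. -/
theorem exists_maximal_of_notMem_coreNodes {s : Finset V} {v : V} (hv : v ∈ s)
    (h : v ∉ coreNodes T s) : ∃ t ∈ T, t ⊂ s ∧ v ∈ t ∧ ∀ r ∈ T, r ⊂ s → ¬ t ⊂ r := by
  obtain ⟨t, ht, hts, hvt⟩ := exists_of_notMem_coreNodes hv h
  obtain ⟨m, hm, hmax⟩ := Finset.exists_max_image (T.filter fun t => t ⊂ s ∧ v ∈ t)
    Finset.card ⟨t, by simp [ht, hts, hvt]⟩
  simp only [Finset.mem_filter] at hm hmax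
  refine ⟨m, hm.1, hm.2.1, hm.2.2, fun r hr hrs hmr => ?_⟩
  exact absurd (Finset.card_lt_card hmr) (not_lt.2 (hmax r ⟨hr, hrs, hmr.1 hm.2.2⟩))

/-- If the proper subtubes covered `s`, an edge of `s` leaving a maximal one would end in another,
contradicting compatibility or maximality. Nonempty cores make the truncated count `card - 1` behave
well when a core is split. -/
theorem IsTubing.coreNodes_nonempty (hG : G.Connected) (hT : G.IsTubing T) {s : Finset V}
    (hs : s ∈ insert Finset.univ T) : (coreNodes T s).Nonempty := by
  by_contra hcon
  rw [Finset.not_nonempty_iff_eq_empty] at hcon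
  have hno : ∀ v, v ∉ coreNodes T s := fun v => by simp [hcon]
  obtain ⟨x, hx⟩ := (hT.isConn hG hs).1
  obtain ⟨t, ht, hts, hxt, hmax⟩ := exists_maximal_of_notMem_coreNodes hx (hno x)
  obtain ⟨p, hp, hpt, q, hq, hqt, hpq⟩ := (hT.isConn hG hs).exists_adj (X := t)
    ⟨x, Finset.mem_inter.2 ⟨hx, hxt⟩⟩ hts.2
  obtain ⟨r, hr, hrs, hqr⟩ := exists_of_notMem_coreNodes hq (hno q)
  have hne : t ≠ r := by rintro rfl; exact hqt hqr
  rcases (hT.compatible t ht r hr hne).comparable hpt hqr (Or.inr hpq) with h | h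
  · exact hmax r hr hrs h
  · exact hqt (h.1 hqr)

/-- If `r` properly contains `t` and is not the parent, then `s` already lies properly inside `r`
and hides the nodes of `t`. -/
theorem IsParent.coreNodes_of_ne {t s r : Finset V} (h : IsParent T t s) (hr : r ∈ insert Finset.univ T)
    (hne : r ≠ s) : coreNodes (insert t T) r = coreNodes T r := by
  ext v
  simp only [mem_coreNodes, Finset.mem_insert, forall_eq_or_imp]
  refine ⟨fun hv => ⟨hv.1, hv.2.2⟩, fun hv => ⟨hv.1, fun htr hvt => ?_, hv.2⟩⟩
  have hsr : s ⊂ r := (h.le r hr htr).ssubset_of_ne hne.symm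
  have hsT : s ∈ T := by
    rcases Finset.mem_insert.1 h.mem with hs | hs
    · subst hs
      exact absurd (Finset.subset_univ r) hsr.2
    · exact hs
  exact hv.2 s hsT hsr (h.ssubset.1 hvt)

theorem IsParent.coreNodes_parent {t s : Finset V} (h : IsParent T t s) :
    coreNodes (insert t T) s = coreNodes T s \ t := by
  ext v
  simp only [mem_coreNodes, Finset.mem_insert, forall_eq_or_imp, Finset.mem_sdiff]
  exact ⟨fun hv => ⟨⟨hv.1, hv.2.2⟩, hv.2.1 h.ssubset⟩, fun hv => ⟨hv.1.1, fun _ => hv.2, hv.1.2⟩⟩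

/-- A tube properly inside `s` that meets `t` cannot contain `t`, because `s` is the parent. So it
lies inside `t` and hides the same nodes in both cores. -/
theorem IsParent.coreNodes_self {t s : Finset V} (h : IsParent T t s)
    (hT : G.IsTubing (insert t T)) (ht : t ∉ T) :
    coreNodes (insert t T) t = coreNodes T s ∩ t := by
  ext v
  simp only [mem_coreNodes, Finset.mem_insert, forall_eq_or_imp, Finset.mem_inter]
  constructor
  · rintro ⟨hv, -, hv'⟩
    refine ⟨⟨h.ssubset.1 hv, fun r hr hrs hvr => ?_⟩, hv⟩
    have hne : t ≠ r := by rintro rfl; exact ht hr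
    rcases (hT.compatible t (Finset.mem_insert_self _ _) r (Finset.mem_insert_of_mem hr)
      hne).comparable hv hvr (Or.inl rfl) with h' | h'
    · exact hrs.2 (h.le r (Finset.mem_insert_of_mem hr) h')
    · exact hv' r hr h' hvr
  · rintro ⟨⟨hv, hv'⟩, hvt⟩
    exact ⟨hvt, fun h' => absurd h' (ssubset_irrefl _),
      fun r hr hrt => hv' r hr (hrt.trans h.ssubset)⟩

/-! ### Connectivity of cores -/

variable (G) in
/-- The least number of nodes in `U` whose removal from `s` separates nodes of `U` or leaves at most
one of them. -/
noncomputable def relConn (U s : Finset V) : ℕ :=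
  sInf {k : ℕ | ∃ S ⊆ U, S.card = k ∧
    ((∃ u ∈ U \ S, ∃ w ∈ U \ S, ¬ G.ReachIn (s \ S) u w) ∨ U.card ≤ S.card + 1)}

theorem relConn_le {U s S : Finset V} (hS : S ⊆ U)
    (h : (∃ u ∈ U \ S, ∃ w ∈ U \ S, ¬ G.ReachIn (s \ S) u w) ∨ U.card ≤ S.card + 1) :
    G.relConn U s ≤ S.card := Nat.sInf_le ⟨S, hS, rfl, h⟩

variable (G) in
theorem exists_relConn (U s : Finset V) : ∃ S ⊆ U, S.card = G.relConn U s ∧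
    ((∃ u ∈ U \ S, ∃ w ∈ U \ S, ¬ G.ReachIn (s \ S) u w) ∨ U.card ≤ S.card + 1) :=
  Nat.sInf_mem (s := {k : ℕ | ∃ S ⊆ U, S.card = k ∧
    ((∃ u ∈ U \ S, ∃ w ∈ U \ S, ¬ G.ReachIn (s \ S) u w) ∨ U.card ≤ S.card + 1)})
    ⟨U.card, U, subset_rfl, rfl, Or.inr (Nat.le_succ _)⟩

theorem relConn_le_card_sub_one (U s : Finset V) : G.relConn U s ≤ U.card - 1 := by
  obtain ⟨S, hS, hc⟩ := Finset.exists_subset_card_eq (Nat.sub_le U.card 1)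
  rw [← hc]
  exact relConn_le hS (Or.inr (by omega))

theorem coreGraph_adj_reachIn (hT : G.IsTubing T) {s S : Finset V} (hS : S ⊆ coreNodes T s)
    {u w : {v : V // v ∈ coreNodes T s}} (hu : (u : V) ∉ S) (hw : (w : V) ∉ S)
    (h : (G.coreGraph T s).Adj u w) : G.ReachIn (s \ S) u w := by
  have hus : (u : V) ∈ s \ S := Finset.mem_sdiff.2 ⟨coreNodes_subset u.2, hu⟩
  have hws : (w : V) ∈ s \ S := Finset.mem_sdiff.2 ⟨coreNodes_subset w.2, hw⟩
  obtain ⟨-, h | ⟨t, ht, hts, ⟨a, ha, hua⟩, ⟨b, hb, hwb⟩⟩⟩ := h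
  · exact ReachIn.single hus hws h
  · have htS : t ⊆ s \ S := fun x hx => Finset.mem_sdiff.2 ⟨hts.1 hx,
      fun hxS => (mem_coreNodes.1 (hS hxS)).2 t ht hts hx⟩
    exact (ReachIn.single hus (htS ha) hua).trans
      ((((isTube_iff.1 (hT.isTube t ht)).2.2 a ha b hb).mono htS).trans
        (ReachIn.single (htS hb) hws hwb.symm))

/-- A path in `s \ S` alternates between core nodes and maximal subtubes. The second clause is the
state of the induction inside a subtube: it remembers a core node `y` next to the subtube. An edge
cannot join two different maximal subtubes, so the path leaves a subtube only to a core node, which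
is adjacent to `y` in the core or equal to it. -/
theorem coreGraph_reachable_of_reachIn (hT : G.IsTubing T) {s S : Finset V}
    {u w : V} (hu : u ∈ coreNodes T s) (huS : u ∉ S) (h : G.ReachIn (s \ S) u w) :
    (∀ (hw : w ∈ coreNodes T s) (hwS : w ∉ S),
      ((G.coreGraph T s).induce {v : {v : V // v ∈ coreNodes T s} | (v : V) ∉ S}).Reachable ⟨⟨u, hu⟩, huS⟩ ⟨⟨w, hw⟩, hwS⟩) ∧
    (∀ t ∈ T, t ⊂ s → w ∈ t → (∀ r ∈ T, r ⊂ s → ¬ t ⊂ r) →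
      ∃ (y : V) (hy : y ∈ coreNodes T s) (hyS : y ∉ S),
      ((G.coreGraph T s).induce {v : {v : V // v ∈ coreNodes T s} | (v : V) ∉ S}).Reachable ⟨⟨u, hu⟩, huS⟩ ⟨⟨y, hy⟩, hyS⟩ ∧
        ∃ a ∈ t, G.Adj y a) := by
  induction h with
  | refl =>
    exact ⟨fun _ _ => Reachable.refl _,
      fun t ht hts hut _ => absurd hut ((mem_coreNodes.1 hu).2 t ht hts)⟩
  | @tail b c hb hbc ih =>
    obtain ⟨hbs, hcs, hadj⟩ := hbc
    rw [Finset.mem_sdiff] at hbs hcs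
    by_cases hbc : b ∈ coreNodes T s
    · have hbr := ih.1 hbc hbs.2
      refine ⟨fun hc hcS => hbr.trans (Adj.reachable ?_), fun t ht hts hct _ =>
        ⟨b, hbc, hbs.2, hbr, c, hct, hadj⟩⟩
      exact ⟨fun h => hadj.ne (congrArg Subtype.val h), Or.inl hadj⟩
    · obtain ⟨t, ht, hts, hbt, hmax⟩ := exists_maximal_of_notMem_coreNodes hbs.1 hbc
      obtain ⟨y, hy, hyS, hr, a, ha, hya⟩ := ih.2 t ht hts hbt hmax
      constructor
      · intro hc hcS
        by_cases hyc : y = c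
        · subst hyc
          exact hr
        · refine hr.trans (Adj.reachable ?_)
          exact ⟨fun h => hyc (congrArg Subtype.val h),
            Or.inr ⟨t, ht, hts, ⟨a, ha, hya⟩, ⟨b, hbt, hadj.symm⟩⟩⟩
      · intro t' ht' hts' hct' hmax'
        have : t = t' := by
          by_contra hne
          rcases (hT.compatible t ht t' ht' hne).comparable hbt hct' (Or.inr hadj) with h | h
          · exact hmax t' ht' hts' h
          · exact hmax' t ht hts h
        subst this
        exact ⟨y, hy, hyS, hr, a, ha, hya⟩

theorem coreGraph_induce_reachable_iff (hT : G.IsTubing T) {s S : Finset V}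
    (hS : S ⊆ coreNodes T s) {u w : V} (hu : u ∈ coreNodes T s) (huS : u ∉ S)
    (hw : w ∈ coreNodes T s) (hwS : w ∉ S) :
    ((G.coreGraph T s).induce {v : {v : V // v ∈ coreNodes T s} | (v : V) ∉ S}).Reachable ⟨⟨u, hu⟩, huS⟩ ⟨⟨w, hw⟩, hwS⟩ ↔
      G.ReachIn (s \ S) u w := by
  refine ⟨fun h => ?_, fun h => (coreGraph_reachable_of_reachIn hT hu huS h).1 hw hwS⟩
  have key : ∀ x y : {v : {v : V // v ∈ coreNodes T s} | (v : V) ∉ S},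
      Relation.ReflTransGen ((G.coreGraph T s).induce {v : {v : V // v ∈ coreNodes T s} | (v : V) ∉ S}).Adj x y →
      G.ReachIn (s \ S) (x : {v : V // v ∈ coreNodes T s}) (y : {v : V // v ∈ coreNodes T s}) := by
    intro x y hxy
    induction hxy with
    | refl => exact ReachIn.refl _
    | @tail b c _ hbc ih => exact ih.trans (coreGraph_adj_reachIn hT hS b.2 c.2 hbc)
  rw [reachable_iff_reflTransGen] at h
  exact key _ _ h

/-- The connectivity of a core depends only on its set of nodes. -/
theorem coreConnectivity_eq (hT : G.IsTubing T) (s : Finset V) :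
    G.coreConnectivity T s = G.relConn (coreNodes T s) s := by
  unfold coreConnectivity vertexConnectivity relConn
  congr 1
  ext k
  simp only [Set.mem_ofPred_eq]
  constructor
  · rintro ⟨S, hSk, h⟩
    have hmem : ∀ v (hv : v ∈ coreNodes T s), v ∈ S.map (Function.Embedding.subtype _) ↔
        (⟨v, hv⟩ : {v : V // v ∈ coreNodes T s}) ∈ S := by
      intro v hv
      simp [hv]
    have hSU : S.map (Function.Embedding.subtype _) ⊆ coreNodes T s := by
      intro v hv
      obtain ⟨x, -, rfl⟩ := Finset.mem_map.1 hv
      exact x.2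
    refine ⟨S.map (Function.Embedding.subtype _), hSU, by simpa using hSk, ?_⟩
    rcases h with h | h
    · left
      simp only [Preconnected, not_forall] at h
      obtain ⟨⟨⟨u, hu⟩, huS⟩, ⟨⟨w, hw⟩, hwS⟩, h⟩ := h
      have huS' : u ∉ S.map (Function.Embedding.subtype _) := by rw [hmem u hu]; exact huS
      have hwS' : w ∉ S.map (Function.Embedding.subtype _) := by rw [hmem w hw]; exact hwS
      refine ⟨u, Finset.mem_sdiff.2 ⟨hu, huS'⟩, w, Finset.mem_sdiff.2 ⟨hw, hwS'⟩, fun hr => h ?_⟩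
      have h2 := (coreGraph_induce_reachable_iff hT hSU hu huS' hw hwS').2 hr
      have e : {v : {v : V // v ∈ coreNodes T s} | v ∉ S} =
          {v : {v : V // v ∈ coreNodes T s} | (v : V) ∉ S.map (Function.Embedding.subtype _)} := by
        ext ⟨v, hv⟩
        simp only [Set.mem_ofPred_eq]
        rw [hmem v hv]
      -- The node sets are generalized so that their equality can be substituted inside the
      -- subtypes.
      have key : ∀ (A B : Set {v : V // v ∈ coreNodes T s}) (_ : A = B)
          (x y : {v : V // v ∈ coreNodes T s}) (hx : x ∈ A) (hy : y ∈ A) (hx' : x ∈ B)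
          (hy' : y ∈ B), ((G.coreGraph T s).induce B).Reachable ⟨x, hx'⟩ ⟨y, hy'⟩ →
          ((G.coreGraph T s).induce A).Reachable ⟨x, hx⟩ ⟨y, hy⟩ := by
        rintro A _ rfl x y hx hy hx' hy' h
        exact h
      exact key _ _ e _ _ _ _ _ _ h2
    · right
      simpa using h
  · rintro ⟨S, hSU, hSk, h⟩
    have hmem : ∀ v : {v : V // v ∈ coreNodes T s}, v ∈ S.subtype (· ∈ coreNodes T s) ↔ (v : V) ∈ S := by
      intro v
      simp
    have hcard : (S.subtype (· ∈ coreNodes T s)).card = S.card := by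
      rw [Finset.card_subtype, Finset.filter_true_of_mem hSU]
    refine ⟨S.subtype (· ∈ coreNodes T s), hcard.trans hSk, ?_⟩
    rcases h with ⟨u, hu, w, hw, h⟩ | h
    · left
      rw [Finset.mem_sdiff] at hu hw
      intro hp
      apply h
      rw [← coreGraph_induce_reachable_iff hT hSU hu.1 hu.2 hw.1 hw.2]
      have e : {v : {v : V // v ∈ coreNodes T s} | v ∉ S.subtype (· ∈ coreNodes T s)} =
          {v : {v : V // v ∈ coreNodes T s} | (v : V) ∉ S} := by
        ext v
        simp only [Set.mem_ofPred_eq]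
        rw [hmem v]
      rw [e] at hp
      exact hp _ _
    · right
      rw [hcard]
      simpa using h

end SimpleGraph

namespace SimpleGraph

variable {V : Type*} [Fintype V] [DecidableEq V] {G : SimpleGraph V} {T : Finset (Finset V)}
  {s t : Finset V}

/-! ### Adding a tube to a tubing -/

variable (G) in
/-- `t` is a new tube that is compatible with the tubes of `T`, and `s` is its parent. -/
structure IsAddable (T : Finset (Finset V)) (t s : Finset V) : Prop where
  isTubing : G.IsTubing (insert t T)
  notMem : t ∉ T
  isParent : IsParent T t s

theorem IsAddable.isTubing_base (h : G.IsAddable T t s) : G.IsTubing T :=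
  h.isTubing.mono (Finset.subset_insert _ _)

theorem IsAddable.isTube (h : G.IsAddable T t s) : G.IsTube t :=
  h.isTubing.isTube t (Finset.mem_insert_self _ _)

theorem IsAddable.isConn (h : G.IsAddable T t s) : G.IsConn t := (isTube_iff.1 h.isTube).2

theorem IsAddable.ne_univ (h : G.IsAddable T t s) : t ≠ Finset.univ := h.isTube.1

theorem IsAddable.ne (h : G.IsAddable T t s) : s ≠ t := fun hst =>
  ssubset_irrefl _ (hst ▸ h.isParent.ssubset)

theorem IsAddable.notMem_insert (h : G.IsAddable T t s) : t ∉ insert Finset.univ T := by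
  rw [Finset.mem_insert, not_or]
  exact ⟨h.ne_univ, h.notMem⟩

theorem IsAddable.compatible (h : G.IsAddable T t s) {r : Finset V}
    (hr : r ∈ insert Finset.univ T) : G.TubesCompatible t r := by
  have hne : t ≠ r := by rintro rfl; exact h.notMem_insert hr
  refine h.isTubing.compatible' (by simp) ?_ hne
  rw [Finset.insert_comm]
  exact Finset.mem_insert_of_mem hr

theorem IsTubing.isAddable (hT : G.IsTubing T) (ht : G.IsTube t) (htT : t ∉ T)
    (hc : ∀ r ∈ T, G.TubesCompatible t r) (hs : IsParent T t s) : G.IsAddable T t s :=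
  ⟨hT.insert_tube ht fun r hr _ => hc r hr, htT, hs⟩

theorem IsTubing.exists_isAddable (hT : G.IsTubing (insert t T)) (ht : t ∉ T) :
    ∃ s, G.IsAddable T t s := by
  have h := isTube_iff.1 (hT.isTube t (Finset.mem_insert_self _ _))
  obtain ⟨s, hs⟩ := (hT.mono (Finset.subset_insert _ _)).exists_parent h.2.1 h.1
  exact ⟨s, hT, ht, hs⟩

theorem IsTubing.exists_isAddable_erase (hT : G.IsTubing T) (ht : t ∈ T) :
    ∃ s, G.IsAddable (T.erase t) t s :=
  IsTubing.exists_isAddable (by rwa [Finset.insert_erase ht]) (Finset.notMem_erase _ _)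

/-- A node of the parent that is adjacent to `t` lies in `t` or in the core of the parent. -/
theorem IsAddable.mem_of_adj (h : G.IsAddable T t s) {p q : V} (hp : p ∈ t) (hq : q ∈ s)
    (hqU : q ∉ coreNodes T s \ t) (hpq : G.Adj p q) : q ∈ t := by
  by_contra hqt
  obtain ⟨r, hr, hrs, hqr⟩ := exists_of_notMem_coreNodes hq
    (fun hU => hqU (Finset.mem_sdiff.2 ⟨hU, hqt⟩))
  rcases (h.compatible (Finset.mem_insert_of_mem hr)).comparable hp hqr (Or.inr hpq) with h' | h'
  · exact hrs.2 (h.isParent.le r (Finset.mem_insert_of_mem hr) h')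
  · exact hqt (h'.1 hqr)

theorem IsAddable.inter_nonempty (hG : G.Connected) (h : G.IsAddable T t s) :
    (coreNodes T s ∩ t).Nonempty := by
  rw [← h.isParent.coreNodes_self h.isTubing h.notMem]
  exact h.isTubing.coreNodes_nonempty hG (by simp)

theorem IsAddable.sdiff_nonempty (hG : G.Connected) (h : G.IsAddable T t s) :
    (coreNodes T s \ t).Nonempty := by
  rw [← h.isParent.coreNodes_parent]
  refine h.isTubing.coreNodes_nonempty hG ?_
  rw [Finset.insert_comm]
  exact Finset.mem_insert_of_mem h.isParent.mem

/-- A new tube is determined by its parent and by the core nodes in it. -/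
theorem IsAddable.eq_comp (h : G.IsAddable T t s) {u : V} (hu : u ∈ t) :
    t = G.comp (s \ (coreNodes T s \ t)) u := by
  have ht : t ⊆ s \ (coreNodes T s \ t) := fun x hx => Finset.mem_sdiff.2
    ⟨h.isParent.ssubset.1 hx, fun hx' => (Finset.mem_sdiff.1 hx').2 hx⟩
  refine (h.isConn.subset_comp ht hu (self_mem_comp (ht hu))).antisymm fun x hx => ?_
  refine (mem_comp.1 hx).2.mem_of_closed hu fun p hp q hq _ hpq => ?_
  rw [Finset.mem_sdiff] at hq
  exact h.mem_of_adj hp hq.1 hq.2 hpq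

/-- A component of a part of `s` that contains all nodes outside the core is a new tube. -/
theorem IsTubing.isAddable_comp (hT : G.IsTubing T) (hs : s ∈ insert Finset.univ T)
    {R : Finset V} (hR : R ⊂ s) (hD : s \ coreNodes T s ⊆ R) {u : V} (hu : u ∈ R)
    (hU : u ∈ coreNodes T s) : G.IsAddable T (G.comp R u) s := by
  have hts : G.comp R u ⊂ s := (comp_subset (G := G) (R := R)).trans_ssubset hR
  have hut : u ∈ G.comp R u := self_mem_comp hu
  have hnot : ∀ r ∈ T, r ⊂ s → u ∉ r := (mem_coreNodes.1 hU).2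
  have hmem : G.comp R u ∉ T := fun h => hnot _ h hts hut
  have hle : ∀ r ∈ insert Finset.univ T, u ∈ r → s ⊆ r := by
    intro r hr hur
    by_cases hne : s = r
    · exact hne.subset
    rcases (hT.compatible' hs hr hne).comparable (hts.1 hut) hur (Or.inl rfl) with h | h
    · exact h.1
    · rcases Finset.mem_insert.1 hr with rfl | hr
      · exact Finset.subset_univ _
      · exact absurd hur (hnot r hr h)
  refine hT.isAddable (isTube_iff.2 ⟨fun h => ?_, isConn_comp hu⟩) hmem (fun r hr => ?_)
    ⟨hs, hts, fun r hr htr => hle r hr (htr.1 hut)⟩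
  · exact hts.2 (h ▸ Finset.subset_univ s)
  · by_cases hrs : r = s
    · subst hrs
      exact Or.inl hts
    rcases hT.compatible' (Finset.mem_insert_of_mem hr) hs hrs with h | h | ⟨h, h'⟩
    · have hrR : r ⊆ R := fun x hx => hD (Finset.mem_sdiff.2 ⟨h.1 hx,
        fun hxU => (mem_coreNodes.1 hxU).2 r hr h hx⟩)
      by_cases hm : ∃ p ∈ r, p ∈ G.comp R u
      · obtain ⟨p, hp, hpc⟩ := hm
        refine Or.inr (Or.inl (((isTube_iff.1 (hT.isTube r hr)).2.subset_comp hrR hp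
          hpc).ssubset_of_ne ?_))
        rintro rfl
        exact hmem hr
      · push Not at hm
        exact Or.inr (Or.inr ⟨Finset.disjoint_right.2 hm,
          fun a ha b hb hab => hm b hb (comp_closed ha (hrR hb) hab)⟩)
    · exact Or.inl (hts.trans h)
    · exact Or.inr (Or.inr ⟨(h.mono_right hts.1).symm,
        fun a ha b hb hab => h' b hb a (hts.1 ha) hab.symm⟩)

/-! ### Connectivity of cores and new tubes -/

/-- A set that separates two nodes of the smaller core in `s` separates the same nodes of the larger
one. If the minimum is not attained by separation, the second alternative holds; it says that the
inner block of `s` after adding `t` has at most one color. -/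
theorem IsAddable.relConn_le_parent (_h : G.IsAddable T t s) :
    G.relConn (coreNodes T s) s ≤ G.relConn (coreNodes T s \ t) s ∨
      (coreNodes T s \ t).card ≤ G.relConn (coreNodes T s \ t) s + 1 := by
  obtain ⟨S, hS, hSc, ⟨u, hu, w, hw, h'⟩ | h'⟩ := G.exists_relConn (coreNodes T s \ t) s
  · left
    rw [← hSc]
    have hsub := Finset.sdiff_subset_sdiff (Finset.sdiff_subset (s := coreNodes T s) (t := t))
      (subset_refl S)
    exact relConn_le (hS.trans Finset.sdiff_subset) (Or.inl ⟨u, hsub hu, w, hsub hw, h'⟩)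
  · right
    rwa [← hSc]

/-- Inside `s`, the tube `t` can be left only through core nodes of `s` (`mem_of_adj`). So a
separating set of the core of `t`, together with all core nodes outside `t`, separates the core of
`s`. The lower bound holds because `t` is connected; it makes the truncated `k - 1` exact. The
second alternative leaves `t` at most one inner color. -/
theorem IsAddable.relConn_le_add (h : G.IsAddable T t s) :
    (1 ≤ G.relConn (coreNodes T s ∩ t) t ∧ G.relConn (coreNodes T s) s ≤
      (coreNodes T s \ t).card + G.relConn (coreNodes T s ∩ t) t) ∨
      (coreNodes T s ∩ t).card ≤ G.relConn (coreNodes T s ∩ t) t + 1 := by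
  obtain ⟨S, hS, hSc, ⟨u, hu, w, hw, h'⟩ | h'⟩ := G.exists_relConn (coreNodes T s ∩ t) t
  · left
    simp only [Finset.mem_sdiff, Finset.mem_inter] at hu hw
    rw [← hSc]
    constructor
    · rw [Nat.one_le_iff_ne_zero, Ne, Finset.card_eq_zero]
      rintro rfl
      exact h' (by simpa using h.isConn.2 u hu.1.2 w hw.1.2)
    · have hdisj : Disjoint (coreNodes T s \ t) S := Finset.disjoint_left.2 fun x hx hxS =>
        (Finset.mem_sdiff.1 hx).2 (Finset.mem_inter.1 (hS hxS)).2
      rw [← Finset.card_union_of_disjoint hdisj]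
      refine relConn_le (Finset.union_subset Finset.sdiff_subset
        (hS.trans Finset.inter_subset_left)) (Or.inl ⟨u, ?_, w, ?_, fun hr => h' ?_⟩)
      · simp [hu]
      · simp [hw]
      · have hmem := hr.mem_of_closed (X := G.comp (t \ S) u)
          (self_mem_comp (Finset.mem_sdiff.2 ⟨hu.1.2, hu.2⟩)) ?_
        · exact (mem_comp.1 hmem).2
        · intro p hp q hq _ hpq
          simp only [Finset.mem_sdiff (s := s), Finset.mem_union, not_or] at hq
          exact comp_closed hp (Finset.mem_sdiff.2 ⟨h.mem_of_adj
            (Finset.mem_sdiff.1 (comp_subset hp)).1 hq.1 hq.2.1 hpq, hq.2.2⟩) hpq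
  · right
    rwa [← hSc]

/-- Deleting the core nodes outside both tubes leaves no exit from `t₁`, while each tube retains a
core node. -/
theorem IsAddable.relConn_le_of_disjoint (hG : G.Connected) {t₁ t₂ : Finset V}
    (h₁ : G.IsAddable T t₁ s) (h₂ : G.IsAddable T t₂ s) (hd : Disjoint t₁ t₂)
    (hn : ∀ a ∈ t₁, ∀ b ∈ t₂, ¬ G.Adj a b) :
    G.relConn (coreNodes T s) s ≤ ((coreNodes T s \ t₁) \ t₂).card := by
  obtain ⟨u, hu⟩ := h₁.inter_nonempty hG
  obtain ⟨w, hw⟩ := h₂.inter_nonempty hG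
  rw [Finset.mem_inter] at hu hw
  refine relConn_le (Finset.sdiff_subset.trans Finset.sdiff_subset)
    (Or.inl ⟨u, ?_, w, ?_, fun hr => ?_⟩)
  · simp [hu]
  · simp [hw]
  · refine Finset.disjoint_left.1 hd (hr.mem_of_closed hu.2 fun p hp q hq _ hpq => ?_) hw.2
    simp only [Finset.mem_sdiff, not_and, not_not] at hq
    by_cases hqt : q ∈ t₂
    · exact absurd hpq (hn p hp q hqt)
    · refine h₁.mem_of_adj hp hq.1 (fun hqU => ?_) hpq
      rw [Finset.mem_sdiff] at hqU
      exact hqt (hq.2 ⟨hqU.1, hqU.2⟩)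

end SimpleGraph

/-! ### Listings of color blocks -/

namespace ColorBlocks

variable {C : Type*} {b b' : ColorBlocks C} {ℓ ℓ' : List C}

/-- The color of the tube and the outer colors, in order. -/
def pre (b : ColorBlocks C) : List C := b.color.toList ++ b.outer

theorem isListing_iff : b.IsListing ℓ ↔ ∃ m : List C, (m : Multiset C) = b.inner ∧
    ℓ = b.pre ++ m := Iff.rfl

theorem exists_isListing (b : ColorBlocks C) : ∃ ℓ, b.IsListing ℓ := by
  obtain ⟨m, hm⟩ := Quot.exists_rep b.inner
  exact ⟨_, m, hm, rfl⟩

theorem IsListing.coe_eq (h : b.IsListing ℓ) : (ℓ : Multiset C) = b.colors := by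
  obtain ⟨m, hm, rfl⟩ := h
  rw [colors, ← hm]
  simp

theorem IsListing.length_eq (h : b.IsListing ℓ) : ℓ.length = b.pre.length + b.inner.card := by
  obtain ⟨m, hm, rfl⟩ := h
  simp [pre, ← hm, Nat.add_assoc]

theorem IsListing.perm (h : b.IsListing ℓ) (h' : b.IsListing ℓ') : ℓ.Perm ℓ' :=
  Multiset.coe_eq_coe.1 (h.coe_eq.trans h'.coe_eq.symm)

theorem IsListing.eq_of_card_inner_le_one (h : b.IsListing ℓ) (h' : b.IsListing ℓ')
    (hb : b.inner.card ≤ 1) : ℓ = ℓ' := by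
  obtain ⟨m, hm, rfl⟩ := h
  obtain ⟨m', hm', rfl⟩ := h'
  congr 1
  rw [← hm, Multiset.coe_card] at hb
  have hp : m.Perm m' := Multiset.coe_eq_coe.1 (hm.trans hm'.symm)
  match m, hb, hp with
  | [], _, hp => exact hp.nil_eq
  | [a], _, hp => exact (List.perm_singleton.1 hp.symm).symm

/-- Only the inner part of a listing can vary, so whatever is appended, entries within the ordered
blocks are forced. -/
theorem IsListing.take_eq (h : b.IsListing ℓ) (h' : b.IsListing ℓ') {p : ℕ}
    (hp : p ≤ b.pre.length) (r r' : List C) : (ℓ ++ r).take p = (ℓ' ++ r').take p := by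
  obtain ⟨m, -, rfl⟩ := isListing_iff.1 h
  obtain ⟨m', -, rfl⟩ := isListing_iff.1 h'
  rw [List.append_assoc, List.append_assoc, List.take_append_of_le_length hp,
    List.take_append_of_le_length hp]

/-- Conversely, a rearrangement that keeps the ordered part can only have shuffled inner colors. -/
theorem IsListing.congr (h : b.IsListing ℓ) (hp : ℓ.Perm ℓ')
    (ht : ℓ.take b.pre.length = ℓ'.take b.pre.length) : b.IsListing ℓ' := by
  obtain ⟨m, hm, rfl⟩ := isListing_iff.1 h
  rw [List.take_left'] at ht
  · have hl : ℓ' = b.pre ++ ℓ'.drop b.pre.length := by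
      conv_lhs => rw [← List.take_append_drop b.pre.length ℓ', ← ht]
    refine isListing_iff.2 ⟨ℓ'.drop b.pre.length, ?_, hl⟩
    rw [hl, List.perm_append_left_iff] at hp
    rw [← hm]
    exact (Multiset.coe_eq_coe.2 hp).symm
  · rfl

theorem eq_of_isListing (hc : b.color.isSome = b'.color.isSome)
    (ho : b.outer.length = b'.outer.length) (h : b.IsListing ℓ) (h' : b'.IsListing ℓ) :
    b = b' := by
  obtain ⟨m, hm, rfl⟩ := h
  obtain ⟨m', hm', he⟩ := h'
  rw [List.append_assoc, List.append_assoc] at he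
  obtain ⟨h1, h2⟩ := List.append_inj he (by
    cases hb : b.color <;> cases hb' : b'.color <;> simp_all)
  obtain ⟨h2, h3⟩ := List.append_inj h2 ho
  ext1
  · cases hb : b.color <;> cases hb' : b'.color <;> simp_all
  · exact h2
  · rw [← hm, ← hm', h3]

theorem IsListing.eq_cons (h : b.IsListing ℓ) {c : C} (hc : b.color = some c) :
    ∃ ℓ', ℓ = c :: ℓ' := by
  obtain ⟨m, -, rfl⟩ := h
  exact ⟨b.outer ++ m, by simp [hc]⟩

theorem IsListing.color_eq {c : C} (h : b.IsListing (c :: ℓ)) (hc : b.color.isSome) :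
    b.color = some c := by
  obtain ⟨d, hd⟩ := Option.isSome_iff_exists.1 hc
  obtain ⟨ℓ', h'⟩ := h.eq_cons hd
  rw [hd, (List.cons.inj h').1]

end ColorBlocks

namespace SimpleGraph

variable {V : Type*} [Fintype V] [DecidableEq V] {G : SimpleGraph V} {C : Type*}

/-! ### Blocks that fit a core -/

/-- The number of colors of the set `r` itself: none if `r` is the universal tube. -/
def ownColor (r : Finset V) : ℕ := if r = Finset.univ then 0 else 1

variable (G) in
/-- The blocks `b` have the shape prescribed for a tube `r` with core nodes `U`. -/
structure FitsCore (U r : Finset V) (b : ColorBlocks C) : Prop where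
  color_isSome : b.color.isSome = decide (r ≠ Finset.univ)
  length_outer : b.outer.length = G.relConn U r - 1
  card_inner : b.inner.card = (U.card - 1) - (G.relConn U r - 1)

variable {U r : Finset V} {b b' : ColorBlocks C} {ℓ : List C}

theorem FitsCore.length_color (h : G.FitsCore U r b) : b.color.toList.length = ownColor r := by
  have := h.color_isSome
  unfold ownColor
  cases hb : b.color <;> by_cases hr : r = Finset.univ <;> simp_all

theorem FitsCore.length_pre (h : G.FitsCore U r b) :
    b.pre.length = ownColor r + (G.relConn U r - 1) := by
  rw [ColorBlocks.pre, List.length_append, h.length_color, h.length_outer]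

theorem FitsCore.length_listing (h : G.FitsCore U r b) (hℓ : b.IsListing ℓ) :
    ℓ.length = ownColor r + (U.card - 1) := by
  rw [hℓ.length_eq, h.length_pre, h.card_inner]
  have := G.relConn_le_card_sub_one U r
  omega

theorem FitsCore.eq (h : G.FitsCore U r b) (h' : G.FitsCore U r b') (hℓ : b.IsListing ℓ)
    (hℓ' : b'.IsListing ℓ) : b = b' :=
  ColorBlocks.eq_of_isListing (h.color_isSome.trans h'.color_isSome.symm)
    (h.length_outer.trans h'.length_outer.symm) hℓ hℓ'

variable (G) in
theorem exists_fitsCore (U r : Finset V) (ℓ : List C) (hℓ : ℓ.length = ownColor r + (U.card - 1)) :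
    ∃ b : ColorBlocks C, G.FitsCore U r b ∧ b.IsListing ℓ := by
  have hk := G.relConn_le_card_sub_one U r
  by_cases hr : r = Finset.univ
  · rw [ownColor, if_pos hr] at hℓ
    refine ⟨⟨none, ℓ.take (G.relConn U r - 1), ℓ.drop (G.relConn U r - 1)⟩, ⟨?_, ?_, ?_⟩,
      ℓ.drop (G.relConn U r - 1), rfl, ?_⟩
    · simp [hr]
    · rw [List.length_take]; omega
    · rw [Multiset.coe_card, List.length_drop]; omega
    · simp
  · rw [ownColor, if_neg hr] at hℓ
    obtain ⟨c, ℓ, rfl⟩ : ∃ c ℓ', ℓ = c :: ℓ' := by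
      cases ℓ with
      | nil => simp at hℓ; omega
      | cons c ℓ' => exact ⟨c, ℓ', rfl⟩
    rw [List.length_cons] at hℓ
    refine ⟨⟨some c, ℓ.take (G.relConn U r - 1), ℓ.drop (G.relConn U r - 1)⟩, ⟨?_, ?_, ?_⟩,
      ℓ.drop (G.relConn U r - 1), rfl, ?_⟩
    · simp [hr]
    · rw [List.length_take]; omega
    · rw [Multiset.coe_card, List.length_drop]; omega
    · simp

namespace ColorTemplate

variable {P : Multiset C} {x y y' z : G.ColorTemplate P} {s t : Finset V}

theorem fitsCore (x : G.ColorTemplate P) (hr : r ∈ insert Finset.univ x.tubing.tubes) :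
    G.FitsCore (coreNodes x.tubing.tubes r) r (x.blocks r) := by
  have hk := coreConnectivity_eq x.tubing.isTubing r
  refine ⟨?_, by rw [x.length_outer r hr, hk], by rw [x.card_inner r hr, hk]⟩
  by_cases h : r = Finset.univ
  · subst h
    simp [x.color_univ]
  · simp [h, x.color_tube r ((Finset.mem_insert.1 hr).resolve_left h)]

/-- A template is given by blocks that fit the cores of a tubing. -/
theorem exists_of_fitsCore (T : G.Tubing) (f : Finset V → ColorBlocks C)
    (h0 : ∀ r, r ∉ insert Finset.univ T.tubes → f r = ColorBlocks.empty)
    (hf : ∀ r ∈ insert Finset.univ T.tubes, G.FitsCore (coreNodes T.tubes r) r (f r))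
    (hP : ∑ r ∈ insert Finset.univ T.tubes, (f r).colors = P) :
    ∃ x : G.ColorTemplate P, x.tubing = T ∧ x.blocks = f := by
  refine ⟨⟨T, f, h0, ?_, ?_, ?_, ?_, hP⟩, rfl, rfl⟩
  · have := (hf Finset.univ (by simp)).color_isSome
    simpa using this
  · intro t ht
    rw [(hf t (Finset.mem_insert_of_mem ht)).color_isSome]
    simpa using (T.isTube t ht).1
  · intro t ht
    rw [(hf t ht).length_outer, coreConnectivity_eq T.isTubing]
  · intro t ht
    rw [(hf t ht).card_inner, coreConnectivity_eq T.isTubing]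

theorem blocks_eq_of_isListing (hT : x.tubing.tubes = y.tubing.tubes)
    (hr : r ∈ insert Finset.univ y.tubing.tubes) (hx : (x.blocks r).IsListing ℓ)
    (hy : (y.blocks r).IsListing ℓ) : x.blocks r = y.blocks r := by
  have h := x.fitsCore (r := r) (by rwa [hT])
  rw [hT] at h
  exact h.eq (y.fitsCore hr) hx hy

theorem eq_of_blocks (hT : x.tubing.tubes = y.tubing.tubes)
    (h : ∀ r ∈ insert Finset.univ y.tubing.tubes, x.blocks r = y.blocks r) : x = y := by
  refine ColorTemplate.ext (Tubing.ext hT) (funext fun r => ?_)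
  by_cases hr : r ∈ insert Finset.univ y.tubing.tubes
  · exact h r hr
  · rw [y.blocks_eq_empty r hr, x.blocks_eq_empty r (by rwa [hT])]

/-! ### Steps -/

/-- `x` is obtained from `y` by adding the tube `t` with parent `s`. -/
structure StepVia (x y : G.ColorTemplate P) (t s : Finset V) : Prop where
  isAddable : G.IsAddable y.tubing.tubes t s
  tubes_eq : x.tubing.tubes = insert t y.tubing.tubes
  blocks_eq : ∀ r, r ≠ t → r ≠ s → x.blocks r = y.blocks r
  exists_isListing : ∃ ℓ₁ ℓ₂ : List C, (y.blocks s).IsListing (ℓ₁ ++ ℓ₂) ∧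
      (x.blocks s).IsListing ℓ₁ ∧ (x.blocks t).IsListing ℓ₂

theorem step_iff : Step x y ↔ ∃ t s, StepVia x y t s := by
  constructor
  · rintro ⟨t, s, ht, hx, hs, hts, hle, hb, hℓ⟩
    exact ⟨t, s, ⟨hx ▸ x.tubing.isTubing, ht, hs, hts, hle⟩, hx, hb, hℓ⟩
  · rintro ⟨t, s, h, hx, hb, hℓ⟩
    exact ⟨t, s, h.notMem, hx, h.isParent.mem, h.isParent.ssubset, h.isParent.le, hb, hℓ⟩

theorem StepVia.le (h : StepVia x y t s) : x ≤ y :=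
  Relation.ReflTransGen.single (step_iff.2 ⟨t, s, h⟩)

theorem StepVia.mem (h : StepVia x y t s) : t ∈ x.tubing.tubes := by
  rw [h.tubes_eq]
  exact Finset.mem_insert_self _ _

theorem StepVia.erase_eq (h : StepVia x y t s) : x.tubing.tubes.erase t = y.tubing.tubes := by
  rw [h.tubes_eq, Finset.erase_insert h.isAddable.notMem]

theorem StepVia.parent_mem (h : StepVia x y t s) : s ∈ insert Finset.univ x.tubing.tubes := by
  rw [h.tubes_eq, Finset.insert_comm]
  exact Finset.mem_insert_of_mem h.isAddable.isParent.mem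

theorem StepVia.fitsCore_parent (h : StepVia x y t s) :
    G.FitsCore (coreNodes y.tubing.tubes s \ t) s (x.blocks s) := by
  have := x.fitsCore h.parent_mem
  rwa [h.tubes_eq, h.isAddable.isParent.coreNodes_parent] at this

theorem StepVia.fitsCore_self (h : StepVia x y t s) :
    G.FitsCore (coreNodes y.tubing.tubes s ∩ t) t (x.blocks t) := by
  have := x.fitsCore (Finset.mem_insert_of_mem h.mem)
  rwa [h.tubes_eq, h.isAddable.isParent.coreNodes_self h.isAddable.isTubing
    h.isAddable.notMem] at this

/-- The blocks of the parent in the larger face do not depend on the chosen listings. -/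
theorem StepVia.isListing (h : StepVia x y t s) {ℓ₁ ℓ₂ : List C}
    (h₁ : (x.blocks s).IsListing ℓ₁) (h₂ : (x.blocks t).IsListing ℓ₂) :
    (y.blocks s).IsListing (ℓ₁ ++ ℓ₂) := by
  obtain ⟨m₁, m₂, hm, hm₁, hm₂⟩ := h.exists_isListing
  refine hm.congr ((hm₁.perm h₁).append (hm₂.perm h₂)) ?_
  have hs := h.fitsCore_parent
  have ht := h.fitsCore_self
  have hp := (y.fitsCore h.isAddable.isParent.mem).length_pre
  have hps := hs.length_pre
  have hpt := ht.length_pre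
  have hot : ownColor t = 1 := if_neg h.isAddable.ne_univ
  -- Either the ordered part of `s` in `y` fits into that of `s` in `x`, or `s` has at most one
  -- inner color in `x` and only one listing.
  rcases h.isAddable.relConn_le_parent with hk | hk
  · exact hm₁.take_eq h₁ (by omega) _ _
  have e₁ : m₁ = ℓ₁ := hm₁.eq_of_card_inner_le_one h₁ (by rw [hs.card_inner]; omega)
  subst e₁
  have hl₁ := hs.length_listing h₁
  -- What the ordered part of `s` in `y` takes from the second list either stays within the ordered
  -- part of `t`, or `t` too has only one listing.
  rcases h.isAddable.relConn_le_add with ⟨hk1, hk'⟩ | hk'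
  · have e := hm₂.take_eq h₂ (p := (y.blocks s).pre.length - m₁.length) (by omega) [] []
    rw [List.append_nil, List.append_nil] at e
    rw [List.take_append, List.take_append, e]
  · rw [hm₂.eq_of_card_inner_le_one h₂ (by rw [ht.card_inner]; omega)]

/-- The concatenation of any listings of `s` and `t` in `x` lists `s` in both upper faces. Thus
removing a tube is an operation on templates. -/
theorem StepVia.right_unique {s' : Finset V} (h : StepVia x y t s) (h' : StepVia x y' t s') :
    y = y' := by
  have hT : y.tubing.tubes = y'.tubing.tubes := h.erase_eq.symm.trans h'.erase_eq
  have hs : s = s' := h.isAddable.isParent.eq (by rw [hT]; exact h'.isAddable.isParent)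
  subst hs
  refine eq_of_blocks hT fun r hr => ?_
  by_cases hrs : r = s
  · subst hrs
    obtain ⟨ℓ₁, h₁⟩ := (x.blocks r).exists_isListing
    obtain ⟨ℓ₂, h₂⟩ := (x.blocks t).exists_isListing
    exact blocks_eq_of_isListing hT hr (h.isListing h₁ h₂) (h'.isListing h₁ h₂)
  · have hrt : r ≠ t := by
      rintro rfl
      exact h'.isAddable.notMem_insert hr
    rw [← h.blocks_eq r hrt hrs, ← h'.blocks_eq r hrt hrs]

theorem sum_insert_eq {A : Finset (Finset V)} {f g : Finset V → Multiset C} (ht : t ∉ A)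
    (hs : s ∈ A) (hg : g s = f s + f t) (h : ∀ r ∈ A, r ≠ s → g r = f r) :
    ∑ r ∈ A, g r = ∑ r ∈ insert t A, f r := by
  rw [Finset.sum_insert ht, ← Finset.add_sum_erase A g hs, ← Finset.add_sum_erase A f hs, hg,
    Finset.sum_congr rfl (fun r hr => h r (Finset.mem_of_mem_erase hr) (Finset.ne_of_mem_erase hr))]
  abel

/-- Any tube of a template can be removed. -/
theorem exists_stepVia_of_mem (hG : G.Connected) (x : G.ColorTemplate P)
    (ht : t ∈ x.tubing.tubes) : ∃ y s, StepVia x y t s := by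
  obtain ⟨s, hs⟩ := x.tubing.isTubing.exists_isAddable_erase ht
  have hx : insert t (x.tubing.tubes.erase t) = x.tubing.tubes := Finset.insert_erase ht
  set Y := x.tubing.tubes.erase t with hY
  have hYT := hs.isTubing_base
  have hsx : s ∈ insert Finset.univ x.tubing.tubes := by
    rw [← hx, Finset.insert_comm]
    exact Finset.mem_insert_of_mem hs.isParent.mem
  have fs := x.fitsCore hsx
  have ft := x.fitsCore (Finset.mem_insert_of_mem ht)
  rw [← hx, hs.isParent.coreNodes_parent] at fs
  rw [← hx, hs.isParent.coreNodes_self hs.isTubing hs.notMem] at ft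
  obtain ⟨ℓ₁, h₁⟩ := (x.blocks s).exists_isListing
  obtain ⟨ℓ₂, h₂⟩ := (x.blocks t).exists_isListing
  have hot : ownColor t = 1 := if_neg hs.ne_univ
  -- The color of `t` itself makes up for subtracting one from two nonempty cores instead of one.
  have hlen : (ℓ₁ ++ ℓ₂).length = ownColor s + ((coreNodes Y s).card - 1) := by
    have e1 := fs.length_listing h₁
    have e2 := ft.length_listing h₂
    have e3 := (hs.sdiff_nonempty hG).card_pos
    have e4 := (hs.inter_nonempty hG).card_pos
    have e5 := Finset.card_sdiff_add_card_inter (coreNodes Y s) t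
    rw [List.length_append]
    omega
  obtain ⟨b, hb, hbℓ⟩ := G.exists_fitsCore (coreNodes Y s) s (ℓ₁ ++ ℓ₂) hlen
  obtain ⟨y, hyT, hyb⟩ := exists_of_fitsCore (P := P) (⟨Y, hYT.1, hYT.2⟩ : G.Tubing)
    (Function.update (Function.update x.blocks t ColorBlocks.empty) s b) (by
      intro r hr
      have hrs : r ≠ s := by rintro rfl; exact hr hs.isParent.mem
      rw [Function.update_of_ne hrs]
      by_cases hrt : r = t
      · subst hrt
        simp
      · rw [Function.update_of_ne hrt]
        apply x.blocks_eq_empty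
        rw [← hx, Finset.insert_comm, Finset.mem_insert, not_or]
        exact ⟨hrt, hr⟩) (by
      intro r hr
      by_cases hrs : r = s
      · subst hrs
        simpa using hb
      · have hrt : r ≠ t := by rintro rfl; exact hs.notMem_insert hr
        rw [Function.update_of_ne hrs, Function.update_of_ne hrt]
        have hr' : r ∈ insert Finset.univ x.tubing.tubes := by
          rw [← hx, Finset.insert_comm]
          exact Finset.mem_insert_of_mem hr
        have := x.fitsCore hr'
        rwa [← hx, hs.isParent.coreNodes_of_ne hr hrs] at this) (by
      refine Eq.trans ?_ x.sum_colors
      rw [← hx, Finset.insert_comm]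
      refine sum_insert_eq (s := s) hs.notMem_insert hs.isParent.mem ?_ ?_
      · rw [Function.update_self, ← hbℓ.coe_eq, ← h₁.coe_eq, ← h₂.coe_eq, Multiset.coe_add]
      · intro r hr hrs
        have hrt : r ≠ t := by rintro rfl; exact hs.notMem_insert hr
        rw [Function.update_of_ne hrs, Function.update_of_ne hrt])
  refine ⟨y, s, ?_, ?_, ?_, ℓ₁, ℓ₂, ?_, h₁, h₂⟩
  · rw [hyT]; exact hs
  · rw [hyT]; exact hx.symm
  · intro r hrt hrs
    rw [hyb, Function.update_of_ne hrs, Function.update_of_ne hrt]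
  · rw [hyb, Function.update_self]
    exact hbℓ

/-- A new tube can be added to a template, for any splitting of a listing of the parent. -/
theorem exists_stepVia_of_isAddable (hG : G.Connected) (y : G.ColorTemplate P)
    (hs : G.IsAddable y.tubing.tubes t s) {ℓ₁ ℓ₂ : List C}
    (hℓ : (y.blocks s).IsListing (ℓ₁ ++ ℓ₂))
    (hlen : ℓ₁.length = ownColor s + ((coreNodes y.tubing.tubes s \ t).card - 1)) :
    ∃ x, StepVia x y t s ∧ (x.blocks s).IsListing ℓ₁ ∧ (x.blocks t).IsListing ℓ₂ := by
  have hot : ownColor t = 1 := if_neg hs.ne_univ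
  have hlen₂ : ℓ₂.length = ownColor t + ((coreNodes y.tubing.tubes s ∩ t).card - 1) := by
    have e1 := (y.fitsCore hs.isParent.mem).length_listing hℓ
    have e3 := (hs.sdiff_nonempty hG).card_pos
    have e4 := (hs.inter_nonempty hG).card_pos
    have e5 := Finset.card_sdiff_add_card_inter (coreNodes y.tubing.tubes s) t
    rw [List.length_append] at e1
    omega
  obtain ⟨b₁, hb₁, hbℓ₁⟩ := G.exists_fitsCore _ s ℓ₁ hlen
  obtain ⟨b₂, hb₂, hbℓ₂⟩ := G.exists_fitsCore _ t ℓ₂ hlen₂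
  have hXT := hs.isTubing
  obtain ⟨x, hxT, hxb⟩ := exists_of_fitsCore (P := P)
    (⟨insert t y.tubing.tubes, hXT.1, hXT.2⟩ : G.Tubing)
    (Function.update (Function.update y.blocks t b₂) s b₁) (by
      intro r hr
      rw [Finset.insert_comm, Finset.mem_insert, not_or] at hr
      have hrs : r ≠ s := by rintro rfl; exact hr.2 hs.isParent.mem
      rw [Function.update_of_ne hrs, Function.update_of_ne hr.1]
      exact y.blocks_eq_empty r hr.2) (by
      intro r hr
      rw [Finset.insert_comm, Finset.mem_insert] at hr
      by_cases hrs : r = s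
      · subst hrs
        simpa [hs.isParent.coreNodes_parent] using hb₁
      · rw [Function.update_of_ne hrs]
        rcases hr with rfl | hr
        · simpa [hs.isParent.coreNodes_self hs.isTubing hs.notMem] using hb₂
        · have hrt : r ≠ t := by rintro rfl; exact hs.notMem_insert hr
          rw [Function.update_of_ne hrt]
          simpa [hs.isParent.coreNodes_of_ne hr hrs] using y.fitsCore hr) (by
      refine Eq.trans ?_ y.sum_colors
      rw [Finset.insert_comm]
      symm
      refine sum_insert_eq (s := s) hs.notMem_insert hs.isParent.mem ?_ ?_
      · rw [Function.update_self, Function.update_of_ne hs.ne.symm, Function.update_self,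
          ← hbℓ₁.coe_eq, ← hbℓ₂.coe_eq, ← hℓ.coe_eq, Multiset.coe_add]
      · intro r hr hrs
        have hrt : r ≠ t := by rintro rfl; exact hs.notMem_insert hr
        rw [Function.update_of_ne hrs, Function.update_of_ne hrt])
  have hx1 : (x.blocks s).IsListing ℓ₁ := by rw [hxb, Function.update_self]; exact hbℓ₁
  have hx2 : (x.blocks t).IsListing ℓ₂ := by
    rw [hxb, Function.update_of_ne hs.ne.symm, Function.update_self]
    exact hbℓ₂
  refine ⟨x, ⟨hs, ?_, ?_, ℓ₁, ℓ₂, hℓ, hx1, hx2⟩, hx1, hx2⟩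
  · rw [hxT]
  · intro r hrt hrs
    rw [hxb, Function.update_of_ne hrs, Function.update_of_ne hrt]

theorem exists_stepVia_of_isAddable' (hG : G.Connected) (y : G.ColorTemplate P)
    (hs : G.IsAddable y.tubing.tubes t s) : ∃ x, StepVia x y t s := by
  obtain ⟨ℓ, hℓ⟩ := (y.blocks s).exists_isListing
  have e1 := (y.fitsCore hs.isParent.mem).length_listing hℓ
  have e5 := Finset.card_sdiff_add_card_inter (coreNodes y.tubing.tubes s) t
  rw [← List.take_append_drop (ownColor s + ((coreNodes y.tubing.tubes s \ t).card - 1)) ℓ] at hℓ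
  obtain ⟨x, hx, -⟩ := exists_stepVia_of_isAddable hG y hs hℓ (by
    rw [List.length_take]
    omega)
  exact ⟨x, hx⟩

/-! ### Confluence -/

/-- With different parents, removing `t₂` leaves the blocks of `s₁` and `t₁` alone, so the same two
lists are merged in either order of removal. -/
theorem blocks_eq_of_two_steps {y₁ y₂ z z' : G.ColorTemplate P} {t₁ t₂ s₁ s₂ : Finset V}
    (h₁ : StepVia x y₁ t₁ s₁) (h₂ : StepVia x y₂ t₂ s₂) (hz : StepVia y₂ z t₁ s₁)
    (hz' : StepVia y₁ z' t₂ s₂) (hT : z.tubing.tubes = z'.tubing.tubes)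
    (hs : s₁ ≠ s₂) (h12 : s₁ ≠ t₂) (h21 : s₂ ≠ t₁) (hne : t₁ ≠ t₂) :
    z.blocks s₁ = z'.blocks s₁ := by
  obtain ⟨ℓ₁, hℓ₁⟩ := (x.blocks s₁).exists_isListing
  obtain ⟨ℓ₂, hℓ₂⟩ := (x.blocks t₁).exists_isListing
  refine blocks_eq_of_isListing (ℓ := ℓ₁ ++ ℓ₂) hT (hT ▸ hz.isAddable.isParent.mem) ?_ ?_
  · refine hz.isListing ?_ ?_
    · rwa [← h₂.blocks_eq _ h12 hs]
    · rwa [← h₂.blocks_eq _ hne h21.symm]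
  · rw [← hz'.blocks_eq _ h12 hs]
    exact h₁.isListing hℓ₁ hℓ₂

/-- Here neither tube is the parent of the other, so both parents survive. If the parents coincide,
the colors of the two tubes are appended in opposite orders. This is harmless because all outer
colors of the parent already come from its own list `ℓ`. -/
theorem StepVia.confluent_of_ne (hG : G.Connected) {y₁ y₂ : G.ColorTemplate P}
    {t₁ t₂ s₁ s₂ : Finset V} (h₁ : StepVia x y₁ t₁ s₁) (h₂ : StepVia x y₂ t₂ s₂) (hne : t₁ ≠ t₂)
    (h12 : s₁ ≠ t₂) (h21 : s₂ ≠ t₁) : ∃ z, StepVia y₁ z t₂ s₂ ∧ StepVia y₂ z t₁ s₁ := by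
  obtain ⟨z, a, hz⟩ := exists_stepVia_of_mem hG y₂ (t := t₁)
    (by rw [← h₂.erase_eq]; exact Finset.mem_erase.2 ⟨hne, h₁.mem⟩)
  obtain ⟨z', b, hz'⟩ := exists_stepVia_of_mem hG y₁ (t := t₂)
    (by rw [← h₁.erase_eq]; exact Finset.mem_erase.2 ⟨hne.symm, h₂.mem⟩)
  have hT : z.tubing.tubes = z'.tubing.tubes := by
    rw [← hz.erase_eq, ← hz'.erase_eq, ← h₂.erase_eq, ← h₁.erase_eq, Finset.erase_right_comm]
  have hzy₁ : y₁.tubing.tubes = insert t₂ z.tubing.tubes := by rw [hT, hz'.tubes_eq]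
  have hzy₂ : y₂.tubing.tubes = insert t₁ z.tubing.tubes := hz.tubes_eq
  have ha : a = s₁ := by
    refine hz.isAddable.isParent.eq ⟨?_, h₁.isAddable.isParent.ssubset, fun r hr => ?_⟩
    · have := h₁.isAddable.isParent.mem
      rw [hzy₁, Finset.insert_comm, Finset.mem_insert] at this
      exact this.resolve_left h12
    · refine h₁.isAddable.isParent.le r ?_
      rw [hzy₁, Finset.insert_comm]
      exact Finset.mem_insert_of_mem hr
  have hb : b = s₂ := by
    refine hz'.isAddable.isParent.eq ⟨?_, h₂.isAddable.isParent.ssubset, fun r hr => ?_⟩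
    · have := h₂.isAddable.isParent.mem
      rw [hzy₂, Finset.insert_comm, Finset.mem_insert] at this
      rw [← hT]
      exact this.resolve_left h21
    · refine h₂.isAddable.isParent.le r ?_
      rw [hzy₂, Finset.insert_comm, hT]
      exact Finset.mem_insert_of_mem hr
  subst ha hb
  suffices z = z' by
    subst this
    exact ⟨z, hz', hz⟩
  refine eq_of_blocks hT fun r hr => ?_
  have hr1 : r ≠ t₁ := by rintro rfl; rw [← hT] at hr; exact hz.isAddable.notMem_insert hr
  have hr2 : r ≠ t₂ := by rintro rfl; exact hz'.isAddable.notMem_insert hr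
  by_cases hab : a = b
  · subst hab
    by_cases hra : r = a
    · subst hra
      obtain ⟨ℓ, hℓ⟩ := (x.blocks r).exists_isListing
      obtain ⟨ℓ₁, hℓ₁⟩ := (x.blocks t₁).exists_isListing
      obtain ⟨ℓ₂, hℓ₂⟩ := (x.blocks t₂).exists_isListing
      have e : (z.blocks r).IsListing ((ℓ ++ ℓ₂) ++ ℓ₁) := by
        refine hz.isListing (h₂.isListing hℓ hℓ₂) ?_
        rwa [← h₂.blocks_eq _ hne hz.isAddable.ne.symm]
      have e' : (z'.blocks r).IsListing ((ℓ ++ ℓ₁) ++ ℓ₂) := by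
        refine hz'.isListing (h₁.isListing hℓ hℓ₁) ?_
        rwa [← h₁.blocks_eq _ hne.symm hz'.isAddable.ne.symm]
      have hz1 : G.IsAddable z.tubing.tubes t₁ r := hz.isAddable
      have hz2 : G.IsAddable z.tubing.tubes t₂ r := hT ▸ hz'.isAddable
      have hlen := (x.fitsCore h₁.parent_mem).length_listing hℓ
      have hcore : coreNodes x.tubing.tubes r = (coreNodes z.tubing.tubes r \ t₁) \ t₂ := by
        rw [h₂.tubes_eq, h₂.isAddable.isParent.coreNodes_parent, hz.tubes_eq,
          hz1.isParent.coreNodes_parent]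
      have hp := (z.fitsCore hz1.isParent.mem).length_pre
      have hc : G.TubesCompatible t₁ t₂ :=
        x.tubing.isTubing.compatible t₁ h₁.mem t₂ h₂.mem hne
      -- Two tubes with the same parent are not nested, so compatibility makes them disjoint and
      -- nonadjacent.
      have hk : G.relConn (coreNodes z.tubing.tubes r) r ≤
          ((coreNodes z.tubing.tubes r \ t₁) \ t₂).card := by
        rcases hc with hc | hc | hc
        · have := h₁.isAddable.isParent.le t₂ (by
            rw [← h₁.erase_eq]
            exact Finset.mem_insert_of_mem (Finset.mem_erase.2 ⟨hne.symm, h₂.mem⟩)) hc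
          exact absurd this h₂.isAddable.isParent.ssubset.2
        · have := h₂.isAddable.isParent.le t₁ (by
            rw [← h₂.erase_eq]
            exact Finset.mem_insert_of_mem (Finset.mem_erase.2 ⟨hne, h₁.mem⟩)) hc
          exact absurd this h₁.isAddable.isParent.ssubset.2
        · exact hz1.relConn_le_of_disjoint hG hz2 hc.1 hc.2
      refine blocks_eq_of_isListing hT hr (e.congr ?_ ?_) e'
      · rw [List.append_assoc, List.append_assoc]
        exact List.Perm.append_left _ List.perm_append_comm
      · rw [hcore] at hlen
        rw [List.append_assoc, List.append_assoc, List.take_append_of_le_length (by omega),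
          List.take_append_of_le_length (by omega)]
    · rw [← hz.blocks_eq r hr1 hra, ← hz'.blocks_eq r hr2 hra, ← h₁.blocks_eq r hr1 hra,
        ← h₂.blocks_eq r hr2 hra]
  · by_cases hra : r = a
    · subst hra
      exact blocks_eq_of_two_steps h₁ h₂ hz hz' hT hab h12 h21 hne
    by_cases hrb : r = b
    · subst hrb
      exact (blocks_eq_of_two_steps h₂ h₁ hz' hz hT.symm (Ne.symm hab) h21 h12 hne.symm).symm
    · rw [← hz.blocks_eq r hr1 hra, ← hz'.blocks_eq r hr2 hrb, ← h₁.blocks_eq r hr1 hra,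
        ← h₂.blocks_eq r hr2 hrb]

/-- When `t₂` is the parent of `t₁`, both orders produce the colors of `s₂`, then `t₂`, then `t₁`:
the claim is associativity of concatenation. -/
theorem StepVia.confluent_of_eq (hG : G.Connected) {y₁ y₂ : G.ColorTemplate P}
    {t₁ t₂ s₂ : Finset V} (h₁ : StepVia x y₁ t₁ t₂) (h₂ : StepVia x y₂ t₂ s₂) :
    ∃ z, StepVia y₁ z t₂ s₂ ∧ StepVia y₂ z t₁ s₂ := by
  have hne : t₁ ≠ t₂ := h₁.isAddable.ne.symm
  have hts : t₁ ⊂ s₂ := h₁.isAddable.isParent.ssubset.trans h₂.isAddable.isParent.ssubset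
  have h21 : s₂ ≠ t₁ := hts.ne'
  obtain ⟨z, a, hz⟩ := exists_stepVia_of_mem hG y₂ (t := t₁)
    (by rw [← h₂.erase_eq]; exact Finset.mem_erase.2 ⟨hne, h₁.mem⟩)
  obtain ⟨z', b, hz'⟩ := exists_stepVia_of_mem hG y₁ (t := t₂)
    (by rw [← h₁.erase_eq]; exact Finset.mem_erase.2 ⟨hne.symm, h₂.mem⟩)
  have hT : z.tubing.tubes = z'.tubing.tubes := by
    rw [← hz.erase_eq, ← hz'.erase_eq, ← h₂.erase_eq, ← h₁.erase_eq, Finset.erase_right_comm]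
  have hzy₁ : y₁.tubing.tubes = insert t₂ z.tubing.tubes := by rw [hT, hz'.tubes_eq]
  have hzy₂ : y₂.tubing.tubes = insert t₁ z.tubing.tubes := hz.tubes_eq
  have hs₂ : s₂ ∈ insert Finset.univ z.tubing.tubes := by
    have := h₂.isAddable.isParent.mem
    rw [hzy₂, Finset.insert_comm, Finset.mem_insert] at this
    exact this.resolve_left h21
  have ht₂ : t₂ ∉ insert Finset.univ z.tubing.tubes := by
    rw [hT]
    exact hz'.isAddable.notMem_insert
  have hle : ∀ r ∈ insert Finset.univ z.tubing.tubes, t₂ ⊂ r → s₂ ⊆ r := fun r hr => by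
    refine h₂.isAddable.isParent.le r ?_
    rw [hzy₂, Finset.insert_comm]
    exact Finset.mem_insert_of_mem hr
  have ha : a = s₂ := by
    refine hz.isAddable.isParent.eq ⟨hs₂, hts, fun r hr hr1 => hle r hr ?_⟩
    refine (h₁.isAddable.isParent.le r ?_ hr1).ssubset_of_ne ?_
    · rw [hzy₁, Finset.insert_comm]
      exact Finset.mem_insert_of_mem hr
    · rintro rfl
      exact ht₂ hr
  have hb : b = s₂ := hz'.isAddable.isParent.eq
    ⟨by rwa [← hT], h₂.isAddable.isParent.ssubset, by rwa [← hT]⟩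
  subst ha hb
  suffices z = z' by
    subst this
    exact ⟨z, hz', hz⟩
  refine eq_of_blocks hT fun r hr => ?_
  have hr1 : r ≠ t₁ := by rintro rfl; rw [← hT] at hr; exact hz.isAddable.notMem_insert hr
  have hr2 : r ≠ t₂ := by rintro rfl; exact hz'.isAddable.notMem_insert hr
  by_cases hra : r = b
  · subst hra
    obtain ⟨ℓ, hℓ⟩ := (x.blocks r).exists_isListing
    obtain ⟨ℓ₁, hℓ₁⟩ := (x.blocks t₁).exists_isListing
    obtain ⟨ℓ₂, hℓ₂⟩ := (x.blocks t₂).exists_isListing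
    have e : (z.blocks r).IsListing ((ℓ ++ ℓ₂) ++ ℓ₁) := by
      refine hz.isListing (h₂.isListing hℓ hℓ₂) ?_
      rwa [← h₂.blocks_eq _ hne hz.isAddable.ne.symm]
    have e' : (z'.blocks r).IsListing (ℓ ++ (ℓ₂ ++ ℓ₁)) := by
      refine hz'.isListing ?_ (h₁.isListing hℓ₂ hℓ₁)
      rwa [← h₁.blocks_eq _ hr1 hr2]
    rw [List.append_assoc] at e
    exact blocks_eq_of_isListing hT hr e e'
  · rw [← hz.blocks_eq r hr1 hra, ← hz'.blocks_eq r hr2 hra, ← h₁.blocks_eq r hr1 hr2,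
      ← h₂.blocks_eq r hr2 hra]

/-- Two tubes can be removed in either order. -/
theorem StepVia.confluent (hG : G.Connected) {y₁ y₂ : G.ColorTemplate P}
    {t₁ t₂ s₁ s₂ : Finset V} (h₁ : StepVia x y₁ t₁ s₁) (h₂ : StepVia x y₂ t₂ s₂) (hne : t₁ ≠ t₂) :
    ∃ z, (∃ s, StepVia y₁ z t₂ s) ∧ ∃ s, StepVia y₂ z t₁ s := by
  by_cases h12 : s₁ = t₂
  · subst h12
    obtain ⟨z, hz, hz'⟩ := h₁.confluent_of_eq hG h₂
    exact ⟨z, ⟨_, hz⟩, ⟨_, hz'⟩⟩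
  by_cases h21 : s₂ = t₁
  · subst h21
    obtain ⟨z, hz, hz'⟩ := h₂.confluent_of_eq hG h₁
    exact ⟨z, ⟨_, hz'⟩, ⟨_, hz⟩⟩
  obtain ⟨z, hz, hz'⟩ := h₁.confluent_of_ne hG h₂ hne h12 h21
  exact ⟨z, ⟨_, hz⟩, ⟨_, hz'⟩⟩

end ColorTemplate

end SimpleGraph

namespace SimpleGraph

variable {V : Type*} [Fintype V] [DecidableEq V] {G : SimpleGraph V} {C : Type*}

namespace ColorTemplate

variable {P : Multiset C} {x y y' z : G.ColorTemplate P} {r s t : Finset V}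

/-! ### The faces above a given face -/

theorem tubes_subset_of_le (h : x ≤ y) : y.tubing.tubes ⊆ x.tubing.tubes := by
  have h' : Relation.ReflTransGen Step x y := h
  clear h
  induction h' with
  | refl => exact subset_rfl
  | tail _ h ih =>
    obtain ⟨t, s, h⟩ := step_iff.1 h
    refine (Finset.subset_insert t _).trans ?_
    rwa [← h.tubes_eq]

/-- The tube `t` is removed somewhere on the way from `x` to `y`. Confluence moves this removal to
the front, where `StepVia.right_unique` identifies its result with `z`. -/
theorem StepVia.le_of_notMem (hG : G.Connected) (h : StepVia x z t s) (hy : x ≤ y)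
    (ht : t ∉ y.tubing.tubes) : z ≤ y := by
  have hy' : Relation.ReflTransGen Step x y := hy
  clear hy
  induction hy' using Relation.ReflTransGen.head_induction_on generalizing z s with
  | refl => exact absurd h.mem ht
  | @head a c hac hcy ih =>
    obtain ⟨r, a', hr⟩ := step_iff.1 hac
    by_cases hrt : r = t
    · subst hrt
      rw [h.right_unique hr]
      exact hcy
    · obtain ⟨w, ⟨_, hw⟩, ⟨_, hw'⟩⟩ := hr.confluent hG h hrt
      exact hw'.le.trans (ih hw)

theorem exists_ge_of_subset (hG : G.Connected) (x : G.ColorTemplate P)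
    {S : Finset (Finset V)} (hS : S ⊆ x.tubing.tubes) : ∃ y, x ≤ y ∧ y.tubing.tubes = S := by
  obtain ⟨n, hn⟩ : ∃ n, (x.tubing.tubes \ S).card = n := ⟨_, rfl⟩
  induction n generalizing x with
  | zero =>
    rw [Finset.card_eq_zero, Finset.sdiff_eq_empty_iff_subset] at hn
    exact ⟨x, le_rfl, hn.antisymm hS⟩
  | succ n ih =>
    obtain ⟨t, ht⟩ := Finset.card_pos.1 (by rw [hn]; omega)
    have ht' := Finset.mem_sdiff.1 ht
    obtain ⟨y, s, hy⟩ := exists_stepVia_of_mem hG x ht'.1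
    obtain ⟨w, hw, hwS⟩ := ih y (by
      rw [← hy.erase_eq]
      exact fun r hr => Finset.mem_erase.2 ⟨by rintro rfl; exact ht'.2 hr, hS hr⟩) (by
      rw [← hy.erase_eq, Finset.erase_sdiff_comm, Finset.card_erase_of_mem ht, hn]
      rfl)
    exact ⟨w, hy.le.trans hw, hwS⟩

theorem eq_of_le_of_tubes_eq (h : x ≤ y) (hT : x.tubing.tubes = y.tubing.tubes) : x = y := by
  rcases eq_or_card_lt h with h | h
  · exact h
  · rw [hT] at h
    exact absurd h (lt_irrefl _)

/-- A face above `x` is determined by its tubes. -/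
theorem eq_of_tubes_eq (hG : G.Connected) (h : x ≤ y) (h' : x ≤ y')
    (hT : y.tubing.tubes = y'.tubing.tubes) : y = y' := by
  obtain ⟨n, hn⟩ : ∃ n, (x.tubing.tubes \ y.tubing.tubes).card = n := ⟨_, rfl⟩
  induction n generalizing x with
  | zero =>
    rw [Finset.card_eq_zero, Finset.sdiff_eq_empty_iff_subset] at hn
    have e := hn.antisymm (tubes_subset_of_le h)
    rw [← eq_of_le_of_tubes_eq h e, ← eq_of_le_of_tubes_eq h' (e.trans hT)]
  | succ n ih =>
    obtain ⟨t, ht⟩ := Finset.card_pos.1 (by rw [hn]; omega)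
    have ht' := Finset.mem_sdiff.1 ht
    obtain ⟨z, s, hz⟩ := exists_stepVia_of_mem hG x ht'.1
    refine ih (hz.le_of_notMem hG h ht'.2) (hz.le_of_notMem hG h' (hT ▸ ht'.2)) ?_
    rw [← hz.erase_eq, Finset.erase_sdiff_comm, Finset.card_erase_of_mem ht, hn]
    rfl

/-- With `exists_ge_of_subset` and `eq_of_tubes_eq`, this identifies the faces above `x` with the
sets of tubes of `x`, ordered by reverse inclusion. -/
theorem le_of_tubes_subset (hG : G.Connected) (h : x ≤ y) (h' : x ≤ y')
    (hT : y'.tubing.tubes ⊆ y.tubing.tubes) : y ≤ y' := by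
  obtain ⟨w, hw, hwT⟩ := exists_ge_of_subset hG y hT
  rwa [eq_of_tubes_eq hG h' (h.trans hw) hwT.symm]

theorem exists_stepVia_of_le (hG : G.Connected) (h : x ≤ y) (ht : t ∉ y.tubing.tubes)
    (hT : x.tubing.tubes = insert t y.tubing.tubes) : ∃ s, StepVia x y t s := by
  obtain ⟨z, s, hz⟩ := exists_stepVia_of_mem hG x (t := t) (by rw [hT]; simp)
  have : z = y := eq_of_tubes_eq hG hz.le h (by
    rw [← hz.erase_eq, hT, Finset.erase_insert ht])
  exact ⟨s, this ▸ hz⟩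

/-- Compatible tubes can be added to a template. -/
theorem exists_le_of_subset (hG : G.Connected) (y : G.ColorTemplate P)
    {S : Finset (Finset V)} (hS : G.IsTubing S) (h : y.tubing.tubes ⊆ S) :
    ∃ x, x ≤ y ∧ x.tubing.tubes = S := by
  obtain ⟨n, hn⟩ : ∃ n, (S \ y.tubing.tubes).card = n := ⟨_, rfl⟩
  induction n generalizing y with
  | zero =>
    rw [Finset.card_eq_zero, Finset.sdiff_eq_empty_iff_subset] at hn
    exact ⟨y, le_rfl, h.antisymm hn⟩
  | succ n ih =>
    obtain ⟨t, ht⟩ := Finset.card_pos.1 (by rw [hn]; omega)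
    have ht' := Finset.mem_sdiff.1 ht
    have hsub : insert t y.tubing.tubes ⊆ S := Finset.insert_subset ht'.1 h
    obtain ⟨s, hs⟩ := (hS.mono hsub).exists_isAddable ht'.2
    obtain ⟨x, hx⟩ := exists_stepVia_of_isAddable' hG y hs
    obtain ⟨w, hw, hwS⟩ := ih x (by rwa [hx.tubes_eq]) (by
      rw [hx.tubes_eq, Finset.insert_eq, Finset.sdiff_union_distrib, Finset.sdiff_singleton_eq_erase,
        Finset.erase_inter, Finset.inter_eq_right.2 Finset.sdiff_subset,
        Finset.card_erase_of_mem ht, hn]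
      rfl)
    exact ⟨w, hw.trans hx.le, hwS⟩

/-- The color of a tube heads its listing, and the parent keeps an initial segment. -/
theorem StepVia.color_eq (h : StepVia x y t s) (hr : r ∈ y.tubing.tubes) :
    (x.blocks r).color = (y.blocks r).color := by
  have hrt : r ≠ t := by rintro rfl; exact h.isAddable.notMem hr
  by_cases hrs : r = s
  · subst hrs
    obtain ⟨ℓ₁, ℓ₂, hy, hx, -⟩ := h.exists_isListing
    have hxr : r ∈ x.tubing.tubes := by
      rw [h.tubes_eq]
      exact Finset.mem_insert_of_mem hr
    obtain ⟨c, hc⟩ := Option.isSome_iff_exists.1 (x.color_tube r hxr)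
    obtain ⟨ℓ', rfl⟩ := hx.eq_cons hc
    rw [hc, ColorBlocks.IsListing.color_eq hy (y.color_tube r hr)]
  · rw [h.blocks_eq r hrt hrs]

/-- The color of a tube is the same in all faces below. -/
theorem color_eq_of_le (h : x ≤ y) (hr : r ∈ y.tubing.tubes) :
    (x.blocks r).color = (y.blocks r).color := by
  have h' : Relation.ReflTransGen Step x y := h
  clear h
  induction h' with
  | refl => rfl
  | tail _ h ih =>
    obtain ⟨t, s, h⟩ := step_iff.1 h
    rw [ih (tubes_subset_of_le h.le hr), h.color_eq hr]

/-! ### Templates without tubes -/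

theorem coreNodes_empty (s : Finset V) : coreNodes ∅ s = s := by
  ext v
  simp [mem_coreNodes]

variable (G) in
theorem exists_of_isListing {ℓ : List C} (hℓ : (ℓ : Multiset C) = P)
    (hP : P.card = Fintype.card V - 1) :
    ∃ x : G.ColorTemplate P, x.tubing.tubes = ∅ ∧ (x.blocks Finset.univ).IsListing ℓ := by
  have hlen : ℓ.length = ownColor (Finset.univ : Finset V) + ((Finset.univ : Finset V).card - 1) := by
    rw [← hℓ, Multiset.coe_card] at hP
    simp [ownColor, hP]
  obtain ⟨b, hb, hbℓ⟩ := G.exists_fitsCore _ _ ℓ hlen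
  obtain ⟨x, hxT, hxb⟩ := exists_of_fitsCore (P := P) (⟨∅, by simp, by simp⟩ : G.Tubing)
    (Function.update (fun _ => ColorBlocks.empty) Finset.univ b) (by
      intro r hr
      rw [Function.update_of_ne]
      rintro rfl
      exact hr (by simp)) (by
      intro r hr
      obtain rfl : r = Finset.univ := by simpa using hr
      simpa [coreNodes_empty] using hb) (by
      simpa [← hℓ] using hbℓ.coe_eq.symm)
  refine ⟨x, by rw [hxT], ?_⟩
  rw [hxb]
  simpa using hbℓ

theorem exists_of_tubing (hG : G.Connected) (hP : P.card = Fintype.card V - 1) (T : G.Tubing) :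
    ∃ x : G.ColorTemplate P, x.tubing = T := by
  obtain ⟨ℓ, hℓ⟩ := Quot.exists_rep P
  obtain ⟨x, hx, -⟩ := exists_of_isListing G hℓ hP
  obtain ⟨w, -, hw⟩ := exists_le_of_subset hG x T.isTubing (by simp [hx])
  exact ⟨w, Tubing.ext hw⟩

/-! ### Monochrome palettes -/

theorem mem_of_mem_colors {c : C} (hr : r ∈ insert Finset.univ x.tubing.tubes)
    (hc : c ∈ (x.blocks r).colors) : c ∈ P := by
  have h := x.sum_colors
  rw [← Finset.add_sum_erase _ _ hr] at h
  have : c ∈ (x.blocks r).colors + ∑ r ∈ (insert Finset.univ x.tubing.tubes).erase r,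
    (x.blocks r).colors := Multiset.mem_add.2 (Or.inl hc)
  rwa [h] at this

theorem eq_of_tubing_eq (hP : ∀ a ∈ P, ∀ b ∈ P, a = b) (h : x.tubing = y.tubing) : x = y := by
  have hT : x.tubing.tubes = y.tubing.tubes := by rw [h]
  refine eq_of_blocks hT fun r hr => ?_
  have hrx : r ∈ insert Finset.univ x.tubing.tubes := by rwa [hT]
  obtain ⟨ℓ, hℓ⟩ := (x.blocks r).exists_isListing
  obtain ⟨ℓ', hℓ'⟩ := (y.blocks r).exists_isListing
  have hlen : ℓ.length = ℓ'.length := by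
    rw [(x.fitsCore hrx).length_listing hℓ, (y.fitsCore hr).length_listing hℓ', hT]
  have e : ℓ = ℓ' := by
    refine List.ext_getElem hlen fun i h1 h2 => hP _ ?_ _ ?_
    · refine mem_of_mem_colors hrx ?_
      rw [← hℓ.coe_eq]
      exact List.getElem_mem h1
    · refine mem_of_mem_colors hr ?_
      rw [← hℓ'.coe_eq]
      exact List.getElem_mem h2
  subst e
  exact blocks_eq_of_isListing hT hr hℓ hℓ'

theorem exists_orderIso_tubing (hG : G.Connected) (hP : P.card = Fintype.card V - 1)
    (hmono : ∀ a ∈ P, ∀ b ∈ P, a = b) :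
    ∃ e : G.ColorTemplate P ≃o G.Tubing, ∀ x, e x = x.tubing := by
  have hb : Function.Bijective (fun x : G.ColorTemplate P => x.tubing) :=
    ⟨fun x y h => eq_of_tubing_eq hmono h, fun T => exists_of_tubing hG hP T⟩
  refine ⟨⟨Equiv.ofBijective _ hb, ?_⟩, fun x => rfl⟩
  intro x y
  change y.tubing.tubes ⊆ x.tubing.tubes ↔ x ≤ y
  refine ⟨fun h => ?_, tubes_subset_of_le⟩
  obtain ⟨w, hw, hwT⟩ := exists_ge_of_subset hG x h
  rwa [← eq_of_tubing_eq hmono (Tubing.ext hwT)]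

/-! ### Counting tubes and colors -/

theorem card_colors (hr : r ∈ insert Finset.univ x.tubing.tubes) :
    (x.blocks r).colors.card = ownColor r + ((coreNodes x.tubing.tubes r).card - 1) := by
  obtain ⟨ℓ, hℓ⟩ := (x.blocks r).exists_isListing
  rw [← hℓ.coe_eq, Multiset.coe_card, (x.fitsCore hr).length_listing hℓ]

/-- Each tube uses its own color, and a core with `m` nodes uses `m - 1` more. So the number of
tubes missing from the maximum `P.card`, which is the rank of the face, is the sum of the numbers `m
- 1`. -/
theorem card_tubes_add_sum (x : G.ColorTemplate P) :
    x.tubing.tubes.card + ∑ r ∈ insert Finset.univ x.tubing.tubes,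
      ((coreNodes x.tubing.tubes r).card - 1) = P.card := by
  have h := congrArg Multiset.card x.sum_colors
  rw [Multiset.card_sum, Finset.sum_congr rfl (fun r hr => card_colors hr),
    Finset.sum_add_distrib, Finset.sum_insert x.tubing.isTubing.univ_notMem] at h
  have e : ∑ r ∈ x.tubing.tubes, ownColor r = x.tubing.tubes.card := by
    rw [Finset.card_eq_sum_ones]
    exact Finset.sum_congr rfl fun r hr => if_neg (x.tubing.isTube r hr).1
  rw [e, ownColor, if_pos rfl, zero_add] at h
  exact h

theorem card_tubes_le (x : G.ColorTemplate P) : x.tubing.tubes.card ≤ P.card := by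
  have := x.card_tubes_add_sum
  omega

end ColorTemplate

end SimpleGraph

/-! ### Bounded graded posets -/

/-- `g` is a grading of a poset with a least element of grade `0` and a greatest element of
grade `N`. -/
structure IsBoundedGrading {α : Type*} [PartialOrder α] (g : α → ℕ) (N : ℕ) : Prop where
  lt_of_lt : ∀ a b, a < b → g a < g b
  exists_least : ∃ a, IsBot a ∧ g a = 0
  exists_greatest : ∃ a, IsTop a ∧ g a = N
  exists_between : ∀ a b, a < b → g a + 2 ≤ g b → ∃ c, a < c ∧ c < b

namespace IsBoundedGrading

variable {α : Type*} [PartialOrder α] {g : α → ℕ} {N : ℕ}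

theorem le_of_le (h : IsBoundedGrading g N) {a b : α} (hab : a ≤ b) : g a ≤ g b := by
  rcases hab.eq_or_lt with rfl | hab
  · rfl
  · exact (h.lt_of_lt a b hab).le

theorem le_top (h : IsBoundedGrading g N) (a : α) : g a ≤ N := by
  obtain ⟨b, hb, hg⟩ := h.exists_greatest
  exact hg ▸ h.le_of_le (hb a)

theorem lt_of_mem (h : IsBoundedGrading g N) (A : Flag α) {a b : α} (ha : a ∈ A) (hb : b ∈ A)
    (hab : g a < g b) : a < b := by
  rcases A.le_or_le ha hb with h' | h'
  · exact h'.lt_of_ne (by rintro rfl; exact lt_irrefl _ hab)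
  · exact absurd (h.le_of_le h') (not_le.2 hab)

theorem eq_of_mem (h : IsBoundedGrading g N) (A : Flag α) {a b : α} (ha : a ∈ A) (hb : b ∈ A)
    (hab : g a = g b) : a = b := by
  rcases A.le_or_le ha hb with h' | h'
  · rcases h'.eq_or_lt with h' | h'
    · exact h'
    · exact absurd (h.lt_of_lt _ _ h') (by omega)
  · rcases h'.eq_or_lt with h' | h'
    · exact h'.symm
    · exact absurd (h.lt_of_lt _ _ h') (by omega)

theorem mem_of_forall (A : Flag α) {c : α} (hc : ∀ x ∈ A, x ≤ c ∨ c ≤ x) : c ∈ A := by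
  have hch : IsChain (· ≤ ·) (insert c (A : Set α)) :=
    A.chain_le.insert fun b hb _ => (hc b hb).symm
  have := A.max_chain' hch (Set.subset_insert _ _)
  change c ∈ (A : Set α)
  exact (congrArg (c ∈ ·) this).mpr (Set.mem_insert _ _)

theorem bot_mem {a : α} (ha : IsBot a) (A : Flag α) : a ∈ A :=
  mem_of_forall A fun x _ => Or.inr (ha x)

theorem top_mem {a : α} (ha : IsTop a) (A : Flag α) : a ∈ A :=
  mem_of_forall A fun x _ => Or.inl (ha x)

/-- The elements of a finite-valued set have one of greatest grade. -/
theorem exists_max (h : IsBoundedGrading g N) {S : Set α} (hS : S.Nonempty) :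
    ∃ a ∈ S, ∀ b ∈ S, g b ≤ g a := by
  obtain ⟨a, ha⟩ := hS
  obtain ⟨n, hn⟩ : ∃ n, N - g a = n := ⟨_, rfl⟩
  induction n using Nat.strong_induction_on generalizing a with
  | _ n ih =>
    by_cases hb : ∀ b ∈ S, g b ≤ g a
    · exact ⟨a, ha, hb⟩
    · push Not at hb
      obtain ⟨b, hb, hab⟩ := hb
      have := h.le_top b
      exact ih (N - g b) (by omega) b hb rfl

theorem exists_min {S : Set α} (hS : S.Nonempty) (g : α → ℕ) : ∃ a ∈ S, ∀ b ∈ S, g a ≤ g b := by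
  obtain ⟨a, ha, hm⟩ := WellFounded.has_min (measure g).wf S hS
  exact ⟨a, ha, fun b hb => not_lt.1 (hm b hb)⟩

/-- Were the grade `i` missing, an element strictly between the neighbors of the gap would be
comparable to the whole flag and would belong to it by maximality, although the gap contains no
element of the flag. -/
theorem exists_mem_of_le (h : IsBoundedGrading g N) (A : Flag α) {i : ℕ} (hi : i ≤ N) :
    ∃ a ∈ A, g a = i := by
  by_contra hcon
  push Not at hcon
  obtain ⟨o, ho, hgo⟩ := h.exists_least
  obtain ⟨e, he, hge⟩ := h.exists_greatest
  have ho0 := hcon o (bot_mem ho A)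
  have he0 := hcon e (top_mem he A)
  obtain ⟨a, ⟨ha, hai⟩, hmax⟩ := h.exists_max (S := {x | x ∈ A ∧ g x < i})
    ⟨o, bot_mem ho A, by omega⟩
  obtain ⟨b, ⟨hb, hbi⟩, hmin⟩ := exists_min (S := {x | x ∈ A ∧ i < g x})
    ⟨e, top_mem he A, by omega⟩ g
  obtain ⟨c, hac, hcb⟩ := h.exists_between a b (h.lt_of_mem A ha hb (by omega)) (by omega)
  have hlow : ∀ x ∈ A, g x < i → x ≤ a := fun x hx hxi => by
    rcases (hmax x ⟨hx, hxi⟩).eq_or_lt with h' | h'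
    · exact (h.eq_of_mem A hx ha h').le
    · exact (h.lt_of_mem A hx ha h').le
  have hhigh : ∀ x ∈ A, i < g x → b ≤ x := fun x hx hxi => by
    rcases (hmin x ⟨hx, hxi⟩).eq_or_lt with h' | h'
    · exact (h.eq_of_mem A hb hx h').le
    · exact (h.lt_of_mem A hb hx h').le
  have hcA : c ∈ A := mem_of_forall A fun x hx => by
    rcases lt_or_gt_of_ne (hcon x hx) with h' | h'
    · exact Or.inl ((hlow x hx h').trans hac.le)
    · exact Or.inr (hcb.le.trans (hhigh x hx h'))
  rcases lt_or_gt_of_ne (hcon c hcA) with h' | h'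
  · exact absurd (hlow c hcA h') (not_le_of_gt hac)
  · exact absurd (hhigh c hcA h') (not_le_of_gt hcb)

theorem image_flag (h : IsBoundedGrading g N) (A : Flag α) : g '' (A : Set α) = Set.Iic N := by
  ext i
  constructor
  · rintro ⟨a, -, rfl⟩
    exact h.le_top a
  · intro hi
    obtain ⟨a, ha, hai⟩ := h.exists_mem_of_le A hi
    exact ⟨a, ha, hai⟩

theorem injOn_flag (h : IsBoundedGrading g N) (A : Flag α) : Set.InjOn g (A : Set α) :=
  fun _ ha _ hb hab => h.eq_of_mem A ha hb hab

theorem finite_flag (h : IsBoundedGrading g N) (A : Flag α) : (A : Set α).Finite :=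
  Set.Finite.of_finite_image (by rw [h.image_flag]; exact Set.finite_Iic N) (h.injOn_flag A)

theorem ncard_flag (h : IsBoundedGrading g N) (A : Flag α) : (A : Set α).ncard = N + 1 := by
  rw [← (h.injOn_flag A).ncard_image, h.image_flag, ← Finset.coe_Iic,
    Set.ncard_coe_finset, Nat.card_Iic]

/-- By `exists_between`, an element of greatest grade below `x` is exactly one grade lower, so
height and grade grow together. -/
theorem height_eq (h : IsBoundedGrading g N) (x : α) : Order.height x = g x := by
  obtain ⟨n, hn⟩ : ∃ n, g x = n := ⟨_, rfl⟩
  induction n using Nat.strong_induction_on generalizing x with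
  | _ n ih =>
    refine le_antisymm ?_ ?_
    · rw [Order.height_le_coe_iff]
      intro y hy
      have := h.lt_of_lt y x hy
      rw [ih (g y) (by omega) y rfl]
      exact_mod_cast this
    · obtain ⟨o, ho, hgo⟩ := h.exists_least
      rcases (ho x).eq_or_lt with hx | hx
      · rw [← hx, hgo]
        simp
      · obtain ⟨y, hy, hmax⟩ := h.exists_max (S := {y | y < x}) ⟨o, hx⟩
        have hyx := h.lt_of_lt y x hy
        have hy1 : g y + 1 = g x := by
          by_contra hne
          obtain ⟨c, hc, hc'⟩ := h.exists_between y x hy (by omega)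
          exact absurd (hmax c hc') (not_le.2 (h.lt_of_lt _ _ hc))
        rw [← hy1]
        have := Order.height_add_one_le hy
        rw [ih (g y) (by omega) y rfl] at this
        exact_mod_cast this

theorem flag_eq_of_subset (h : IsBoundedGrading g N) {A : Flag α} {S : Set α}
    (hS : S.ncard = N + 1) (hSA : S ⊆ A) : (A : Set α) = S :=
  (Set.eq_of_subset_of_ncard_le hSA (by rw [hS, h.ncard_flag]) (h.finite_flag A)).symm

/-- Two distinct flags and the two common elements that enclose a place where they differ. -/
theorem exists_gap (h : IsBoundedGrading g N) {A B : Flag α} (hAB : A ≠ B) :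
    ∃ a b x y : α, (a ∈ A ∧ a ∈ B) ∧ (b ∈ A ∧ b ∈ B) ∧ (x ∈ A ∧ x ∉ B) ∧ (y ∈ B ∧ y ∉ A) ∧
      g y = g x ∧ a < x ∧ x < b ∧ a < y ∧ y < b ∧ ∀ z, z ∈ A → z ∈ B → z ≤ a ∨ b ≤ z := by
  obtain ⟨x, hxA, hxB⟩ : ∃ x ∈ A, x ∉ B := by
    by_contra hcon
    push Not at hcon
    exact hAB (SetLike.coe_injective (h.flag_eq_of_subset (h.ncard_flag A) hcon).symm)
  obtain ⟨y, hyB, hyx⟩ := h.exists_mem_of_le B (h.le_top x)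
  have hyA : y ∉ A := fun hyA => hxB (h.eq_of_mem A hyA hxA hyx ▸ hyB)
  obtain ⟨o, ho, -⟩ := h.exists_least
  obtain ⟨e, he, -⟩ := h.exists_greatest
  have hox : o < x := (ho x).lt_of_ne (by rintro rfl; exact hxB (bot_mem ho B))
  have hxe : x < e := (he x).lt_of_ne (by rintro rfl; exact hxB (top_mem he B))
  obtain ⟨a, ⟨haA, haB, hax⟩, hmax⟩ := h.exists_max (S := {z | z ∈ A ∧ z ∈ B ∧ z < x})
    ⟨o, bot_mem ho A, bot_mem ho B, hox⟩
  obtain ⟨b, ⟨hbA, hbB, hxb⟩, hmin⟩ := exists_min (S := {z | z ∈ A ∧ z ∈ B ∧ x < z})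
    ⟨e, top_mem he A, top_mem he B, hxe⟩ g
  have h1 := h.lt_of_lt _ _ hax
  have h2 := h.lt_of_lt _ _ hxb
  refine ⟨a, b, x, y, ⟨haA, haB⟩, ⟨hbA, hbB⟩, ⟨hxA, hxB⟩, ⟨hyB, hyA⟩, hyx, hax, hxb,
    h.lt_of_mem B haB hyB (by omega), h.lt_of_mem B hyB hbB (by omega), fun z hzA hzB => ?_⟩
  have hzx : z ≠ x := by rintro rfl; exact hxB hzB
  rcases A.le_or_le hzA hxA with h' | h'
  · left
    rcases (hmax z ⟨hzA, hzB, h'.lt_of_ne hzx⟩).eq_or_lt with h' | h'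
    · exact (h.eq_of_mem A hzA haA h').le
    · exact (h.lt_of_mem A hzA haA h').le
  · right
    rcases (hmin z ⟨hzA, hzB, h'.lt_of_ne hzx.symm⟩).eq_or_lt with h' | h'
    · exact (h.eq_of_mem A hbA hzA h').le
    · exact (h.lt_of_mem A hbA hzA h').le

theorem ncard_lt_of_mem (h : IsBoundedGrading g N) {A B X Y : Flag α} {y : α}
    (hsub : (A : Set α) ∩ B ⊆ (X : Set α) ∩ Y) (hy : y ∈ X ∧ y ∈ Y) (hy' : ¬ (y ∈ A ∧ y ∈ B)) :
    ((A : Set α) ∩ B).ncard < ((X : Set α) ∩ Y).ncard :=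
  Set.ncard_lt_ncard ⟨hsub, fun h' => hy' (h' hy)⟩ ((h.finite_flag X).inter_of_left _)

/-- A bounded graded poset in which all long open intervals are connected is strongly
flag-connected. -/
theorem strongly_flag_connected (h : IsBoundedGrading g N)
    (hconn : ∀ a b, a < b → g a + 3 ≤ g b → ∀ x y, a < x → x < b → a < y → y < b →
      Relation.ReflTransGen (fun u v => (u ≤ v ∨ v ≤ u) ∧ a < v ∧ v < b) x y)
    (A B : Flag α) (I : Set α) (hI : I ⊆ (A : Set α) ∩ B) :
    Relation.ReflTransGen (fun X Y : Flag α => X.IsAdjacent Y ∧ I ⊆ (Y : Set α)) A B := by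
  -- Induction on the number of places where the flags differ. The set `I` stays fixed while the
  -- pair of flags and its intersection change.
  obtain ⟨n, hn⟩ : ∃ n, N + 1 - ((A : Set α) ∩ B).ncard = n := ⟨_, rfl⟩
  induction n using Nat.strong_induction_on generalizing A B with
  | _ n ih =>
    have hle : ∀ X Y : Flag α, ((X : Set α) ∩ Y).ncard ≤ N + 1 := fun X Y => by
      rw [← h.ncard_flag X]
      exact Set.ncard_le_ncard Set.inter_subset_left (h.finite_flag X)
    have step : ∀ X Y : Flag α, I ⊆ (X : Set α) ∩ Y →
        ((A : Set α) ∩ B).ncard < ((X : Set α) ∩ Y).ncard →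
        Relation.ReflTransGen (fun X Y : Flag α => X.IsAdjacent Y ∧ I ⊆ (Y : Set α)) X Y := by
      intro X Y hXY hlt
      have := hle X Y
      exact ih _ (by omega) X Y hXY rfl
    by_cases hAB : A = B
    · rw [hAB]
    obtain ⟨a, b, x, y, ⟨haA, haB⟩, ⟨hbA, hbB⟩, ⟨hxA, hxB⟩, ⟨hyB, hyA⟩, hyx, hax, hxb, hay, hyb,
      hgap⟩ := h.exists_gap hAB
    have hgax := h.lt_of_lt _ _ hax
    have hgxb := h.lt_of_lt _ _ hxb
    -- In a gap with a single missing grade, exchanging `x` for `y` gives an adjacent flag that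
    -- shares one more element with `B`.
    by_cases hab : g b = g a + 2
    · have hch : IsChain (· ≤ ·) (insert y ((A : Set α) \ {x})) := by
        refine (A.chain_le.mono Set.sdiff_subset).insert fun z hz _ => ?_
        have hzx : g z ≠ g x := fun h' => hz.2 (h.eq_of_mem A hz.1 hxA h')
        rcases lt_or_gt_of_ne hzx with h' | h'
        · right
          refine le_trans ?_ hay.le
          rcases (show g z ≤ g a by omega).eq_or_lt with h'' | h''
          · exact (h.eq_of_mem A hz.1 haA h'').le
          · exact (h.lt_of_mem A hz.1 haA h'').le
        · left
          refine hyb.le.trans ?_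
          rcases (show g b ≤ g z by omega).eq_or_lt with h'' | h''
          · exact (h.eq_of_mem A hbA hz.1 h'').le
          · exact (h.lt_of_mem A hbA hz.1 h'').le
      obtain ⟨X, hX⟩ := hch.exists_subset_flag
      have hfin := h.finite_flag A
      have hXe : (X : Set α) = insert y ((A : Set α) \ {x}) := by
        refine h.flag_eq_of_subset ?_ hX
        rw [Set.ncard_insert_of_notMem (fun h' => hyA h'.1) (hfin.subset Set.sdiff_subset),
          Set.ncard_sdiff_singleton_add_one hxA hfin, h.ncard_flag]
      have hxy : x ≠ y := by rintro rfl; exact hyA hxA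
      have hadj : A.IsAdjacent X := by
        constructor
        · have : (A : Set α) \ X = {x} := by
            rw [hXe]
            ext z
            simp only [Set.mem_sdiff, Set.mem_insert_iff, Set.mem_singleton_iff, SetLike.mem_coe,
              not_or, not_and, not_not]
            constructor
            · rintro ⟨hz, -, hz'⟩
              exact hz' hz
            · rintro rfl
              exact ⟨hxA, hxy, fun _ => rfl⟩
          rw [this, Set.ncard_singleton]
        · have : (X : Set α) \ A = {y} := by
            rw [hXe]
            ext z
            simp only [Set.mem_sdiff, Set.mem_insert_iff, Set.mem_singleton_iff, SetLike.mem_coe]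
            constructor
            · rintro ⟨rfl | hz, hz'⟩
              · rfl
              · exact absurd hz.1 hz'
            · rintro rfl
              exact ⟨Or.inl rfl, hyA⟩
          rw [this, Set.ncard_singleton]
      have hsub : (A : Set α) ∩ B ⊆ (X : Set α) ∩ B := by
        rintro z ⟨hzA, hzB⟩
        refine ⟨?_, hzB⟩
        rw [hXe]
        exact Or.inr ⟨hzA, by rintro rfl; exact hxB hzB⟩
      refine Relation.ReflTransGen.head ⟨hadj, fun z hz => (hsub (hI hz)).1⟩
        (step X B (hI.trans hsub) (h.ncard_lt_of_mem hsub ⟨?_, hyB⟩ fun h' => hyA h'.1))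
      change y ∈ (X : Set α)
      rw [hXe]
      exact Set.mem_insert _ _
    -- In a longer gap, follow a path from `x` to `y`. Each pair of consecutive path elements
    -- extends with `A ∩ B` to a flag. Consecutive flags share `A ∩ B` and one path element besides,
    -- so the induction hypothesis joins them.
    · have hab' : g a + 3 ≤ g b := by omega
      have hpath := hconn a b (hax.trans hxb) hab' x y hax hxb hay hyb
      have hnot : ∀ w, a < w → w < b → ¬ (w ∈ A ∧ w ∈ B) := fun w h1 h2 h3 => by
        rcases hgap w h3.1 h3.2 with h' | h'
        · exact not_le_of_gt h1 h'
        · exact not_le_of_gt h2 h'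
      have key : ∀ w, Relation.ReflTransGen (fun u v => (u ≤ v ∨ v ≤ u) ∧ a < v ∧ v < b) x w →
          (a < w ∧ w < b) ∧ ∃ X : Flag α, (A : Set α) ∩ B ⊆ X ∧ w ∈ X ∧
          Relation.ReflTransGen (fun X Y : Flag α => X.IsAdjacent Y ∧ I ⊆ (Y : Set α)) A X := by
        intro w hw
        induction hw with
        | refl => exact ⟨⟨hax, hxb⟩, A, Set.inter_subset_left, hxA, Relation.ReflTransGen.refl⟩
        | @tail w v _ hwv ihw =>
          obtain ⟨⟨haw, hwb⟩, X, hXsub, hwX, hAX⟩ := ihw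
          obtain ⟨hcmp, hav, hvb⟩ := hwv
          refine ⟨⟨hav, hvb⟩, ?_⟩
          have hside : ∀ u, a < u → u < b → ∀ z ∈ (A : Set α) ∩ B, u ≤ z ∨ z ≤ u := by
            intro u hau hub z hz
            rcases hgap z hz.1 hz.2 with h' | h'
            · exact Or.inr (h'.trans hau.le)
            · exact Or.inl (hub.le.trans h')
          have hch : IsChain (· ≤ ·) (insert v (insert w ((A : Set α) ∩ B))) := by
            refine ((A.chain_le.mono Set.inter_subset_left).insert
              fun z hz _ => hside w haw hwb z hz).insert fun z hz _ => ?_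
            rcases hz with rfl | hz
            · exact hcmp.symm
            · exact hside v hav hvb z hz
          obtain ⟨Y, hY⟩ := hch.exists_subset_flag
          have hYsub : (A : Set α) ∩ B ⊆ Y := fun z hz => hY (Or.inr (Or.inr hz))
          refine ⟨Y, hYsub, hY (Or.inl rfl), hAX.trans (step X Y ?_ ?_)⟩
          · exact hI.trans (Set.subset_inter hXsub hYsub)
          · exact h.ncard_lt_of_mem (Set.subset_inter hXsub hYsub)
              ⟨hwX, hY (Or.inr (Or.inl rfl))⟩ (hnot w haw hwb)
      obtain ⟨-, X, hXsub, hyX, hAX⟩ := key y hpath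
      have hsub : (A : Set α) ∩ B ⊆ (X : Set α) ∩ B := Set.subset_inter hXsub Set.inter_subset_right
      exact hAX.trans (step X B (hI.trans hsub)
        (h.ncard_lt_of_mem hsub ⟨hyX, hyB⟩ fun h' => hyA h'.1))

theorem isAbstractPolytope {n : ℕ} (h : IsBoundedGrading g (n + 1))
    (hconn : ∀ a b, a < b → g a + 3 ≤ g b → ∀ x y, a < x → x < b → a < y → y < b →
      Relation.ReflTransGen (fun u v => (u ≤ v ∨ v ≤ u) ∧ a < v ∧ v < b) x y)
    (hdiamond : ∀ a b, a < b → g b = g a + 2 → {c | a < c ∧ c < b}.ncard = 2) :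
    IsAbstractPolytope α n where
  exists_least := h.exists_least.imp fun _ h => h.1
  exists_greatest := h.exists_greatest.imp fun _ h => h.1
  ncard_flag := h.ncard_flag
  strongly_flag_connected A B := h.strongly_flag_connected hconn A B _ subset_rfl
  diamond a b hab hh := by
    refine hdiamond a b hab ?_
    rw [h.height_eq, h.height_eq] at hh
    exact_mod_cast hh

end IsBoundedGrading

namespace SimpleGraph

variable {V : Type*} [Fintype V] [DecidableEq V] {G : SimpleGraph V} {T S : Finset (Finset V)}
  {r s t : Finset V}

/-! ### Tubes with different parents -/

/-- If `s₁ ⊂ s₂`, then `t₂` is not properly inside `s₁`, since its parent is `s₂`. So `s₁` lies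
inside `t₂` or apart from it, and `t₁ ⊂ s₁` inherits this. -/
theorem IsAddable.compatible_of_ne {t₁ t₂ s₁ s₂ : Finset V} (h₁ : G.IsAddable T t₁ s₁)
    (h₂ : G.IsAddable T t₂ s₂) (hne : s₁ ≠ s₂) : G.TubesCompatible t₁ t₂ := by
  have key : ∀ {t₁ t₂ s₁ s₂ : Finset V}, G.IsAddable T t₁ s₁ → G.IsAddable T t₂ s₂ → s₁ ⊂ s₂ →
      G.TubesCompatible t₁ t₂ := by
    intro t₁ t₂ s₁ s₂ h₁ h₂ h
    rcases h₂.compatible h₁.isParent.mem with h' | h' | ⟨h', h''⟩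
    · exact absurd (h₂.isParent.le _ h₁.isParent.mem h') h.2
    · exact Or.inl (h₁.isParent.ssubset.trans h')
    · exact Or.inr (Or.inr ⟨(h'.mono_right h₁.isParent.ssubset.1).symm,
        fun a ha b hb hab => h'' b hb a (h₁.isParent.ssubset.1 ha) hab.symm⟩)
  rcases h₁.isTubing_base.compatible' h₁.isParent.mem h₂.isParent.mem hne with h | h | ⟨h, h'⟩
  · exact key h₁ h₂ h
  · exact (key h₂ h₁ h).symm
  · exact Or.inr (Or.inr ⟨h.mono h₁.isParent.ssubset.1 h₂.isParent.ssubset.1,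
      fun a ha b hb => h' a (h₁.isParent.ssubset.1 ha) b (h₂.isParent.ssubset.1 hb)⟩)

theorem IsAddable.insert_of_ne {t₁ t₂ s₁ s₂ : Finset V} (h₁ : G.IsAddable T t₁ s₁)
    (h₂ : G.IsAddable T t₂ s₂) (hne : s₁ ≠ s₂) : G.IsAddable (insert t₁ T) t₂ s₂ := by
  have htne : t₁ ≠ t₂ := by
    rintro rfl
    exact hne (h₁.isParent.eq h₂.isParent)
  refine ⟨?_, ?_, ?_, h₂.isParent.ssubset, ?_⟩
  · refine h₁.isTubing.insert_tube h₂.isTube fun r hr _ => ?_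
    rcases Finset.mem_insert.1 hr with rfl | hr
    · exact h₂.compatible_of_ne h₁ hne.symm
    · exact h₂.compatible (Finset.mem_insert_of_mem hr)
  · rw [Finset.mem_insert, not_or]
    exact ⟨htne.symm, h₂.notMem⟩
  · rw [Finset.insert_comm]
    exact Finset.mem_insert_of_mem h₂.isParent.mem
  · intro r hr htr
    rw [Finset.insert_comm, Finset.mem_insert] at hr
    rcases hr with rfl | hr
    · have h21 : s₂ ⊂ s₁ := (h₂.isParent.le s₁ h₁.isParent.mem
        (htr.trans h₁.isParent.ssubset)).ssubset_of_ne hne.symm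
      obtain ⟨x, hx⟩ := h₂.isConn.1
      rcases (h₁.compatible h₂.isParent.mem).comparable (htr.1 hx) (h₂.isParent.ssubset.1 hx)
        (Or.inl rfl) with h | h
      · exact absurd (h₁.isParent.le _ h₂.isParent.mem h) h21.2
      · exact h.1
    · exact h₂.isParent.le r hr htr

/-! ### Nodes that do not separate a core -/

theorem coreNodes_anti (h : T ⊆ S) (s : Finset V) : coreNodes S s ⊆ coreNodes T s := by
  intro v hv
  rw [mem_coreNodes] at hv ⊢
  exact ⟨hv.1, fun r hr => hv.2 r (h hr)⟩

variable (G) in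
/-- The core node `a` of `s` does not separate the core, and `ta` is the component of `s` without
`a` that contains the other core nodes. -/
structure IsCoTube (T : Finset (Finset V)) (s : Finset V) (a : V) (ta : Finset V) : Prop where
  mem : a ∈ coreNodes T s
  eq_comp : ∀ w ∈ coreNodes T s, w ≠ a → ta = G.comp (s \ {a}) w
  nontrivial : 1 < (coreNodes T s).card

section CoTube

variable {a b v : V} {ta : Finset V}

theorem IsCoTube.exists_ne (h : G.IsCoTube T s a ta) : ∃ w ∈ coreNodes T s, w ≠ a :=
  Finset.exists_mem_ne h.nontrivial a

theorem IsCoTube.subset (h : G.IsCoTube T s a ta) : ta ⊆ s \ {a} := by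
  obtain ⟨w, hw, hwa⟩ := h.exists_ne
  rw [h.eq_comp w hw hwa]
  exact comp_subset

theorem IsCoTube.notMem (h : G.IsCoTube T s a ta) : a ∉ ta := fun ha => by
  simpa using h.subset ha

theorem IsCoTube.mem_of_ne (h : G.IsCoTube T s a ta) {w : V} (hw : w ∈ coreNodes T s)
    (hwa : w ≠ a) : w ∈ ta := by
  rw [h.eq_comp w hw hwa]
  exact self_mem_comp (by simp [hwa, coreNodes_subset hw])

theorem IsCoTube.subset_of_isConn (h : G.IsCoTube T s a ta) (hr : G.IsConn r) (hrs : r ⊆ s \ {a})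
    {w : V} (hw : w ∈ coreNodes T s) (hwr : w ∈ r) : r ⊆ ta := by
  have hwa : w ≠ a := by
    rintro rfl
    simpa using hrs hwr
  rw [h.eq_comp w hw hwa]
  exact hr.subset_comp hrs hwr (self_mem_comp (hrs hwr))

theorem IsCoTube.isAddable (h : G.IsCoTube T s a ta) (hT : G.IsTubing T)
    (hs : s ∈ insert Finset.univ T) : G.IsAddable T ta s := by
  obtain ⟨w, hw, hwa⟩ := h.exists_ne
  rw [h.eq_comp w hw hwa]
  have has := coreNodes_subset h.mem
  refine hT.isAddable_comp hs ⟨Finset.sdiff_subset, fun h' => ?_⟩ ?_ ?_ hw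
  · simpa using h' has
  · intro x hx
    rw [Finset.mem_sdiff] at hx ⊢
    refine ⟨hx.1, fun hxa => hx.2 ?_⟩
    rw [Finset.mem_singleton.1 hxa]
    exact h.mem
  · simp [hwa, coreNodes_subset hw]

theorem IsCoTube.core_inter (h : G.IsCoTube T s a ta) :
    coreNodes T s ∩ ta = (coreNodes T s).erase a := by
  ext w
  rw [Finset.mem_inter, Finset.mem_erase]
  refine ⟨fun hw => ⟨?_, hw.1⟩, fun hw => ⟨hw.2, h.mem_of_ne hw.2 hw.1⟩⟩
  rintro rfl
  exact h.notMem hw.2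

theorem IsCoTube.core_sdiff (h : G.IsCoTube T s a ta) (hS : T ⊆ S) (ha : a ∈ coreNodes S s) :
    coreNodes S s \ ta = {a} := by
  ext w
  rw [Finset.mem_sdiff, Finset.mem_singleton]
  constructor
  · rintro ⟨hw, hwt⟩
    by_contra hwa
    exact hwt (h.mem_of_ne (coreNodes_anti hS s hw) hwa)
  · rintro rfl
    exact ⟨ha, h.notMem⟩

/-- The tube `ta` can be added to a larger tubing if all new tubes avoid `a`. -/
theorem IsCoTube.isAddable_of_subset (h : G.IsCoTube T s a ta) (hS : G.IsTubing S) (hTS : T ⊆ S)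
    (hs : s ∈ insert Finset.univ T)
    (hr : ∀ r ∈ S, r ∉ T → r ⊂ ta ∧ ∃ w ∈ coreNodes T s, w ∈ r) : G.IsAddable S ta s := by
  have hadd := h.isAddable (hS.mono hTS) hs
  refine hS.isAddable hadd.isTube (fun hta => ?_) (fun r hrS => ?_) ⟨?_, hadd.isParent.ssubset,
    fun r hrS htr => ?_⟩
  · exact ssubset_irrefl _ (hr ta hta hadd.notMem).1
  · by_cases hrT : r ∈ T
    · exact hadd.compatible (Finset.mem_insert_of_mem hrT)
    · exact Or.inr (Or.inl (hr r hrS hrT).1)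
  · exact Finset.insert_subset_insert _ hTS hs
  · rcases Finset.mem_insert.1 hrS with rfl | hrS
    · exact Finset.subset_univ _
    · by_cases hrT : r ∈ T
      · exact hadd.isParent.le r (Finset.mem_insert_of_mem hrT) htr
      · exact absurd (hr r hrS hrT).1.1 htr.2

theorem exists_isCoTube (ha : a ∈ coreNodes T s) (hU : 1 < (coreNodes T s).card)
    (h : ∀ u ∈ coreNodes T s, u ≠ a → ∀ w ∈ coreNodes T s, w ≠ a → G.ReachIn (s \ {a}) u w) :
    ∃ ta, G.IsCoTube T s a ta := by
  obtain ⟨u, hu, hua⟩ := Finset.exists_mem_ne hU a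
  refine ⟨G.comp (s \ {a}) u, ha, fun w hw hwa => (comp_eq_of_mem ?_).symm, hU⟩
  rw [mem_comp]
  exact ⟨by simp [hwa, coreNodes_subset hw], h u hu hua w hw hwa⟩

/-- Every component of `s` without the core node `v` contains a core node that does not separate
the core. -/
theorem exists_isCoTube_of_reachIn (hs : G.IsConn s) (hv : v ∈ coreNodes T s) {u : V}
    (hu : u ∈ coreNodes T s) (huv : u ≠ v) :
    ∃ a ∈ coreNodes T s, a ≠ v ∧ G.ReachIn (s \ {v}) u a ∧ ∃ ta, G.IsCoTube T s a ta := by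
  classical
  -- The node `a` is chosen as far from `v` as possible: its removal leaves the largest component
  -- around `v`.
  obtain ⟨a, ha, hmax⟩ := Finset.exists_max_image
    ((coreNodes T s).filter fun a => a ≠ v ∧ G.ReachIn (s \ {v}) u a)
    (fun a => (G.comp (s \ {a}) v).card) ⟨u, by simp [hu, huv, ReachIn.refl]⟩
  simp only [Finset.mem_filter] at ha hmax
  obtain ⟨haU, hav, hua⟩ := ha
  have hvs := coreNodes_subset hv
  have has := coreNodes_subset haU
  have hva : v ∈ s \ {a} := by simp [hvs, Ne.symm hav]
  refine ⟨a, haU, hav, hua, exists_isCoTube haU (Finset.one_lt_card.2 ⟨a, haU, v, hv, hav⟩) ?_⟩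
  have key : ∀ w ∈ coreNodes T s, w ≠ a → G.ReachIn (s \ {a}) v w := by
    intro w hw hwa
    by_contra hcon
    have hws := coreNodes_subset hw
    have hwv : w ≠ v := by
      rintro rfl
      exact hcon (ReachIn.refl _)
    have hwsa : w ∈ s \ {a} := by simp [hws, hwa]
    have hexit : ∀ x ∈ s \ {a}, ∃ p ∈ G.comp (s \ {a}) x, G.Adj p a := by
      intro x hx
      obtain ⟨p, hp, hpL, q, hq, hqL, hpq⟩ := hs.exists_adj (X := G.comp (s \ {a}) x)
        ⟨x, Finset.mem_inter.2 ⟨(Finset.mem_sdiff.1 hx).1, self_mem_comp hx⟩⟩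
        (fun h => by simpa using comp_subset (h has))
      by_cases hqa : q = a
      · exact ⟨p, hpL, hqa ▸ hpq⟩
      · exact absurd (comp_closed hpL (by simp [hq, hqa]) hpq) hqL
    have hL : G.comp (s \ {a}) w ⊆ s \ {v} := by
      intro x hx
      rw [Finset.mem_sdiff, Finset.mem_singleton]
      refine ⟨(Finset.mem_sdiff.1 (comp_subset hx)).1, ?_⟩
      rintro rfl
      exact hcon (mem_comp.1 hx).2.symm
    have hwa' : G.ReachIn (s \ {v}) w a := by
      obtain ⟨p, hp, hpa⟩ := hexit w hwsa
      exact (((isConn_comp hwsa).2 w (self_mem_comp hwsa) p hp).mono hL).trans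
        (ReachIn.single (hL hp) (by simp [has, hav]) hpa)
    have hK : G.comp (s \ {a}) v ⊆ s \ {w} := by
      intro x hx
      rw [Finset.mem_sdiff, Finset.mem_singleton]
      refine ⟨(Finset.mem_sdiff.1 (comp_subset hx)).1, ?_⟩
      rintro rfl
      exact hcon (mem_comp.1 hx).2
    -- If `a` cuts `w` off from `v`, removing `w` instead of `a` keeps the component of `v` and adds
    -- `a` to it. As `w` is joined to `a` without `v`, it is a better choice than `a`.
    have hlt : G.comp (s \ {a}) v ⊂ G.comp (s \ {w}) v := by
      have hvK : v ∈ s \ {w} := by simp [hvs, Ne.symm hwv]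
      refine ⟨(isConn_comp hva).subset_comp hK (self_mem_comp hva) (self_mem_comp hvK),
        fun h => ?_⟩
      obtain ⟨p, hp, hpa⟩ := hexit v hva
      have : a ∈ G.comp (s \ {w}) v := comp_closed
        ((isConn_comp hva).subset_comp hK (self_mem_comp hva) (self_mem_comp hvK) hp)
        (by simp [has, Ne.symm hwa]) hpa
      simpa using comp_subset (h this)
    exact absurd (hmax w ⟨hw, hwv, hua.trans hwa'.symm⟩) (not_le.2 (Finset.card_lt_card hlt))
  exact fun u hu hua w hw hwa => (key u hu hua).symm.trans (key w hw hwa)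

end CoTube

/-! ### The components left by a node of the core -/

section Comps

variable (G) in
/-- The components of `s` without the core node `v` that contain core nodes, added to `T`. -/
noncomputable def addComps (T : Finset (Finset V)) (s : Finset V) (v : V) : Finset (Finset V) :=
  T ∪ ((coreNodes T s).erase v).image (G.comp (s \ {v}))

variable {a v : V} {ta : Finset V}

theorem mem_addComps : r ∈ G.addComps T s v ↔
    r ∈ T ∨ ∃ u ∈ coreNodes T s, u ≠ v ∧ G.comp (s \ {v}) u = r := by
  simp only [addComps, Finset.mem_union, Finset.mem_image, Finset.mem_erase]
  constructor
  · rintro (h | ⟨u, ⟨h1, h2⟩, h⟩)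
    · exact Or.inl h
    · exact Or.inr ⟨u, h2, h1, h⟩
  · rintro (h | ⟨u, h1, h2, h⟩)
    · exact Or.inl h
    · exact Or.inr ⟨u, ⟨h2, h1⟩, h⟩

theorem isAddable_comp_sdiff (hT : G.IsTubing T) (hs : s ∈ insert Finset.univ T)
    (hv : v ∈ coreNodes T s) (ha : a ∈ coreNodes T s) (hav : a ≠ v) :
    G.IsAddable T (G.comp (s \ {v}) a) s := by
  have hvs := coreNodes_subset hv
  refine hT.isAddable_comp hs ⟨Finset.sdiff_subset, fun h' => ?_⟩ ?_ ?_ ha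
  · simpa using h' hvs
  · intro x hx
    rw [Finset.mem_sdiff] at hx ⊢
    refine ⟨hx.1, fun hxa => hx.2 ?_⟩
    rw [Finset.mem_singleton.1 hxa]
    exact hv
  · simp [hav, coreNodes_subset ha]

theorem isTubing_addComps (hT : G.IsTubing T) (hs : s ∈ insert Finset.univ T)
    (hv : v ∈ coreNodes T s) : G.IsTubing (G.addComps T s v) := by
  have key : ∀ r ∈ T, ∀ u ∈ coreNodes T s, u ≠ v → G.TubesCompatible (G.comp (s \ {v}) u) r :=
    fun r hr u hu huv => (isAddable_comp_sdiff hT hs hv hu huv).compatible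
      (Finset.mem_insert_of_mem hr)
  constructor
  · intro r hr
    rcases mem_addComps.1 hr with hr | ⟨u, hu, huv, rfl⟩
    · exact hT.isTube r hr
    · exact (isAddable_comp_sdiff hT hs hv hu huv).isTube
  · intro r hr r' hr' hne
    rcases mem_addComps.1 hr with hr | ⟨u, hu, huv, rfl⟩ <;>
      rcases mem_addComps.1 hr' with hr' | ⟨w, hw, hwv, rfl⟩
    · exact hT.compatible r hr r' hr' hne
    · exact (key r hr w hw hwv).symm
    · exact key r' hr' u hu huv
    · have hdis : ∀ x ∈ G.comp (s \ {v}) u, x ∉ G.comp (s \ {v}) w := fun x hx hx' =>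
        hne ((comp_eq_of_mem hx).symm.trans (comp_eq_of_mem hx'))
      exact Or.inr (Or.inr ⟨Finset.disjoint_left.2 hdis,
        fun x hx y hy hxy => hdis y (comp_closed hx (comp_subset hy) hxy) hy⟩)

/-- The components left by `v`, except for the one with `a`, can be completed by that component or
by the tube that avoids `a`. -/
theorem IsCoTube.addComps_erase (h : G.IsCoTube T s a ta) (hT : G.IsTubing T)
    (hs : s ∈ insert Finset.univ T) (hv : v ∈ coreNodes T s) (hav : a ≠ v)
    (hS : S = (G.addComps T s v).erase (G.comp (s \ {v}) a)) :
    T ⊆ S ∧ G.IsAddable S (G.comp (s \ {v}) a) s ∧ G.IsAddable S ta s ∧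
      coreNodes S s \ G.comp (s \ {v}) a = {v} ∧ coreNodes S s \ ta = {a} := by
  have hA := isAddable_comp_sdiff hT hs hv h.mem hav
  have haR : a ∈ s \ {v} := by simp [hav, coreNodes_subset h.mem]
  have haA : a ∈ G.comp (s \ {v}) a := self_mem_comp haR
  have hmem : ∀ r, r ∈ S ↔ r ∈ T ∨ ∃ u ∈ coreNodes T s, u ∉ G.comp (s \ {v}) a ∧ u ≠ v ∧
      G.comp (s \ {v}) u = r := by
    intro r
    rw [hS, Finset.mem_erase, mem_addComps]
    constructor
    · rintro ⟨hne, hr | ⟨u, hu, huv, hr⟩⟩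
      · exact Or.inl hr
      · refine Or.inr ⟨u, hu, fun huA => hne ?_, huv, hr⟩
        rw [← hr, comp_eq_of_mem huA]
    · rintro (hr | ⟨u, hu, huA, huv, hr⟩)
      · exact ⟨by rintro rfl; exact hA.notMem hr, Or.inl hr⟩
      · refine ⟨?_, Or.inr ⟨u, hu, huv, hr⟩⟩
        rintro rfl
        exact huA (hr ▸ self_mem_comp (by simp [huv, coreNodes_subset hu]))
  have hTS : T ⊆ S := fun r hr => (hmem r).2 (Or.inl hr)
  have hAS : insert (G.comp (s \ {v}) a) S = G.addComps T s v := by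
    rw [hS, Finset.insert_erase (mem_addComps.2 (Or.inr ⟨a, h.mem, hav, rfl⟩))]
  have htub := isTubing_addComps hT hs hv
  have hSt : G.IsTubing S := htub.mono (hS ▸ Finset.erase_subset _ _)
  -- The remaining components avoid both `a` and `v`; hence they fit properly inside `ta`, which
  -- contains `v`.
  have hnew : ∀ r ∈ S, r ∉ T → a ∉ r ∧ v ∉ r ∧ r ⊆ s ∧ G.IsConn r ∧
      ∃ w ∈ coreNodes T s, w ∈ r := by
    intro r hr hrT
    rcases (hmem r).1 hr with hr | ⟨u, hu, huA, huv, rfl⟩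
    · exact absurd hr hrT
    · have huR : u ∈ s \ {v} := by simp [huv, coreNodes_subset hu]
      refine ⟨fun ha => huA ?_, fun hv => by simpa using comp_subset hv,
        comp_subset.trans Finset.sdiff_subset, isConn_comp huR, u, hu, self_mem_comp huR⟩
      rw [comp_eq_of_mem ha]
      exact self_mem_comp huR
  refine ⟨hTS, ⟨?_, ?_, ?_, hA.isParent.ssubset, ?_⟩, ?_, ?_, ?_⟩
  · rwa [hAS]
  · rw [hS]
    exact Finset.notMem_erase _ _
  · exact Finset.insert_subset_insert _ hTS hs
  · intro r hr hAr
    by_cases hrT : r ∈ insert Finset.univ T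
    · exact hA.isParent.le r hrT hAr
    · rw [Finset.mem_insert, not_or] at hrT
      exact absurd (hAr.1 haA) (hnew r ((Finset.mem_insert.1 hr).resolve_left hrT.1) hrT.2).1
  · refine h.isAddable_of_subset hSt hTS hs fun r hr hrT => ?_
    obtain ⟨har, hvr, hrs, hrc, w, hw, hwr⟩ := hnew r hr hrT
    refine ⟨⟨h.subset_of_isConn hrc (fun x hx => ?_) hw hwr, fun h' => ?_⟩, w, hw, hwr⟩
    · rw [Finset.mem_sdiff, Finset.mem_singleton]
      exact ⟨hrs hx, by rintro rfl; exact har hx⟩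
    · exact hvr (h' (h.mem_of_ne hv hav.symm))
  · ext w
    rw [Finset.mem_sdiff, Finset.mem_singleton, mem_coreNodes]
    constructor
    · rintro ⟨⟨hws, hw⟩, hwA⟩
      by_contra hwv
      have hwU : w ∈ coreNodes T s := mem_coreNodes.2 ⟨hws, fun r hr => hw r (hTS hr)⟩
      have hwR : w ∈ s \ {v} := by simp [hwv, hws]
      exact hw _ ((hmem _).2 (Or.inr ⟨w, hwU, hwA, hwv, rfl⟩))
        (isAddable_comp_sdiff hT hs hv hwU hwv).isParent.ssubset (self_mem_comp hwR)
    · rintro rfl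
      refine ⟨⟨coreNodes_subset hv, fun r hr hrs => ?_⟩, fun h' => by simpa using comp_subset h'⟩
      by_cases hrT : r ∈ T
      · exact (mem_coreNodes.1 hv).2 r hrT hrs
      · exact (hnew r hr hrT).2.1
  · refine h.core_sdiff hTS (mem_coreNodes.2 ⟨coreNodes_subset h.mem, fun r hr hrs => ?_⟩)
    by_cases hrT : r ∈ T
    · exact (mem_coreNodes.1 h.mem).2 r hrT hrs
    · exact (hnew r hr hrT).1

end Comps

end SimpleGraph

namespace SimpleGraph

variable {V : Type*} [Fintype V] [DecidableEq V] {G : SimpleGraph V} {C : Type*}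

namespace ColorTemplate

variable {P : Multiset C} {x y y' z h : G.ColorTemplate P} {r s t : Finset V}

/-! ### Paths of faces below a given face -/

/-- `x` and `y` are joined by a path of pairwise comparable proper faces of `h`. -/
def Linked (h : G.ColorTemplate P) : G.ColorTemplate P → G.ColorTemplate P → Prop :=
  Relation.ReflTransGen fun u v => (u ≤ v ∨ v ≤ u) ∧ u < h ∧ v < h

theorem Linked.symm (H : Linked h x y) : Linked h y x := by
  unfold Linked at H
  induction H with
  | refl => exact Relation.ReflTransGen.refl
  | tail _ hbc ih => exact ih.head ⟨hbc.1.symm, hbc.2.2, hbc.2.1⟩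

theorem Linked.trans (H : Linked h x y) (H' : Linked h y z) : Linked h x z :=
  Relation.ReflTransGen.trans H H'

theorem Linked.of_le (hxy : x ≤ y) (hy : y < h) : Linked h x y :=
  Relation.ReflTransGen.single ⟨Or.inl hxy, hxy.trans_lt hy, hy⟩

theorem Linked.of_ge (hxy : y ≤ x) (hx : x < h) : Linked h x y := (Linked.of_le hxy hx).symm

theorem lt_of_le_of_mem (hG : G.Connected) (hx : x ≤ h) (hxy : x ≤ y)
    (hT : h.tubing.tubes ⊆ y.tubing.tubes) (hr : r ∈ y.tubing.tubes)
    (hrh : r ∉ h.tubing.tubes) : y < h :=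
  (le_of_tubes_subset hG hxy hx hT).lt_of_ne (by rintro rfl; exact hrh hr)

theorem StepVia.lt (H : StepVia x y t s) : x < y :=
  H.le.lt_of_ne (by rintro rfl; exact H.isAddable.notMem H.mem)

theorem exists_mem_of_lt (hx : x < h) : ∃ t ∈ x.tubing.tubes, t ∉ h.tubing.tubes := by
  by_contra hcon
  push Not at hcon
  exact hx.ne (eq_of_le_of_tubes_eq hx.le (Finset.Subset.antisymm hcon (tubes_subset_of_le hx.le)))

/-- The facet of `h` above `x` that contains a given tube of `x`. -/
theorem exists_facet_of_mem (hG : G.Connected) (hx : x ≤ h) (ht : t ∈ x.tubing.tubes)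
    (hth : t ∉ h.tubing.tubes) : ∃ z s, x ≤ z ∧ StepVia z h t s := by
  obtain ⟨z, hxz, hz⟩ := exists_ge_of_subset hG x
    (Finset.insert_subset ht (tubes_subset_of_le hx))
  obtain ⟨s, hs⟩ := exists_stepVia_of_le hG
    (le_of_tubes_subset hG hxz hx (hz ▸ Finset.subset_insert _ _)) hth hz
  exact ⟨z, s, hxz, hs⟩

theorem exists_facet (hG : G.Connected) (hx : x < h) : ∃ z t s, x ≤ z ∧ StepVia z h t s := by
  obtain ⟨t, ht, hth⟩ := exists_mem_of_lt hx
  obtain ⟨z, s, hz⟩ := exists_facet_of_mem hG hx.le ht hth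
  exact ⟨z, t, s, hz⟩

/-- Facets at different tubes have a common face. -/
theorem exists_common_le (hG : G.Connected) {z₁ z₂ : G.ColorTemplate P} {t₁ t₂ s₁ s₂ : Finset V}
    (h₁ : StepVia z₁ h t₁ s₁) (h₂ : StepVia z₂ h t₂ s₂) (hne : s₁ ≠ s₂) :
    ∃ q, q ≤ z₁ ∧ q ≤ z₂ := by
  have ha₂ : G.IsAddable z₁.tubing.tubes t₂ s₂ := by
    rw [h₁.tubes_eq]
    exact h₁.isAddable.insert_of_ne h₂.isAddable hne
  have ha₁ : G.IsAddable (insert t₂ h.tubing.tubes) t₁ s₁ :=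
    h₂.isAddable.insert_of_ne h₁.isAddable hne.symm
  have hs₂t₁ : s₂ ≠ t₁ := fun he => h₁.isAddable.notMem_insert (he ▸ h₂.isAddable.isParent.mem)
  have hs₁t₂ : s₁ ≠ t₂ := fun he => h₂.isAddable.notMem_insert (he ▸ h₁.isAddable.isParent.mem)
  have ht : t₁ ≠ t₂ := fun he => ha₁.notMem (he ▸ Finset.mem_insert_self _ _)
  -- The tube `t₂` is added to `z₁` with the very splitting that `z₂` uses, which is possible since
  -- `z₁` and `h` agree at `s₂`.
  obtain ⟨ℓ₁, ℓ₂, hℓ, hℓ₁, hℓ₂⟩ := h₂.exists_isListing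
  obtain ⟨q, hq, hqℓ₁, hqℓ₂⟩ := exists_stepVia_of_isAddable hG z₁ ha₂ (ℓ₁ := ℓ₁) (ℓ₂ := ℓ₂) (by
      rwa [h₁.blocks_eq s₂ hs₂t₁ hne.symm]) (by
      rw [h₁.tubes_eq, h₁.isAddable.isParent.coreNodes_of_ne h₂.isAddable.isParent.mem hne.symm]
      exact h₂.fitsCore_parent.length_listing hℓ₁)
  have hqT : q.tubing.tubes = insert t₁ (insert t₂ h.tubing.tubes) := by
    rw [hq.tubes_eq, h₁.tubes_eq, Finset.insert_comm]
  -- Removing `t₁` again must give `z₂`.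
  obtain ⟨w, hqw, hw⟩ := exists_ge_of_subset hG q (S := insert t₂ h.tubing.tubes)
    (by rw [hqT]; exact Finset.subset_insert _ _)
  have hwh : w ≤ h := le_of_tubes_subset hG hqw (hq.le.trans h₁.le)
    (hw ▸ Finset.subset_insert _ _)
  obtain ⟨a, hwa⟩ := exists_stepVia_of_le hG hwh h₂.isAddable.notMem hw
  obtain rfl := hwa.isAddable.isParent.eq h₂.isAddable.isParent
  obtain ⟨b, hqb⟩ := exists_stepVia_of_le hG hqw (by rw [hw]; exact ha₁.notMem)
    (by rw [hqT, hw])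
  obtain rfl := hqb.isAddable.isParent.eq (by rw [hw]; exact ha₁.isParent)
  have hwz : w.tubing.tubes = z₂.tubing.tubes := by rw [hw, h₂.tubes_eq]
  suffices w = z₂ by
    subst this
    exact ⟨q, hq.le, hqw⟩
  refine eq_of_blocks hwz fun r hr => ?_
  by_cases hr1 : r = a
  · subst hr1
    refine blocks_eq_of_isListing hwz hr ?_ hℓ₁
    rwa [← hqb.blocks_eq r hs₂t₁ hne.symm]
  by_cases hr2 : r = t₂
  · subst hr2
    refine blocks_eq_of_isListing hwz hr ?_ hℓ₂
    rwa [← hqb.blocks_eq r ht.symm hs₁t₂.symm]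
  · rw [hwa.blocks_eq r hr2 hr1, h₂.blocks_eq r hr2 hr1]

/-- A tube can be exchanged, keeping its color, if its parent then has a single core node. -/
theorem StepVia.exists_flip (hG : G.Connected) {t' : Finset V} (H : StepVia x z t s)
    (ht' : G.IsAddable z.tubing.tubes t' s) (hc : (coreNodes z.tubing.tubes s \ t).card = 1)
    (hc' : (coreNodes z.tubing.tubes s \ t').card = 1) :
    ∃ x', StepVia x' z t' s ∧ (x'.blocks t').color = (x.blocks t).color := by
  obtain ⟨ℓ₁, ℓ₂, hℓ, hℓ₁, hℓ₂⟩ := H.exists_isListing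
  have hlen := H.fitsCore_parent.length_listing hℓ₁
  -- Both tubes leave `s` equally many core nodes, so one splitting serves both and its second part
  -- has the same head.
  rw [show (coreNodes z.tubing.tubes s \ t).card = (coreNodes z.tubing.tubes s \ t').card from
    hc.trans hc'.symm] at hlen
  obtain ⟨x', hx', -, hxℓ⟩ := exists_stepVia_of_isAddable hG z ht' hℓ hlen
  obtain ⟨c, hc⟩ := Option.isSome_iff_exists.1 (x.color_tube t H.mem)
  obtain ⟨ℓ', rfl⟩ := hℓ₂.eq_cons hc
  exact ⟨x', hx', by rw [hc, hxℓ.color_eq (x'.color_tube t' hx'.mem)]⟩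

/-! ### Facets whose parent has a single core node -/

/-- A core with one node has no outer or inner colors, and the color of the parent is inherited from
`h`. -/
theorem StepVia.blocks_parent_eq {s' : Finset V} (H : StepVia y h t s) (H' : StepVia y' h t s')
    (hc : (coreNodes h.tubing.tubes s \ t).card = 1) : y.blocks s = y'.blocks s := by
  obtain rfl := H.isAddable.isParent.eq H'.isAddable.isParent
  have f := H.fitsCore_parent
  have f' := H'.fitsCore_parent
  have hk := G.relConn_le_card_sub_one (coreNodes h.tubing.tubes s \ t) s
  have hin : ∀ b : ColorBlocks C, G.FitsCore (coreNodes h.tubing.tubes s \ t) s b →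
      b.outer = [] ∧ b.inner = 0 := fun b hb => by
    have h1 := hb.length_outer
    have h2 := hb.card_inner
    rw [hc] at hk h2
    exact ⟨List.eq_nil_of_length_eq_zero (by omega), Multiset.card_eq_zero.1 (by omega)⟩
  ext1
  · by_cases hs : s = Finset.univ
    · subst hs
      rw [y.color_univ, y'.color_univ]
    · have hsh : s ∈ h.tubing.tubes :=
        (Finset.mem_insert.1 H.isAddable.isParent.mem).resolve_left hs
      rw [H.color_eq hsh, H'.color_eq hsh]
  · rw [(hin _ f).1, (hin _ f').1]
  · rw [(hin _ f).2, (hin _ f').2]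

/-- The blocks of the parent agree, so the colors left for `t` agree as multisets. The ordered part
of `t` then determines its inner block by cancellation. -/
theorem StepVia.eq_of_pre_eq {s' : Finset V} (H : StepVia y h t s) (H' : StepVia y' h t s')
    (hc : (coreNodes h.tubing.tubes s \ t).card = 1)
    (hpre : (y.blocks t).pre = (y'.blocks t).pre) : y = y' := by
  have hs := H.blocks_parent_eq H' hc
  obtain rfl := H.isAddable.isParent.eq H'.isAddable.isParent
  have hT : y.tubing.tubes = y'.tubing.tubes := by rw [H.tubes_eq, H'.tubes_eq]
  have hcol : ∀ b : ColorBlocks C, b.colors = (b.pre : Multiset C) + b.inner := fun b => by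
    rw [ColorBlocks.colors, ColorBlocks.pre, Multiset.coe_add]
  have hsum : ∀ {w : G.ColorTemplate P}, StepVia w h t s →
      (h.blocks s).colors = (w.blocks s).colors + (w.blocks t).colors := by
    intro w hw
    obtain ⟨ℓ₁, ℓ₂, h1, h2, h3⟩ := hw.exists_isListing
    rw [← h1.coe_eq, ← h2.coe_eq, ← h3.coe_eq, Multiset.coe_add]
  have hin : (y.blocks t).inner = (y'.blocks t).inner := by
    have e := (hsum H).symm.trans (hsum H')
    rw [hs] at e
    have e' := add_left_cancel e
    rw [hcol, hcol, hpre] at e'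
    exact add_left_cancel e'
  refine eq_of_blocks hT fun r _ => ?_
  by_cases hrs : r = s
  · rw [hrs, hs]
  by_cases hrt : r = t
  · subst hrt
    obtain ⟨c, hc⟩ := Option.isSome_iff_exists.1 (y.color_tube r H.mem)
    obtain ⟨c', hc'⟩ := Option.isSome_iff_exists.1 (y'.color_tube r H'.mem)
    simp only [ColorBlocks.pre, hc, hc', Option.toList_some, List.cons_append, List.nil_append,
      List.cons.injEq] at hpre
    exact ColorBlocks.ext (by rw [hc, hc', hpre.1]) hpre.2 hin
  · rw [H.blocks_eq r hrt hrs, H'.blocks_eq r hrt hrs]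

/-- The outer colors of `s` in `h` suffice for the color and the outer blocks of `t`. They are
ordered, so no choice remains. -/
theorem StepVia.eq_of_relConn_lt {s' : Finset V} (H : StepVia y h t s) (H' : StepVia y' h t s')
    (hc : (coreNodes h.tubing.tubes s \ t).card = 1)
    (hk : 1 + (G.relConn (coreNodes h.tubing.tubes s ∩ t) t - 1) ≤
      G.relConn (coreNodes h.tubing.tubes s) s - 1) : y = y' := by
  have hs := H.blocks_parent_eq H' hc
  obtain rfl := H.isAddable.isParent.eq H'.isAddable.isParent
  refine H.eq_of_pre_eq H' hc ?_
  obtain ⟨ℓ, hℓ⟩ := (y.blocks s).exists_isListing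
  have hlen := H.fitsCore_parent.length_listing hℓ
  have hpre := (h.fitsCore H.isAddable.isParent.mem).length_pre
  have hot : ownColor t = 1 := if_neg H.isAddable.ne_univ
  have key : ∀ {w : G.ColorTemplate P}, StepVia w h t s → (w.blocks s).IsListing ℓ →
      ℓ ++ (w.blocks t).pre = ((h.blocks s).pre).take
        (ownColor s + (1 + (G.relConn (coreNodes h.tubing.tubes s ∩ t) t - 1))) := by
    intro w hw hwℓ
    obtain ⟨ℓ₂, hℓ₂⟩ := (w.blocks t).exists_isListing
    have hl := hw.isListing hwℓ hℓ₂
    obtain ⟨m, -, hm⟩ := ColorBlocks.isListing_iff.1 hl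
    obtain ⟨m₂, -, rfl⟩ := ColorBlocks.isListing_iff.1 hℓ₂
    have hp := hw.fitsCore_self.length_pre
    rw [← List.append_assoc] at hm
    have e := congrArg (List.take (ownColor s +
      (1 + (G.relConn (coreNodes h.tubing.tubes s ∩ t) t - 1)))) hm
    rw [List.take_append_of_le_length (l₁ := (h.blocks s).pre) (by rw [hpre]; omega)] at e
    rw [← e, List.take_left']
    rw [List.length_append]
    omega
  have e := (key H hℓ).trans (key H' (hs ▸ hℓ)).symm
  exact List.append_cancel_left e

/-- With connectivity at most one there are no outer blocks, and the ordered part of `t` is just its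
color. -/
theorem StepVia.eq_of_color_eq {s' : Finset V} (H : StepVia y h t s) (H' : StepVia y' h t s')
    (hc : (coreNodes h.tubing.tubes s \ t).card = 1)
    (hk : G.relConn (coreNodes h.tubing.tubes s ∩ t) t ≤ 1)
    (hcol : (y.blocks t).color = (y'.blocks t).color) : y = y' := by
  have f := H.fitsCore_self.length_outer
  obtain rfl := H.isAddable.isParent.eq H'.isAddable.isParent
  have f' := H'.fitsCore_self.length_outer
  refine H.eq_of_pre_eq H' hc ?_
  rw [ColorBlocks.pre, ColorBlocks.pre, hcol, List.eq_nil_of_length_eq_zero (l := (y.blocks t).outer)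
    (by omega), List.eq_nil_of_length_eq_zero (l := (y'.blocks t).outer) (by omega)]

/-! ### Facets at a single core -/

section SingleCore

variable {a b v : V} {ta tb : Finset V}

/-- A face with tubes compatible with `ta` is linked to a facet with tube `ta`. -/
theorem exists_linked_of_isTubing (hG : G.Connected) (hs : s ∈ insert Finset.univ h.tubing.tubes)
    (ha : G.IsCoTube h.tubing.tubes s a ta) (hx : x < h)
    (hT : G.IsTubing (insert ta x.tubing.tubes)) : ∃ y, StepVia y h ta s ∧ Linked h x y := by
  have hadd := ha.isAddable h.tubing.isTubing hs
  obtain ⟨q, hqx, hq⟩ := exists_le_of_subset hG x hT (Finset.subset_insert _ _)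
  obtain ⟨y, s', hqy, hy⟩ := exists_facet_of_mem hG (hqx.trans hx.le) (t := ta)
    (by rw [hq]; exact Finset.mem_insert_self _ _) hadd.notMem
  obtain rfl := hy.isAddable.isParent.eq hadd.isParent
  exact ⟨y, hy, (Linked.of_ge hqx hx).trans (Linked.of_le hqy hy.lt)⟩

theorem StepVia.exists_core_mem (hG : G.Connected) (H : StepVia z h t s) :
    ∃ w ∈ coreNodes h.tubing.tubes s, w ∈ t := by
  obtain ⟨w, hw⟩ := H.isAddable.inter_nonempty hG
  rw [Finset.mem_inter] at hw
  exact ⟨w, hw⟩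

/-- A tube that avoids `a` contains a core node and hence lies in `ta`. The two tubes are compatible
and have a common face below `z`. -/
theorem StepVia.exists_linked_of_notMem (hG : G.Connected) (H : StepVia z h t s)
    (ha : G.IsCoTube h.tubing.tubes s a ta) (hat : a ∉ t) :
    ∃ y, StepVia y h ta s ∧ Linked h z y := by
  by_cases htt : t = ta
  · subst htt
    exact ⟨z, H, Relation.ReflTransGen.refl⟩
  refine exists_linked_of_isTubing hG H.isAddable.isParent.mem ha H.lt ?_
  refine (ha.isAddable_of_subset z.tubing.isTubing (tubes_subset_of_le H.le)
    H.isAddable.isParent.mem fun r hr hrh => ?_).isTubing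
  rw [H.tubes_eq] at hr
  obtain rfl := (Finset.mem_insert.1 hr).resolve_right hrh
  obtain ⟨w, hw, hwr⟩ := H.exists_core_mem hG
  refine ⟨(ha.subset_of_isConn H.isAddable.isConn (fun u hu => ?_) hw hwr).ssubset_of_ne htt,
    w, hw, hwr⟩
  rw [Finset.mem_sdiff, Finset.mem_singleton]
  exact ⟨H.isAddable.isParent.ssubset.1 hu, by rintro rfl; exact hat hu⟩

/-- In a face with a tube `t` that contains core nodes `a` and `w`, a tube inside `t` that avoids
`a` but contains `w` can be added. -/
theorem StepVia.exists_subtube (hG : G.Connected) (H : StepVia z h t s)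
    (ha : a ∈ coreNodes h.tubing.tubes s) (hat : a ∈ t) {w : V}
    (hw : w ∈ coreNodes h.tubing.tubes s) (hwt : w ∈ t) (hwa : w ≠ a) :
    ∃ e q z', StepVia q z e t ∧ a ∉ e ∧ w ∈ e ∧ StepVia z' h e s ∧ StepVia q z' t s := by
  have hself := H.isAddable.isParent.coreNodes_self H.isAddable.isTubing H.isAddable.notMem
  rw [← H.tubes_eq] at hself
  have hadd : G.IsAddable z.tubing.tubes (G.comp (t \ {a}) w) t := by
    refine isAddable_comp_sdiff z.tubing.isTubing (Finset.mem_insert_of_mem H.mem) ?_ ?_ hwa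
    · rw [hself]
      exact Finset.mem_inter.2 ⟨ha, hat⟩
    · rw [hself]
      exact Finset.mem_inter.2 ⟨hw, hwt⟩
  have hwR : w ∈ t \ {a} := by simp [hwt, hwa]
  have hwe : w ∈ G.comp (t \ {a}) w := self_mem_comp hwR
  obtain ⟨q, hq⟩ := exists_stepVia_of_isAddable' hG z hadd
  have heh : G.comp (t \ {a}) w ∉ h.tubing.tubes := fun he =>
    hadd.notMem (tubes_subset_of_le H.le he)
  obtain ⟨z', s', hqz', hz'⟩ := exists_facet_of_mem hG (hq.le.trans H.le) hq.mem heh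
  have hes : G.comp (t \ {a}) w ⊂ s := hadd.isParent.ssubset.trans H.isAddable.isParent.ssubset
  -- The subtube contains the core node `w` of `s`, and no smaller set of the tubing of `h` does.
  have hs' : s' = s := by
    have h1 := hz'.isAddable.isParent.le s H.isAddable.isParent.mem hes
    by_contra hne
    rcases Finset.mem_insert.1 hz'.isAddable.isParent.mem with hu | hu
    · exact hne (h1.antisymm (hu ▸ Finset.subset_univ s))
    · exact (mem_coreNodes.1 hw).2 s' hu (h1.ssubset_of_ne hne)
        (hz'.isAddable.isParent.ssubset.1 hwe)
  subst hs'
  have htz' : t ∉ z'.tubing.tubes := by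
    rw [hz'.tubes_eq, Finset.mem_insert, not_or]
    exact ⟨hadd.ne, H.isAddable.notMem⟩
  have hqT : q.tubing.tubes = insert t z'.tubing.tubes := by
    rw [hq.tubes_eq, H.tubes_eq, hz'.tubes_eq, Finset.insert_comm]
  obtain ⟨s'', hs''⟩ := exists_stepVia_of_le hG hqz' htz' hqT
  have : s'' = s' := by
    refine hs''.isAddable.isParent.eq ⟨?_, H.isAddable.isParent.ssubset, fun r hr htr => ?_⟩
    · rw [hz'.tubes_eq, Finset.insert_comm]
      exact Finset.mem_insert_of_mem H.isAddable.isParent.mem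
    · rw [hz'.tubes_eq, Finset.insert_comm, Finset.mem_insert] at hr
      rcases hr with rfl | hr
      · exact absurd hadd.isParent.ssubset.1 htr.2
      · exact H.isAddable.isParent.le r hr htr
  subst this
  exact ⟨_, q, z', hq, fun h' => by simpa using comp_subset h', hwe, hz', hs''⟩

/-- Shrink `t` to a subtube without `a`, which reduces to the case `a ∉ t`. -/
theorem StepVia.exists_linked_of_mem (hG : G.Connected) (H : StepVia z h t s)
    (ha : G.IsCoTube h.tubing.tubes s a ta) (hat : a ∈ t) {w : V}
    (hw : w ∈ coreNodes h.tubing.tubes s) (hwt : w ∈ t) (hwa : w ≠ a) :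
    ∃ y, StepVia y h ta s ∧ Linked h z y := by
  obtain ⟨e, q, z', hq, hae, -, hz', hqz'⟩ := H.exists_subtube hG ha.mem hat hw hwt hwa
  obtain ⟨y, hy, hzy⟩ := hz'.exists_linked_of_notMem hG ha hae
  exact ⟨y, hy, (Linked.of_ge hq.le H.lt).trans ((Linked.of_le hqz'.le hz'.lt).trans hzy)⟩

/-- Every facet at `s` is linked to a facet with tube `ta`. -/
theorem StepVia.exists_linked (hG : G.Connected) (H : StepVia z h t s)
    (hU : 3 ≤ (coreNodes h.tubing.tubes s).card) (ha : G.IsCoTube h.tubing.tubes s a ta)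
    (hb : G.IsCoTube h.tubing.tubes s b tb) (hab : a ≠ b) :
    ∃ y, StepVia y h ta s ∧ Linked h z y := by
  by_cases hat : a ∈ t
  · by_cases hw : ∃ w ∈ coreNodes h.tubing.tubes s, w ∈ t ∧ w ≠ a
    · obtain ⟨w, hw, hwt, hwa⟩ := hw
      exact H.exists_linked_of_mem hG ha hat hw hwt hwa
    -- If `a` is the only core node in `t`, the detour goes through `tb`. It contains `a` and, as
    -- there are at least three core nodes, also a third one.
    · push Not at hw
      have hbt : b ∉ t := fun hbt => hab (hw b hb.mem hbt).symm
      obtain ⟨y, hy, hzy⟩ := H.exists_linked_of_notMem hG hb hbt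
      obtain ⟨w, hw, hwab⟩ := Finset.exists_mem_notMem_of_card_lt_card
        (s := {a, b}) (t := coreNodes h.tubing.tubes s) (lt_of_le_of_lt Finset.card_le_two (by omega))
      simp only [Finset.mem_insert, Finset.mem_singleton, not_or] at hwab
      obtain ⟨y', hy', hyy'⟩ := hy.exists_linked_of_mem hG ha (hb.mem_of_ne ha.mem hab) hw
        (hb.mem_of_ne hw hwab.2) hwab.1
      exact ⟨y', hy', hzy.trans hyy'⟩
  · exact H.exists_linked_of_notMem hG ha hat

theorem _root_.Multiset.exists_coe_append_cons_eq {M : Multiset C} {j : C} (hj : j ∈ M) {p : ℕ}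
    (hp : p < M.card) : ∃ m₁ m₂ : List C, ((m₁ ++ j :: m₂ : List C) : Multiset C) = M ∧
      m₁.length = p := by
  obtain ⟨M', rfl⟩ := Multiset.exists_cons_of_mem hj
  obtain ⟨l, rfl⟩ := Quot.exists_rep M'
  change p < ((l : Multiset C).card + 1 : ℕ) at hp
  rw [Multiset.coe_card] at hp
  refine ⟨l.take p, l.drop p, ?_, ?_⟩
  · change _ = ((j :: l : List C) : Multiset C)
    rw [Multiset.coe_eq_coe]
    refine List.perm_middle.trans ?_
    rw [List.take_append_drop]
  · rw [List.length_take]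
    omega

/-- If `v` separates the core nodes `a` and `b`, then a facet with tube `ta` is linked to one with
tube `tb` whose color is any other prescribed inner color. -/
theorem StepVia.exists_linked_color (hG : G.Connected) (H : StepVia y h ta s)
    (ha : G.IsCoTube h.tubing.tubes s a ta) (hb : G.IsCoTube h.tubing.tubes s b tb)
    (hv : v ∈ coreNodes h.tubing.tubes s) (hav : a ≠ v) (hbv : b ≠ v)
    (hsep : ¬ G.ReachIn (s \ {v}) a b)
    (hk : G.relConn (coreNodes h.tubing.tubes s ∩ ta) ta ≤ 1)
    {j : C} (hj : j ∈ (y.blocks ta).inner) :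
    ∃ y', StepVia y' h tb s ∧ Linked h y y' ∧ (y'.blocks tb).color = some j := by
  have hs := H.isAddable.isParent.mem
  have hhT := h.tubing.isTubing
  have hbR : b ∈ s \ {v} := by simp [hbv, coreNodes_subset hb.mem]
  have haR : a ∈ s \ {v} := by simp [hav, coreNodes_subset ha.mem]
  set A := G.comp (s \ {v}) a with hA
  set B := G.comp (s \ {v}) b with hB
  have haB : a ∉ B := fun h' => hsep (mem_comp.1 h').2.symm
  have hbB : b ∈ B := self_mem_comp hbR
  have haA : a ∈ A := self_mem_comp haR
  have hvB : v ∉ B := fun h' => by simpa using comp_subset h'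
  have hvA : v ∉ A := fun h' => by simpa using comp_subset h'
  have hAB : A ≠ B := fun h' => haB (h' ▸ haA)
  have hBadd : G.IsAddable h.tubing.tubes B s := isAddable_comp_sdiff hhT hs hv hb.mem hbv
  have hAadd : G.IsAddable h.tubing.tubes A s := isAddable_comp_sdiff hhT hs hv ha.mem hav
  have hvta : v ∈ ta := ha.mem_of_ne hv hav.symm
  have hvtb : v ∈ tb := hb.mem_of_ne hv hbv.symm
  have hBta : B ⊂ ta := by
    refine ⟨ha.subset_of_isConn hBadd.isConn (fun u hu => ?_) hb.mem hbB, fun h' => hvB (h' hvta)⟩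
    rw [Finset.mem_sdiff, Finset.mem_singleton]
    exact ⟨hBadd.isParent.ssubset.1 hu, by rintro rfl; exact haB hu⟩
  -- the two partial tubings in which one tube will be exchanged
  obtain ⟨hT₁, hA₁, hta₁, hcA₁, hcta₁⟩ := ha.addComps_erase hhT hs hv hav rfl
  obtain ⟨hT₂, hB₂, htb₂, hcB₂, hctb₂⟩ := hb.addComps_erase hhT hs hv hbv rfl
  have hBmem : B ∈ G.addComps h.tubing.tubes s v := mem_addComps.2 (Or.inr ⟨b, hb.mem, hbv, rfl⟩)
  have hAmem : A ∈ G.addComps h.tubing.tubes s v := mem_addComps.2 (Or.inr ⟨a, ha.mem, hav, rfl⟩)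
  -- add the tube `B` with color `j`
  have hBy : G.IsAddable y.tubing.tubes B ta := by
    rw [H.tubes_eq]
    refine ⟨?_, ?_, Finset.mem_insert_of_mem (Finset.mem_insert_self _ _), hBta, ?_⟩
    · refine hta₁.isTubing.mono (Finset.insert_subset ?_ (Finset.insert_subset_insert _ hT₁))
      exact Finset.mem_insert_of_mem (Finset.mem_erase.2 ⟨hAB.symm, hBmem⟩)
    · rw [Finset.mem_insert, not_or]
      exact ⟨hBta.ne, hBadd.notMem⟩
    · intro r hr hBr
      rw [Finset.insert_comm, Finset.mem_insert] at hr
      rcases hr with rfl | hr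
      · exact subset_rfl
      · exact H.isAddable.isParent.ssubset.1.trans (hBadd.isParent.le r hr hBr)
  obtain ⟨q₀, hq₀, hq₀B⟩ : ∃ q₀, StepVia q₀ y B ta ∧ (q₀.blocks B).color = some j := by
    have hcore : coreNodes y.tubing.tubes ta = coreNodes h.tubing.tubes s ∩ ta := by
      rw [H.tubes_eq, H.isAddable.isParent.coreNodes_self H.isAddable.isTubing H.isAddable.notMem]
    have f := H.fitsCore_self
    have hin := f.card_inner
    have e1 := (hBy.sdiff_nonempty hG).card_pos
    have e2 := (hBy.inter_nonempty hG).card_pos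
    have e3 := Finset.card_sdiff_add_card_inter (coreNodes y.tubing.tubes ta) B
    rw [← hcore] at hin hk
    -- The color of `B` is the first entry of the second segment. The ordered part of `ta` is only
    -- its color, so `j` must follow as many inner colors as `ta` keeps.
    obtain ⟨m₁, m₂, hm, hm₁⟩ := Multiset.exists_coe_append_cons_eq hj
      (p := (coreNodes y.tubing.tubes ta \ B).card - 1) (by omega)
    obtain ⟨q₀, hq₀, -, hq₀ℓ⟩ := exists_stepVia_of_isAddable hG y hBy
      (ℓ₁ := (y.blocks ta).pre ++ m₁) (ℓ₂ := j :: m₂)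
      (ColorBlocks.isListing_iff.2 ⟨_, hm, by rw [List.append_assoc]⟩) (by
        rw [List.length_append, hm₁, f.length_pre, ← hcore]
        omega)
    exact ⟨q₀, hq₀, hq₀ℓ.color_eq (q₀.color_tube B hq₀.mem)⟩
  have hyh := H.lt
  have hq₀h : q₀ < h := hq₀.lt.trans hyh
  -- add the other components
  obtain ⟨q₁, hq₁, hq₁T⟩ := exists_le_of_subset hG q₀ hta₁.isTubing (by
    rw [hq₀.tubes_eq, H.tubes_eq]
    exact Finset.insert_subset (Finset.mem_insert_of_mem (Finset.mem_erase.2 ⟨hAB.symm, hBmem⟩))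
      (Finset.insert_subset_insert _ hT₁))
  have hq₁h : q₁ < h := hq₁.trans_lt hq₀h
  -- exchange `ta` for `A`
  obtain ⟨z₁, hqz₁, hz₁T⟩ := exists_ge_of_subset hG q₁
    (S := (G.addComps h.tubing.tubes s v).erase A) (by rw [hq₁T]; exact Finset.subset_insert _ _)
  obtain ⟨s₁, hs₁⟩ := exists_stepVia_of_le hG hqz₁ (t := ta) (by rw [hz₁T]; exact hta₁.notMem)
    (by rw [hq₁T, hz₁T])
  obtain rfl : s₁ = s := hs₁.isAddable.isParent.eq (by rw [hz₁T]; exact hta₁.isParent)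
  have hBz₁ : B ∈ z₁.tubing.tubes := by
    rw [hz₁T]
    exact Finset.mem_erase.2 ⟨hAB.symm, hBmem⟩
  have hz₁h : z₁ < h := lt_of_le_of_mem hG hq₁h.le hqz₁ (by rw [hz₁T]; exact hT₁) hBz₁ hBadd.notMem
  obtain ⟨q₂, hq₂, -⟩ := hs₁.exists_flip hG (t' := A) (by rw [hz₁T]; exact hA₁)
    (by rw [hz₁T, hcta₁, Finset.card_singleton]) (by rw [hz₁T, hcA₁, Finset.card_singleton])
  have hq₂h : q₂ < h := hq₂.lt.trans hz₁h
  have hq₂T : q₂.tubing.tubes = G.addComps h.tubing.tubes s₁ v := by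
    rw [hq₂.tubes_eq, hz₁T, Finset.insert_erase hAmem]
  have hq₂B : (q₂.blocks B).color = some j := by
    have hBq₀ : B ∈ q₀.tubing.tubes := hq₀.mem
    rw [hq₂.color_eq hBz₁, ← color_eq_of_le hqz₁ hBz₁, color_eq_of_le hq₁ hBq₀, hq₀B]
  -- exchange `B` for `tb`
  obtain ⟨z₂, hqz₂, hz₂T⟩ := exists_ge_of_subset hG q₂
    (S := (G.addComps h.tubing.tubes s₁ v).erase B) (by rw [hq₂T]; exact Finset.erase_subset _ _)
  obtain ⟨s₂, hs₂⟩ := exists_stepVia_of_le hG hqz₂ (t := B) (by rw [hz₂T]; exact hB₂.notMem)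
    (by rw [hq₂T, hz₂T, Finset.insert_erase hBmem])
  obtain rfl : s₂ = s₁ := hs₂.isAddable.isParent.eq (by rw [hz₂T]; exact hB₂.isParent)
  have hAz₂ : A ∈ z₂.tubing.tubes := by
    rw [hz₂T]
    exact Finset.mem_erase.2 ⟨hAB, hAmem⟩
  have hz₂h : z₂ < h := lt_of_le_of_mem hG hq₂h.le hqz₂ (by rw [hz₂T]; exact hT₂) hAz₂ hAadd.notMem
  obtain ⟨q₃, hq₃, hq₃c⟩ := hs₂.exists_flip hG (t' := tb) (by rw [hz₂T]; exact htb₂)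
    (by rw [hz₂T, hcB₂, Finset.card_singleton]) (by rw [hz₂T, hctb₂, Finset.card_singleton])
  obtain ⟨y', s', hqy', hy'⟩ := exists_facet_of_mem hG (hq₃.le.trans hz₂h.le) hq₃.mem
    (hb.isAddable hhT hs).notMem
  obtain rfl := hy'.isAddable.isParent.eq (hb.isAddable hhT hs).isParent
  refine ⟨y', hy', ?_, ?_⟩
  · exact (Linked.of_ge hq₀.le hyh).trans <| (Linked.of_ge hq₁ hq₀h).trans <|
      (Linked.of_le hqz₁ hz₁h).trans <| (Linked.of_ge hq₂.le hz₁h).trans <|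
      (Linked.of_le hqz₂ hz₂h).trans <| (Linked.of_ge hq₃.le hz₂h).trans <|
      Linked.of_le hqy' hy'.lt
  · rw [← color_eq_of_le hqy' hy'.mem, hq₃c, hq₂B]

/-- A facet with tube `tb` is linked to one with tube `ta` of the same color. -/
theorem StepVia.exists_linked_same_color (hG : G.Connected) (H : StepVia y h tb s)
    (ha : G.IsCoTube h.tubing.tubes s a ta) (hb : G.IsCoTube h.tubing.tubes s b tb)
    (hv : v ∈ coreNodes h.tubing.tubes s) (hav : a ≠ v) (hbv : b ≠ v) (hab : a ≠ b) :
    ∃ y', StepVia y' h ta s ∧ Linked h y y' ∧ (y'.blocks ta).color = (y.blocks tb).color := by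
  have hs := H.isAddable.isParent.mem
  -- The auxiliary tube `e` contains `v` but neither `a` nor `b`. Beside it, both `tb` and `ta`
  -- leave a single core node in `s`, so they can be exchanged without change of color.
  obtain ⟨e, q, z, hq, hae, hve, hz, hqz⟩ := H.exists_subtube hG ha.mem (hb.mem_of_ne ha.mem hab)
    hv (hb.mem_of_ne hv hbv.symm) hav.symm
  have hbe : b ∉ e := fun h' => hb.notMem (hq.isAddable.isParent.ssubset.1 h')
  have hsub : h.tubing.tubes ⊆ z.tubing.tubes := tubes_subset_of_le hz.le
  have hcore : ∀ c ∈ coreNodes h.tubing.tubes s, c ∉ e → c ∈ coreNodes z.tubing.tubes s := by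
    intro c hc hce
    rw [hz.tubes_eq, hz.isAddable.isParent.coreNodes_parent]
    exact Finset.mem_sdiff.2 ⟨hc, hce⟩
  have hadd : G.IsAddable z.tubing.tubes ta s := by
    refine ha.isAddable_of_subset z.tubing.isTubing hsub hs fun r hr hrh => ?_
    rw [hz.tubes_eq] at hr
    obtain rfl := (Finset.mem_insert.1 hr).resolve_right hrh
    refine ⟨⟨ha.subset_of_isConn hz.isAddable.isConn (fun u hu => ?_) hv hve,
      fun h' => hbe (h' (ha.mem_of_ne hb.mem hab.symm))⟩, v, hv, hve⟩
    rw [Finset.mem_sdiff, Finset.mem_singleton]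
    exact ⟨hz.isAddable.isParent.ssubset.1 hu, by rintro rfl; exact hae hu⟩
  obtain ⟨q', hq', hq'c⟩ := hqz.exists_flip hG hadd
    (by rw [hb.core_sdiff hsub (hcore b hb.mem hbe), Finset.card_singleton])
    (by rw [ha.core_sdiff hsub (hcore a ha.mem hae), Finset.card_singleton])
  have hadd' := ha.isAddable h.tubing.isTubing hs
  obtain ⟨y', s', hqy', hy'⟩ := exists_facet_of_mem hG (hq'.le.trans hz.le) hq'.mem hadd'.notMem
  obtain rfl := hy'.isAddable.isParent.eq hadd'.isParent
  refine ⟨y', hy', ?_, ?_⟩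
  · exact (Linked.of_ge hq.le H.lt).trans <| (Linked.of_le hqz.le hz.lt).trans <|
      (Linked.of_ge hq'.le hz.lt).trans <| Linked.of_le hqy' hy'.lt
  · rw [← color_eq_of_le hqy' hy'.mem, hq'c, hq.color_eq H.mem]

theorem card_sdiff_of_isCoTube (ha : G.IsCoTube h.tubing.tubes s a ta) :
    (coreNodes h.tubing.tubes s \ ta).card = 1 := by
  rw [ha.core_sdiff subset_rfl ha.mem, Finset.card_singleton]

/-- Facets with the same tube `ta` are linked if `v` separates the core. -/
theorem StepVia.linked_of_separated (hG : G.Connected) (H : StepVia y h ta s)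
    (H' : StepVia y' h ta s) (ha : G.IsCoTube h.tubing.tubes s a ta)
    (hb : G.IsCoTube h.tubing.tubes s b tb)
    (hv : v ∈ coreNodes h.tubing.tubes s) (hav : a ≠ v) (hbv : b ≠ v)
    (hsep : ¬ G.ReachIn (s \ {v}) a b)
    (hk : G.relConn (coreNodes h.tubing.tubes s ∩ ta) ta ≤ 1) : Linked h y y' := by
  have hc := card_sdiff_of_isCoTube ha
  by_cases hcol : (y.blocks ta).color = (y'.blocks ta).color
  · rw [H.eq_of_color_eq H' hc hk hcol]
    exact Relation.ReflTransGen.refl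
  obtain ⟨i, hi⟩ := Option.isSome_iff_exists.1 (y.color_tube ta H.mem)
  obtain ⟨j, hj⟩ := Option.isSome_iff_exists.1 (y'.color_tube ta H'.mem)
  -- Both facets give `ta` the same multiset of colors. Without outer blocks, a color other than
  -- that of `ta` is inner.
  have hjy : j ∈ (y.blocks ta).inner := by
    have hsum : ∀ {w : G.ColorTemplate P}, StepVia w h ta s →
        (h.blocks s).colors = (w.blocks s).colors + (w.blocks ta).colors := by
      intro w hw
      obtain ⟨ℓ₁, ℓ₂, h1, h2, h3⟩ := hw.exists_isListing
      rw [← h1.coe_eq, ← h2.coe_eq, ← h3.coe_eq, Multiset.coe_add]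
    have e := (hsum H).symm.trans (hsum H')
    rw [H.blocks_parent_eq H' hc] at e
    have e' := add_left_cancel e
    have hjc : j ∈ (y.blocks ta).colors := by
      rw [e']
      simp [ColorBlocks.colors, hj]
    have hout : (y.blocks ta).outer = [] := List.eq_nil_of_length_eq_zero (by
      have := H.fitsCore_self.length_outer
      omega)
    rw [ColorBlocks.colors, hi, hout] at hjc
    simp only [Option.toList_some, Multiset.coe_singleton, Multiset.coe_nil, add_zero,
      Multiset.mem_add, Multiset.mem_singleton] at hjc
    rcases hjc with rfl | hjc
    · exact absurd (hi.trans hj.symm) hcol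
    · exact hjc
  have hab : a ≠ b := by
    rintro rfl
    exact hsep (ReachIn.refl _)
  -- The color changes to `j` on the way to `tb` and is kept on the way back.
  obtain ⟨w, hw, hyw, hwc⟩ := H.exists_linked_color hG ha hb hv hav hbv hsep hk hjy
  obtain ⟨w', hw', hww', hwc'⟩ := hw.exists_linked_same_color hG ha hb hv hav hbv hab
  have : w' = y' := hw'.eq_of_color_eq H' hc hk (by rw [hwc', hwc, hj])
  exact this ▸ hyw.trans hww'

/-- Any two facets at a core with at least three nodes are linked. -/
theorem StepVia.linked (hG : G.Connected) {t' : Finset V} (H : StepVia y h t s)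
    (H' : StepVia y' h t' s) (hU : 3 ≤ (coreNodes h.tubing.tubes s).card) : Linked h y y' := by
  have hs := H.isAddable.isParent.mem
  have hconn := h.tubing.isTubing.isConn hG hs
  -- All facets move to the tube `ta`; the node `b` serves only for detours. What is left is to link
  -- facets that share the tube `ta`.
  suffices ∃ a b ta tb, G.IsCoTube h.tubing.tubes s a ta ∧ G.IsCoTube h.tubing.tubes s b tb ∧
      a ≠ b ∧ ∀ y y' : G.ColorTemplate P, StepVia y h ta s → StepVia y' h ta s → Linked h y y' by
    obtain ⟨a, b, ta, tb, ha, hb, hab, hlink⟩ := this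
    obtain ⟨w, hw, hyw⟩ := H.exists_linked hG hU ha hb hab
    obtain ⟨w', hw', hyw'⟩ := H'.exists_linked hG hU ha hb hab
    exact hyw.trans ((hlink w w' hw hw').trans hyw'.symm)
  obtain ⟨S, hSU, hSk, hS⟩ := G.exists_relConn (coreNodes h.tubing.tubes s) s
  by_cases hk : 2 ≤ G.relConn (coreNodes h.tubing.tubes s) s
  · have hnc : ∀ a ∈ (coreNodes h.tubing.tubes s), ∃ ta, G.IsCoTube h.tubing.tubes s a ta := by
      intro a ha
      refine exists_isCoTube ha (by omega) fun u hu hua w hw hwa => ?_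
      by_contra hcon
      have := relConn_le (G := G) (s := s) (Finset.singleton_subset_iff.2 ha)
        (Or.inl ⟨u, by simp [hua, hu], w, by simp [hwa, hw], hcon⟩)
      rw [Finset.card_singleton] at this
      omega
    obtain ⟨a, haS⟩ := Finset.card_pos.1 (show 0 < S.card by omega)
    obtain ⟨b, hbU, hba⟩ := Finset.exists_mem_ne (show 1 < (coreNodes h.tubing.tubes s).card by omega) a
    obtain ⟨ta, ha⟩ := hnc a (hSU haS)
    obtain ⟨tb, hb⟩ := hnc b hbU
    refine ⟨a, b, ta, tb, ha, hb, hba.symm, fun y y' hy hy' => ?_⟩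
    -- No core node separates here. Since `a` belongs to a minimum cut `S`, the set `S.erase a`
    -- witnesses that the connectivity drops when `a` is removed.
    have hka : G.relConn ((coreNodes h.tubing.tubes s) ∩ ta) ta ≤ G.relConn (coreNodes h.tubing.tubes s) s - 1 := by
      rw [← hSk, ← Finset.card_erase_of_mem haS, ha.core_inter]
      refine relConn_le (Finset.erase_subset_erase a hSU) ?_
      rcases hS with ⟨u, hu, w, hw, hS⟩ | hS
      · left
        simp only [Finset.mem_sdiff] at hu hw
        refine ⟨u, ?_, w, ?_, fun hr => hS (hr.mono fun p hp => ?_)⟩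
        · simp only [Finset.mem_sdiff, Finset.mem_erase, not_and]
          exact ⟨⟨by rintro rfl; exact hu.2 haS, hu.1⟩, fun _ => hu.2⟩
        · simp only [Finset.mem_sdiff, Finset.mem_erase, not_and]
          exact ⟨⟨by rintro rfl; exact hw.2 haS, hw.1⟩, fun _ => hw.2⟩
        · rw [Finset.mem_sdiff, Finset.mem_erase, not_and] at hp
          have hpa := ha.subset hp.1
          rw [Finset.mem_sdiff, Finset.mem_singleton] at hpa
          exact Finset.mem_sdiff.2 ⟨hpa.1, hp.2 hpa.2⟩
      · right
        rw [Finset.card_erase_of_mem haS, Finset.card_erase_of_mem (hSU haS)]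
        omega
    rw [hy.eq_of_relConn_lt hy' (card_sdiff_of_isCoTube ha) (by omega)]
    exact Relation.ReflTransGen.refl
  -- Connectivity zero is impossible because `s` is connected, so a minimum cut is a single node
  -- `v`. Nonseparating nodes `a` and `b` are taken on different sides of it.
  · rcases hS with ⟨u, hu, w, hw, hS⟩ | hS
    · rw [Finset.mem_sdiff] at hu hw
      have hS1 : S.card = 1 := by
        have h0 : S.card ≠ 0 := by
          intro h0
          rw [Finset.card_eq_zero] at h0
          subst h0
          exact hS (by simpa using hconn.2 u (coreNodes_subset hu.1) w (coreNodes_subset hw.1))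
        omega
      obtain ⟨v, rfl⟩ := Finset.card_eq_one.1 hS1
      rw [Finset.singleton_subset_iff] at hSU
      rw [Finset.mem_singleton] at hu hw
      obtain ⟨a, haU, hav, hua, ta, ha⟩ := exists_isCoTube_of_reachIn hconn hSU hu.1 hu.2
      obtain ⟨b, hbU, hbv, hwb, tb, hb⟩ := exists_isCoTube_of_reachIn hconn hSU hw.1 hw.2
      have hsep : ¬ G.ReachIn (s \ {v}) a b := fun h' => hS (hua.trans (h'.trans hwb.symm))
      have hab : a ≠ b := by
        rintro rfl
        exact hsep (ReachIn.refl _)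
      -- The node `v` still separates the core inside `ta` if core nodes other than `a` remain on
      -- two sides of `v`.
      have key : ∀ {a ta c}, G.IsCoTube h.tubing.tubes s a ta → a ≠ v → c ∈ (coreNodes h.tubing.tubes s) → c ≠ a → c ≠ v →
          (∃ d ∈ (coreNodes h.tubing.tubes s), d ≠ a ∧ d ≠ v ∧ ¬ G.ReachIn (s \ {v}) c d) →
          G.relConn ((coreNodes h.tubing.tubes s) ∩ ta) ta ≤ 1 := by
        rintro a ta c ha hav hc hca hcv ⟨d, hd, hda, hdv, hcd⟩
        rw [← Finset.card_singleton v]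
        refine relConn_le (Finset.singleton_subset_iff.2
          (Finset.mem_inter.2 ⟨hSU, ha.mem_of_ne hSU hav.symm⟩))
          (Or.inl ⟨c, ?_, d, ?_, fun hr => hcd (hr.mono ?_)⟩)
        · simp [hc, hcv, ha.mem_of_ne hc hca]
        · simp [hd, hdv, ha.mem_of_ne hd hda]
        · exact Finset.sdiff_subset_sdiff (ha.subset.trans Finset.sdiff_subset) subset_rfl
      -- With three core nodes, `ta` contains two of them and its connectivity is at most one.
      -- Otherwise there is a fourth node `c`. If it is on the side of `b`, it is separated from `a`
      -- inside `tb`; if not, it is separated from `b` inside `ta`.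
      have hgood : G.relConn ((coreNodes h.tubing.tubes s) ∩ ta) ta ≤ 1 ∨ G.relConn ((coreNodes h.tubing.tubes s) ∩ tb) tb ≤ 1 := by
        by_cases hU3 : (coreNodes h.tubing.tubes s).card = 3
        · left
          have := G.relConn_le_card_sub_one ((coreNodes h.tubing.tubes s) ∩ ta) ta
          rw [ha.core_inter, Finset.card_erase_of_mem haU, hU3] at this
          rw [ha.core_inter]
          exact this
        · obtain ⟨c, hc, hcab⟩ := Finset.exists_mem_notMem_of_card_lt_card
            (s := {a, b, v}) (t := (coreNodes h.tubing.tubes s)) (lt_of_le_of_lt Finset.card_le_three (by omega))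
          simp only [Finset.mem_insert, Finset.mem_singleton, not_or] at hcab
          by_cases hac : G.ReachIn (s \ {v}) c b
          · exact Or.inr (key hb hbv hc hcab.2.1 hcab.2.2
              ⟨a, haU, hab, hav, fun h' => hsep (h'.symm.trans hac)⟩)
          · exact Or.inl (key ha hav hc hcab.1 hcab.2.2 ⟨b, hbU, hab.symm, hbv, hac⟩)
      rcases hgood with hgood | hgood
      · exact ⟨a, b, ta, tb, ha, hb, hab, fun y y' hy hy' =>
          hy.linked_of_separated hG hy' ha hb hSU hav hbv hsep hgood⟩
      · exact ⟨b, a, tb, ta, hb, ha, hab.symm, fun y y' hy hy' =>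
          hy.linked_of_separated hG hy' hb ha hSU hbv hav (fun h' => hsep h'.symm) hgood⟩
    · omega

end SingleCore

/-- The proper faces of a face of rank at least two are connected. -/
theorem linked_of_lt (hG : G.Connected) (hc : h.tubing.tubes.card + 2 ≤ P.card) (hx : x < h)
    (hy : y < h) : Linked h x y := by
  obtain ⟨z, t, s, hxz, hz⟩ := exists_facet hG hx
  obtain ⟨z', t', s', hyz', hz'⟩ := exists_facet hG hy
  refine (Linked.of_le hxz hz.lt).trans (Linked.trans ?_ (Linked.of_ge hyz' hz'.lt))
  have hne : ∀ {z z' : G.ColorTemplate P} {t t' s s' : Finset V}, StepVia z h t s →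
      StepVia z' h t' s' → s ≠ s' → Linked h z z' := by
    intro z z' t t' s s' hz hz' hss
    obtain ⟨q, hqz, hqz'⟩ := exists_common_le hG hz hz' hss
    exact (Linked.of_ge hqz hz.lt).trans (Linked.of_le hqz' hz'.lt)
  by_cases hss : s = s'
  · subst hss
    by_cases hU : 3 ≤ (coreNodes h.tubing.tubes s).card
    · exact hz.linked hG hz' hU
    -- A core with at most two nodes contributes at most one to the rank. So another core has two
    -- nodes, and a facet there has a common face with each of the given ones.
    · have hsum := h.card_tubes_add_sum
      rw [← Finset.add_sum_erase _ _ hz.isAddable.isParent.mem] at hsum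
      obtain ⟨s', hs', hs'c⟩ := Finset.exists_ne_zero_of_sum_ne_zero
        (show ∑ r ∈ (insert Finset.univ h.tubing.tubes).erase s,
          ((coreNodes h.tubing.tubes r).card - 1) ≠ 0 by omega)
      rw [Finset.mem_erase] at hs'
      obtain ⟨u, hu, w, hw, huw⟩ := Finset.one_lt_card.1
        (show 1 < (coreNodes h.tubing.tubes s').card by omega)
      obtain ⟨z'', hz''⟩ := exists_stepVia_of_isAddable' hG h
        (isAddable_comp_sdiff h.tubing.isTubing hs'.2 hu hw huw.symm)
      exact (hne hz hz'' hs'.1.symm).trans (hne hz'' hz' hs'.1)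
  · exact hne hz hz' hss

end ColorTemplate

end SimpleGraph

namespace SimpleGraph

variable {V : Type*} [Fintype V] [DecidableEq V] {G : SimpleGraph V} {C : Type*}

namespace ColorTemplate

variable {P : Multiset C} {x y y' z f h : G.ColorTemplate P} {r s t : Finset V}

/-! ### Intervals of templates -/

theorem card_lt_of_lt (hxy : x < y) : y.tubing.tubes.card < x.tubing.tubes.card :=
  (eq_or_card_lt hxy.le).resolve_left hxy.ne

theorem eq_of_le_of_card_eq (hxy : x ≤ y) (hc : x.tubing.tubes.card = y.tubing.tubes.card) :
    x = y :=
  (eq_or_card_lt hxy).resolve_right (by omega)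

theorem StepVia.card_eq (H : StepVia x y t s) :
    x.tubing.tubes.card = y.tubing.tubes.card + 1 := by
  rw [H.tubes_eq, Finset.card_insert_of_notMem H.isAddable.notMem]

theorem exists_lt (hG : G.Connected) (hc : y.tubing.tubes.card < P.card) : ∃ x, x < y := by
  have hsum := y.card_tubes_add_sum
  obtain ⟨s, hs, hsc⟩ := Finset.exists_ne_zero_of_sum_ne_zero
    (show ∑ r ∈ insert Finset.univ y.tubing.tubes,
      ((coreNodes y.tubing.tubes r).card - 1) ≠ 0 by omega)
  obtain ⟨u, hu, w, hw, huw⟩ := Finset.one_lt_card.1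
    (show 1 < (coreNodes y.tubing.tubes s).card by omega)
  obtain ⟨x, hx⟩ := exists_stepVia_of_isAddable' hG y
    (isAddable_comp_sdiff y.tubing.isTubing hs hu hw huw.symm)
  exact ⟨x, hx.lt⟩

theorem exists_between (hG : G.Connected) (hxy : x < y)
    (hc : y.tubing.tubes.card + 2 ≤ x.tubing.tubes.card) : ∃ z, x < z ∧ z < y := by
  obtain ⟨z, t, s, hxz, hz⟩ := exists_facet hG hxy
  refine ⟨z, hxz.lt_of_ne ?_, hz.lt⟩
  rintro rfl
  have := hz.card_eq
  omega

/-- Above a template, two faces below `h` are joined by a path of faces below `h`. -/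
theorem exists_zigzag (hG : G.Connected) (hfx : f < x) (hxh : x < h) (hfy : f < y) (hyh : y < h)
    (hc : h.tubing.tubes.card + 3 ≤ f.tubing.tubes.card) :
    ∃ u v w, x ≤ u ∧ v ≤ u ∧ v ≤ w ∧ y ≤ w ∧ f < v ∧ u < h ∧ w < h := by
  obtain ⟨u, t, s, hxu, hu⟩ := exists_facet hG hxh
  obtain ⟨w, t', s', hyw, hw⟩ := exists_facet hG hyh
  have ht : t ∈ f.tubing.tubes := tubes_subset_of_le (hfx.le.trans hxu) hu.mem
  have ht' : t' ∈ f.tubing.tubes := tubes_subset_of_le (hfy.le.trans hyw) hw.mem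
  have hfh := tubes_subset_of_le (hfx.trans hxh).le
  -- This face has at most two tubes more than `h`, so a difference of three keeps it strictly above
  -- `f`.
  obtain ⟨v, hfv, hv⟩ := exists_ge_of_subset hG f
    (S := insert t (insert t' h.tubing.tubes))
    (Finset.insert_subset ht (Finset.insert_subset ht' hfh))
  refine ⟨u, v, w, hxu, le_of_tubes_subset hG hfv (hfx.le.trans hxu) ?_,
    le_of_tubes_subset hG hfv (hfy.le.trans hyw) ?_, hyw, hfv.lt_of_ne ?_, hu.lt, hw.lt⟩
  · rw [hu.tubes_eq, hv]
    exact Finset.insert_subset_insert _ (Finset.subset_insert _ _)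
  · rw [hw.tubes_eq, hv]
    exact Finset.subset_insert _ _
  · rintro rfl
    have h1 := Finset.card_insert_le t (insert t' h.tubing.tubes)
    have h2 := Finset.card_insert_le t' h.tubing.tubes
    rw [hv] at hc
    omega

/-- There are exactly two faces between faces whose numbers of tubes differ by two. -/
theorem exists_two_between (hG : G.Connected) (hfh : f < h)
    (hc : f.tubing.tubes.card = h.tubing.tubes.card + 2) :
    ∃ z₁ z₂, z₁ ≠ z₂ ∧ ∀ z, f < z ∧ z < h ↔ z = z₁ ∨ z = z₂ := by
  have hsub := tubes_subset_of_le hfh.le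
  obtain ⟨t₁, t₂, hne, ht⟩ := Finset.card_eq_two.1
    (show (f.tubing.tubes \ h.tubing.tubes).card = 2 by
      rw [Finset.card_sdiff_of_subset hsub]
      omega)
  have hmem : ∀ t, t ∈ f.tubing.tubes ∧ t ∉ h.tubing.tubes ↔ t = t₁ ∨ t = t₂ := fun t => by
    rw [← Finset.mem_sdiff, ht, Finset.mem_insert, Finset.mem_singleton]
  have key : ∀ t, t ∈ f.tubing.tubes ∧ t ∉ h.tubing.tubes → ∃ z s, f < z ∧ StepVia z h t s := by
    intro t ht
    obtain ⟨z, s, hfz, hz⟩ := exists_facet_of_mem hG hfh.le ht.1 ht.2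
    refine ⟨z, s, hfz.lt_of_ne ?_, hz⟩
    rintro rfl
    have := hz.card_eq
    omega
  obtain ⟨z₁, s₁, hfz₁, hz₁⟩ := key t₁ ((hmem t₁).2 (Or.inl rfl))
  obtain ⟨z₂, s₂, hfz₂, hz₂⟩ := key t₂ ((hmem t₂).2 (Or.inr rfl))
  refine ⟨z₁, z₂, ?_, fun z => ⟨fun hz => ?_, ?_⟩⟩
  · rintro rfl
    have := hz₁.mem
    rw [hz₂.tubes_eq, Finset.mem_insert] at this
    exact this.elim hne hz₁.isAddable.notMem
  · obtain ⟨z', t, s, hzz', hz'⟩ := exists_facet hG hz.2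
    have e : z = z' := eq_of_le_of_card_eq hzz' (by
      have h1 := card_lt_of_lt hz.1
      have h2 := card_lt_of_lt hz.2
      have h3 := hz'.card_eq
      omega)
    subst e
    have h1 := (hmem t).1 ⟨tubes_subset_of_le hz.1.le hz'.mem, hz'.isAddable.notMem⟩
    rcases h1 with rfl | rfl
    · exact Or.inl (eq_of_tubes_eq hG hz.1.le hfz₁.le (by rw [hz'.tubes_eq, hz₁.tubes_eq]))
    · exact Or.inr (eq_of_tubes_eq hG hz.1.le hfz₂.le (by rw [hz'.tubes_eq, hz₂.tubes_eq]))
  · rintro (rfl | rfl)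
    · exact ⟨hfz₁, hz₁.lt⟩
    · exact ⟨hfz₂, hz₂.lt⟩

/-- The parent has only one listing in `h`, and the lengths of the two segments are prescribed. -/
theorem StepVia.eq_of_card_inner_le_one {s' : Finset V} (H : StepVia y h t s)
    (H' : StepVia y' h t s') (hc : (h.blocks s).inner.card ≤ 1) : y = y' := by
  obtain rfl := H.isAddable.isParent.eq H'.isAddable.isParent
  obtain ⟨ℓ₁, ℓ₂, h1, h2, h3⟩ := H.exists_isListing
  obtain ⟨m₁, m₂, h1', h2', h3'⟩ := H'.exists_isListing
  obtain ⟨rfl, rfl⟩ := List.append_inj (h1.eq_of_card_inner_le_one h1' hc)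
    ((H.fitsCore_parent.length_listing h2).trans (H'.fitsCore_parent.length_listing h2').symm)
  have hT : y.tubing.tubes = y'.tubing.tubes := by rw [H.tubes_eq, H'.tubes_eq]
  refine eq_of_blocks hT fun r hr => ?_
  by_cases hrs : r = s
  · subst hrs
    exact blocks_eq_of_isListing hT hr h2 h2'
  by_cases hrt : r = t
  · subst hrt
    exact blocks_eq_of_isListing hT hr h3 h3'
  · rw [H.blocks_eq r hrt hrs, H'.blocks_eq r hrt hrs]

/-- A face of rank one has exactly two proper faces. -/
theorem exists_two_lt (hG : G.Connected) (hc : h.tubing.tubes.card + 1 = P.card) :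
    ∃ z₁ z₂, z₁ ≠ z₂ ∧ ∀ z, z < h ↔ z = z₁ ∨ z = z₂ := by
  have hsum := h.card_tubes_add_sum
  obtain ⟨s, hs, hsc⟩ := Finset.exists_ne_zero_of_sum_ne_zero
    (show ∑ r ∈ insert Finset.univ h.tubing.tubes,
      ((coreNodes h.tubing.tubes r).card - 1) ≠ 0 by omega)
  have hsum' := hsum
  rw [← Finset.add_sum_erase _ _ hs] at hsum'
  -- In rank one the numbers of core nodes minus one add up to one. So one core has two nodes and
  -- all others have a single node.
  have hU : (coreNodes h.tubing.tubes s).card = 2 := by omega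
  have hother : ∀ s' ∈ insert Finset.univ h.tubing.tubes,
      1 < (coreNodes h.tubing.tubes s').card → s' = s := by
    intro s' hs' hc'
    by_contra hne
    have := Finset.single_le_sum (f := fun r => (coreNodes h.tubing.tubes r).card - 1)
      (fun _ _ => Nat.zero_le _) (Finset.mem_erase.2 ⟨hne, hs'⟩)
    omega
  obtain ⟨u, w, huw, hUe⟩ := Finset.card_eq_two.1 hU
  have hu : u ∈ coreNodes h.tubing.tubes s := by simp [hUe]
  have hw : w ∈ coreNodes h.tubing.tubes s := by simp [hUe]
  have hau := isAddable_comp_sdiff h.tubing.isTubing hs hw hu huw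
  have haw := isAddable_comp_sdiff h.tubing.isTubing hs hu hw huw.symm
  obtain ⟨z₁, hz₁⟩ := exists_stepVia_of_isAddable' hG h hau
  obtain ⟨z₂, hz₂⟩ := exists_stepVia_of_isAddable' hG h haw
  have hin : (h.blocks s).inner.card ≤ 1 := by
    rw [(h.fitsCore hs).card_inner]
    omega
  have key : ∀ {u w t z}, coreNodes h.tubing.tubes s = {u, w} → StepVia z h t s → u ∈ t → w ∉ t →
      t = G.comp (s \ {w}) u := by
    intro u w t z hUe hz hut hwt
    have e : coreNodes h.tubing.tubes s \ t = {w} := by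
      rw [hUe]
      ext v
      simp only [Finset.mem_sdiff, Finset.mem_insert, Finset.mem_singleton]
      constructor
      · rintro ⟨rfl | rfl, hv⟩
        · exact absurd hut hv
        · rfl
      · rintro rfl
        exact ⟨Or.inr rfl, hwt⟩
    rw [← e]
    exact hz.isAddable.eq_comp hut
  have huR : u ∈ s \ {w} := by simp [huw, coreNodes_subset hu]
  refine ⟨z₁, z₂, ?_, fun z => ⟨fun hz => ?_, ?_⟩⟩
  · rintro rfl
    have := hz₁.mem
    rw [hz₂.tubes_eq, Finset.mem_insert] at this
    refine this.elim (fun he => ?_) hau.notMem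
    have hu' : u ∈ G.comp (s \ {w}) u := self_mem_comp huR
    rw [he] at hu'
    simpa using comp_subset hu'
  · obtain ⟨z', t, s', hzz', hz'⟩ := exists_facet hG hz
    have e : z = z' := eq_of_le_of_card_eq hzz' (by
      have h1 := card_lt_of_lt hz
      have h2 := hz'.card_eq
      have h3 := z.card_tubes_le
      omega)
    subst e
    have e1 := (hz'.isAddable.sdiff_nonempty hG).card_pos
    have e2 := (hz'.isAddable.inter_nonempty hG).card_pos
    have e3 := Finset.card_sdiff_add_card_inter (coreNodes h.tubing.tubes s') t
    obtain rfl := hother s' hz'.isAddable.isParent.mem (by omega)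
    by_cases hut : u ∈ t
    · have hwt : w ∉ t := by
        intro hwt
        obtain ⟨v, hv⟩ := Finset.card_pos.1 e1
        rw [Finset.mem_sdiff, hUe, Finset.mem_insert, Finset.mem_singleton] at hv
        rcases hv with ⟨rfl | rfl, hv⟩
        · exact hv hut
        · exact hv hwt
      obtain rfl := key hUe hz' hut hwt
      exact Or.inl (hz'.eq_of_card_inner_le_one hz₁ hin)
    · have hwt : w ∈ t := by
        obtain ⟨v, hv⟩ := Finset.card_pos.1 e2
        rw [Finset.mem_inter, hUe, Finset.mem_insert, Finset.mem_singleton] at hv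
        rcases hv with ⟨rfl | rfl, hv⟩
        · exact absurd hv hut
        · exact hv
      obtain rfl := key (by rw [hUe, Finset.pair_comm]) hz' hwt hut
      exact Or.inr (hz'.eq_of_card_inner_le_one hz₂ hin)
  · rintro (rfl | rfl)
    · exact hz₁.lt
    · exact hz₂.lt

/-! ### Greatest faces -/

theorem exists_ge_empty (hG : G.Connected) (x : G.ColorTemplate P) :
    ∃ y, x ≤ y ∧ y.tubing.tubes = ∅ := exists_ge_of_subset hG x (Finset.empty_subset _)

/-- The greatest face above `x`. -/
noncomputable def greatest (hG : G.Connected) (x : G.ColorTemplate P) : G.ColorTemplate P :=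
  (x.exists_ge_empty hG).choose

theorem le_greatest (hG : G.Connected) (x : G.ColorTemplate P) : x ≤ x.greatest hG :=
  (x.exists_ge_empty hG).choose_spec.1

theorem tubes_greatest (hG : G.Connected) (x : G.ColorTemplate P) :
    (x.greatest hG).tubing.tubes = ∅ := (x.exists_ge_empty hG).choose_spec.2

theorem greatest_eq_of_le (hG : G.Connected) (hxy : x ≤ y) : x.greatest hG = y.greatest hG :=
  eq_of_tubes_eq hG (x.le_greatest hG) (hxy.trans (y.le_greatest hG))
    (by rw [tubes_greatest, tubes_greatest])

theorem greatest_eq_self (hG : G.Connected) (hx : x.tubing.tubes = ∅) : x.greatest hG = x :=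
  (eq_of_le_of_tubes_eq (x.le_greatest hG) (by rw [tubes_greatest, hx])).symm

theorem mk_eq_mk_of_le (hxy : x ≤ y) :
    (Quot.mk _ x : G.ColorfulComponent P) = Quot.mk _ y := Quot.sound hxy

/-- The greatest face is constant along the order, hence an invariant of the component, and it lies
in the component. So components correspond to templates without tubes. -/
theorem mk_eq_mk_iff (hG : G.Connected) :
    (Quot.mk _ x : G.ColorfulComponent P) = Quot.mk _ y ↔ x.greatest hG = y.greatest hG := by
  constructor
  · intro he
    exact congrArg (Quot.lift (fun x : G.ColorTemplate P => x.greatest hG)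
      fun _ _ hxy => greatest_eq_of_le hG hxy) he
  · intro he
    exact (mk_eq_mk_of_le (x.le_greatest hG)).trans
      (he ▸ (mk_eq_mk_of_le (y.le_greatest hG)).symm)

end ColorTemplate

/-! ### The components are abstract polytopes -/

namespace ColorfulComponent

open ColorTemplate

variable {P : Multiset C} {c : G.ColorfulComponent P}

/-- The number of faces in a maximal chain strictly below a face. -/
def grade (a : c.Faces) : ℕ :=
  WithBot.recBotCoe 0 (fun x => P.card + 1 - x.1.tubing.tubes.card) a

theorem grade_bot : grade (⊥ : c.Faces) = 0 := rfl

theorem grade_coe (x : {x : G.ColorTemplate P // (Quot.mk _ x : G.ColorfulComponent P) = c}) :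
    grade (x : c.Faces) = P.card + 1 - x.1.tubing.tubes.card := rfl

theorem coe_lt_coe {x y : {x : G.ColorTemplate P // (Quot.mk _ x : G.ColorfulComponent P) = c}} :
    (x : c.Faces) < y ↔ x.1 < y.1 := WithBot.coe_lt_coe

theorem coe_le_coe {x y : {x : G.ColorTemplate P // (Quot.mk _ x : G.ColorfulComponent P) = c}} :
    (x : c.Faces) ≤ y ↔ x.1 ≤ y.1 := WithBot.coe_le_coe

/-- Adding a tube lowers the grade by one. The adjoined least face shifts all grades, so a template
with the maximal number `P.card` of tubes has grade one. -/
theorem isBoundedGrading (hG : G.Connected) (c : G.ColorfulComponent P) :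
    IsBoundedGrading (grade (c := c)) (P.card + 1) := by
  constructor
  · intro a b hab
    induction b using WithBot.recBotCoe with
    | bot => exact absurd hab not_lt_bot
    | coe y =>
      have hy := y.1.card_tubes_le
      rw [grade_coe]
      induction a using WithBot.recBotCoe with
      | bot =>
        rw [grade_bot]
        omega
      | coe x =>
        have hx := x.1.card_tubes_le
        have := card_lt_of_lt (coe_lt_coe.1 hab)
        rw [grade_coe]
        omega
  · exact ⟨⊥, fun a => bot_le, rfl⟩
  · obtain ⟨x, hx⟩ : ∃ x, (Quot.mk _ x : G.ColorfulComponent P) = c := Quot.exists_rep c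
    refine ⟨((⟨x.greatest hG, (mk_eq_mk_of_le (x.le_greatest hG)).symm.trans hx⟩ :
      {y : G.ColorTemplate P // (Quot.mk _ y : G.ColorfulComponent P) = c}) : c.Faces),
      fun a => ?_, ?_⟩
    · induction a using WithBot.recBotCoe with
      | bot => exact bot_le
      | coe y =>
        rw [coe_le_coe]
        change y.1 ≤ x.greatest hG
        rw [← (mk_eq_mk_iff hG).1 (y.2.trans hx.symm)]
        exact y.1.le_greatest hG
    · rw [grade_coe, tubes_greatest]
      rfl
  · intro a b hab hgab
    induction b using WithBot.recBotCoe with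
    | bot => exact absurd hab not_lt_bot
    | coe y =>
      have hy := y.1.card_tubes_le
      rw [grade_coe] at hgab
      induction a using WithBot.recBotCoe with
      | bot =>
        rw [grade_bot] at hgab
        obtain ⟨x, hx⟩ := exists_lt hG (show y.1.tubing.tubes.card < P.card by omega)
        exact ⟨((⟨x, (mk_eq_mk_of_le hx.le).trans y.2⟩ :
          {y : G.ColorTemplate P // (Quot.mk _ y : G.ColorfulComponent P) = c}) : c.Faces),
          WithBot.bot_lt_coe _, coe_lt_coe.2 hx⟩
      | coe x =>
        rw [grade_coe] at hgab
        have hx := x.1.card_tubes_le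
        obtain ⟨z, hz⟩ := exists_between hG (coe_lt_coe.1 hab) (by omega)
        exact ⟨((⟨z, (mk_eq_mk_of_le hz.2.le).trans y.2⟩ :
          {y : G.ColorTemplate P // (Quot.mk _ y : G.ColorfulComponent P) = c}) : c.Faces),
          coe_lt_coe.2 hz.1, coe_lt_coe.2 hz.2⟩

theorem reflTransGen_of_linked {x h w : G.ColorTemplate P} (hh : Quot.mk _ h = c)
    (hx : Quot.mk _ x = c) (H : Linked h x w) (hw : Quot.mk _ w = c) :
    Relation.ReflTransGen (fun u v : c.Faces => (u ≤ v ∨ v ≤ u) ∧ ⊥ < v ∧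
      v < ((⟨h, hh⟩ : {y : G.ColorTemplate P // (Quot.mk _ y : G.ColorfulComponent P) = c}) :
        c.Faces))
      ((⟨x, hx⟩ : {y : G.ColorTemplate P // (Quot.mk _ y : G.ColorfulComponent P) = c}) : c.Faces)
      ((⟨w, hw⟩ : {y : G.ColorTemplate P // (Quot.mk _ y : G.ColorfulComponent P) = c}) :
        c.Faces) := by
  unfold Linked at H
  induction H with
  | refl => exact Relation.ReflTransGen.refl
  | tail _ hbc ih =>
    refine (ih ((mk_eq_mk_of_le hbc.2.1.le).trans hh)).tail ⟨?_, WithBot.bot_lt_coe _, ?_⟩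
    · exact hbc.1.imp coe_le_coe.2 coe_le_coe.2
    · exact coe_lt_coe.2 hbc.2.2

theorem exists_coe {a b : c.Faces} (hab : a < b) :
    ∃ x : {y : G.ColorTemplate P // (Quot.mk _ y : G.ColorfulComponent P) = c}, b = x := by
  induction b using WithBot.recBotCoe with
  | bot => exact absurd hab not_lt_bot
  | coe y => exact ⟨y, rfl⟩

/-- Each component is an abstract polytope. -/
theorem isAbstractPolytope (hG : G.Connected) (c : G.ColorfulComponent P) :
    IsAbstractPolytope c.Faces P.card := by
  refine (isBoundedGrading hG c).isAbstractPolytope ?_ ?_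
  · intro a b hab hg x y hax hxb hay hyb
    obtain ⟨h, rfl⟩ := exists_coe hab
    obtain ⟨x, rfl⟩ := exists_coe hax
    obtain ⟨y, rfl⟩ := exists_coe hay
    have hh := h.1.card_tubes_le
    -- Over the least face this is the connectedness of the proper faces of `h`. Over a template
    -- `f`, the interval is Boolean and a zigzag of length four suffices.
    induction a using WithBot.recBotCoe with
    | bot =>
      rw [grade_bot, grade_coe] at hg
      exact reflTransGen_of_linked h.2 x.2
        (linked_of_lt hG (by omega) (coe_lt_coe.1 hxb) (coe_lt_coe.1 hyb)) y.2
    | coe f =>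
      have hf := f.1.card_tubes_le
      rw [grade_coe, grade_coe] at hg
      obtain ⟨u, v, w, hxu, hvu, hvw, hyw, hfv, huh, hwh⟩ := exists_zigzag hG
        (coe_lt_coe.1 hax) (coe_lt_coe.1 hxb) (coe_lt_coe.1 hay) (coe_lt_coe.1 hyb) (by omega)
      have hmk : ∀ {z}, z < h.1 → (Quot.mk _ z : G.ColorfulComponent P) = c :=
        fun hz => (mk_eq_mk_of_le hz.le).trans h.2
      have hvh := hvu.trans_lt huh
      have step : ∀ p q : {y : G.ColorTemplate P // (Quot.mk _ y : G.ColorfulComponent P) = c},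
          p.1 ≤ q.1 ∨ q.1 ≤ p.1 → f.1 < q.1 → q.1 < h.1 →
          Relation.ReflTransGen (fun u v : c.Faces => (u ≤ v ∨ v ≤ u) ∧ (f : c.Faces) < v ∧
            v < (h : c.Faces)) (p : c.Faces) (q : c.Faces) := fun p q hpq h1 h2 =>
        Relation.ReflTransGen.single ⟨hpq.imp coe_le_coe.2 coe_le_coe.2, coe_lt_coe.2 h1,
          coe_lt_coe.2 h2⟩
      exact (step x ⟨u, hmk huh⟩ (Or.inl hxu) (hfv.trans_le hvu) huh).trans <|
        (step _ ⟨v, hmk hvh⟩ (Or.inr hvu) hfv hvh).trans <|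
        (step _ ⟨w, hmk hwh⟩ (Or.inl hvw) (hfv.trans_le hvw) hwh).trans <|
        step _ y (Or.inr hyw) (coe_lt_coe.1 hay) (coe_lt_coe.1 hyb)
  · intro a b hab hg
    obtain ⟨h, rfl⟩ := exists_coe hab
    have hh := h.1.card_tubes_le
    have key : ∀ (z₁ z₂ : {y : G.ColorTemplate P // (Quot.mk _ y : G.ColorfulComponent P) = c}),
        z₁ ≠ z₂ → {d | a < d ∧ d < (h : c.Faces)} = {(z₁ : c.Faces), (z₂ : c.Faces)} →
        {d | a < d ∧ d < (h : c.Faces)}.ncard = 2 := by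
      intro z₁ z₂ hne he
      rw [he, Set.ncard_pair (fun h' => hne (WithBot.coe_injective h'))]
    induction a using WithBot.recBotCoe with
    | bot =>
      rw [grade_bot, grade_coe] at hg
      obtain ⟨z₁, z₂, hne, hz⟩ := exists_two_lt (h := h.1) hG (by omega)
      have h₁ := (hz z₁).2 (Or.inl rfl)
      have h₂ := (hz z₂).2 (Or.inr rfl)
      refine key ⟨z₁, (mk_eq_mk_of_le h₁.le).trans h.2⟩ ⟨z₂, (mk_eq_mk_of_le h₂.le).trans h.2⟩
        (fun h' => hne (congrArg Subtype.val h')) ?_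
      ext d
      simp only [Set.mem_ofPred_eq, Set.mem_insert_iff, Set.mem_singleton_iff]
      induction d using WithBot.recBotCoe with
      | bot => simp
      | coe z =>
        rw [coe_lt_coe, WithBot.coe_inj, WithBot.coe_inj, Subtype.ext_iff, Subtype.ext_iff, ← hz]
        exact and_iff_right (WithBot.bot_lt_coe _)
    | coe f =>
      have hf := f.1.card_tubes_le
      rw [grade_coe, grade_coe] at hg
      obtain ⟨z₁, z₂, hne, hz⟩ := exists_two_between hG (coe_lt_coe.1 hab) (by omega)
      have h₁ := (hz z₁).2 (Or.inl rfl)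
      have h₂ := (hz z₂).2 (Or.inr rfl)
      refine key ⟨z₁, (mk_eq_mk_of_le h₁.2.le).trans h.2⟩
        ⟨z₂, (mk_eq_mk_of_le h₂.2.le).trans h.2⟩ (fun h' => hne (congrArg Subtype.val h')) ?_
      ext d
      simp only [Set.mem_ofPred_eq, Set.mem_insert_iff, Set.mem_singleton_iff]
      induction d using WithBot.recBotCoe with
      | bot => simp
      | coe z =>
        rw [coe_lt_coe, coe_lt_coe, WithBot.coe_inj, WithBot.coe_inj, Subtype.ext_iff,
          Subtype.ext_iff, ← hz]

end ColorfulComponent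

end SimpleGraph

/-- A list without duplicates is mapped to any other of the same length by some permutation. -/
theorem List.exists_perm_map_eq {α : Type*} {ℓ ℓ' : List α} (h : ℓ.Nodup) (h' : ℓ'.Nodup)
    (hlen : ℓ.length = ℓ'.length) : ∃ π : Equiv.Perm α, ℓ.map π = ℓ' := by
  have := Equiv.Perm.isMultiplyPretransitive α ℓ.length
  obtain ⟨π, hπ⟩ := MulAction.exists_smul_eq (Equiv.Perm α)
    (⟨ℓ.get, List.nodup_iff_injective_get.1 h⟩ : Fin ℓ.length ↪ α)
    ⟨fun i => ℓ'.get (i.cast hlen), fun i j hij => by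
      simpa using List.nodup_iff_injective_get.1 h' hij⟩
  refine ⟨π, List.ext_get (by simpa using hlen) fun i h1 h2 => ?_⟩
  have := DFunLike.congr_fun hπ ⟨i, by simpa using h1⟩
  rw [List.get_eq_getElem, List.getElem_map]
  exact this

/-! ### Recoloring of blocks -/

namespace ColorBlocks

variable {C D : Type*} {b : ColorBlocks C} {ℓ : List C}

/-- Recoloring of blocks. -/
def map (f : C → D) (b : ColorBlocks C) : ColorBlocks D :=
  ⟨b.color.map f, b.outer.map f, b.inner.map f⟩

theorem colors_map (f : C → D) (b : ColorBlocks C) : (b.map f).colors = b.colors.map f := by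
  cases h : b.color <;> simp [colors, map, h]

theorem IsListing.map (h : b.IsListing ℓ) (f : C → D) : (b.map f).IsListing (ℓ.map f) := by
  obtain ⟨m, hm, rfl⟩ := h
  refine ⟨m.map f, by rw [ColorBlocks.map, ← hm, Multiset.map_coe], ?_⟩
  cases h : b.color <;> simp [ColorBlocks.map, h]

theorem map_map_of_leftInverse {f : C → D} {g : D → C} (h : Function.LeftInverse g f)
    (b : ColorBlocks C) : (b.map f).map g = b := by
  cases b
  simp [map, Function.comp_def, h.eq]

end ColorBlocks

namespace SimpleGraph

variable {V : Type*} [Fintype V] [DecidableEq V] {G : SimpleGraph V} {C : Type*}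

variable (G) in
theorem vertexConnectivity_eq_relConn :
    G.vertexConnectivity = G.relConn Finset.univ Finset.univ := by
  have key : ∀ S : Finset V, ¬ (G.induce {v : V | v ∉ S}).Preconnected ↔
      ∃ u ∈ Finset.univ \ S, ∃ w ∈ Finset.univ \ S, ¬ G.ReachIn (Finset.univ \ S) u w := by
    intro S
    have e : {v : V | v ∉ S} = ((Finset.univ \ S : Finset V) : Set V) := by
      ext v
      simp
    rw [e]
    simp only [Preconnected, not_forall]
    constructor
    · rintro ⟨⟨u, hu⟩, ⟨w, hw⟩, h⟩
      exact ⟨u, hu, w, hw, fun h' => h ((reachable_induce_iff hu hw).2 h')⟩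
    · rintro ⟨u, hu, w, hw, h⟩
      exact ⟨⟨u, hu⟩, ⟨w, hw⟩, fun h' => h ((reachable_induce_iff hu hw).1 h')⟩
  unfold vertexConnectivity relConn
  simp only [key, Finset.subset_univ, true_and, Finset.card_univ]

/-- Only a graph with a single node is connected with connectivity zero. -/
theorem card_eq_one_of_vertexConnectivity_eq_zero (hG : G.Connected)
    (h : G.vertexConnectivity = 0) : Fintype.card V = 1 := by
  rw [vertexConnectivity_eq_relConn] at h
  obtain ⟨S, -, hS, h'⟩ := G.exists_relConn Finset.univ Finset.univ
  rw [h, Finset.card_eq_zero] at hS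
  subst hS
  have hpos := Fintype.card_pos_iff.2 hG.nonempty
  rcases h' with ⟨u, hu, w, hw, hn⟩ | h'
  · rw [Finset.sdiff_empty] at hn
    exact absurd ((isConn_univ hG).2 u (Finset.mem_univ _) w (Finset.mem_univ _)) hn
  · rw [Finset.card_univ, Finset.card_empty] at h'
    omega

namespace ColorTemplate

variable {P : Multiset C} {x y : G.ColorTemplate P}

/-! ### Templates without tubes -/

theorem fitsCore_univ (hx : x.tubing.tubes = ∅) :
    G.FitsCore Finset.univ Finset.univ (x.blocks Finset.univ) := by
  have := x.fitsCore (Finset.mem_insert_self _ _)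
  rwa [hx, coreNodes_empty] at this

theorem colors_univ (hx : x.tubing.tubes = ∅) : (x.blocks Finset.univ).colors = P := by
  have := x.sum_colors
  rwa [hx, insert_empty_eq, Finset.sum_singleton] at this

theorem length_outer_univ (hx : x.tubing.tubes = ∅) :
    (x.blocks Finset.univ).outer.length = G.vertexConnectivity - 1 := by
  rw [(fitsCore_univ hx).length_outer, vertexConnectivity_eq_relConn]

theorem outer_add_inner (hx : x.tubing.tubes = ∅) :
    ((x.blocks Finset.univ).outer : Multiset C) + (x.blocks Finset.univ).inner = P := by
  have := colors_univ hx
  rw [ColorBlocks.colors, x.color_univ] at this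
  simpa using this

theorem eq_of_blocks_univ_eq (hx : x.tubing.tubes = ∅) (hy : y.tubing.tubes = ∅)
    (h : x.blocks Finset.univ = y.blocks Finset.univ) : x = y := by
  refine eq_of_blocks (hx.trans hy.symm) fun r hr => ?_
  rw [hy, insert_empty_eq, Finset.mem_singleton] at hr
  rw [hr, h]

theorem eq_of_outer_eq (hx : x.tubing.tubes = ∅) (hy : y.tubing.tubes = ∅)
    (h : (x.blocks Finset.univ).outer = (y.blocks Finset.univ).outer) : x = y := by
  refine eq_of_blocks_univ_eq hx hy (ColorBlocks.ext (x.color_univ.trans y.color_univ.symm) h ?_)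
  have := (outer_add_inner hx).trans (outer_add_inner hy).symm
  rw [h] at this
  exact add_left_cancel this

variable (G) in
theorem exists_outer_eq (hP : P.card = Fintype.card V - 1) {ℓ : List C}
    (hℓ : (ℓ : Multiset C) ≤ P) (hlen : ℓ.length = G.vertexConnectivity - 1) :
    ∃ x : G.ColorTemplate P, x.tubing.tubes = ∅ ∧ (x.blocks Finset.univ).outer = ℓ := by
  obtain ⟨m, rfl⟩ := Multiset.le_iff_exists_add.1 hℓ
  obtain ⟨m, rfl⟩ := Quot.exists_rep m
  obtain ⟨x, hx, n, -, hn⟩ := exists_of_isListing G (ℓ := ℓ ++ m) rfl hP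
  rw [x.color_univ, Option.toList_none, List.nil_append] at hn
  exact ⟨x, hx, (List.append_inj hn (hlen.trans (length_outer_univ hx).symm)).1.symm⟩

end ColorTemplate

/-! ### Number of components for a full palette -/

namespace ColorfulComponent

open ColorTemplate

variable {P : Multiset C}

theorem exists_eq_mk (hG : G.Connected) (c : G.ColorfulComponent P) :
    ∃ x : G.ColorTemplate P, x.tubing.tubes = ∅ ∧ Quot.mk _ x = c := by
  obtain ⟨x, rfl⟩ := Quot.exists_rep c
  exact ⟨x.greatest hG, x.tubes_greatest hG, (mk_eq_mk_of_le (x.le_greatest hG)).symm⟩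

/-- A component is given by its template without tubes. This is determined by its outer colors,
since the inner block consists of the rest of the palette. For distinct colors these sequences are
the embeddings of `Fin (k - 1)` into the palette. -/
theorem card_eq_descFactorial (hG : G.Connected) (hP : P.card = Fintype.card V - 1)
    (hnd : P.Nodup) :
    Nat.card (G.ColorfulComponent P) = P.card.descFactorial (G.vertexConnectivity - 1) := by
  have hsub : ∀ f : Fin (G.vertexConnectivity - 1) ↪ {a // a ∈ (⟨P, hnd⟩ : Finset C)},
      ((List.ofFn fun i => (f i : C) : List C) : Multiset C) ≤ P := by
    intro f
    refine (Multiset.le_iff_subset (Multiset.coe_nodup.2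
      (List.nodup_ofFn.2 (Subtype.val_injective.comp f.injective)))).2 ?_
    intro a ha
    obtain ⟨i, rfl⟩ := List.mem_ofFn.1 (Multiset.mem_coe.1 ha)
    exact (f i).2
  choose φ hφ hout using fun f => exists_outer_eq G hP (hsub f) List.length_ofFn
  have hbij : Function.Bijective fun f => (Quot.mk _ (φ f) : G.ColorfulComponent P) := by
    constructor
    · intro f g hfg
      have h := (mk_eq_mk_iff hG).1 hfg
      rw [greatest_eq_self hG (hφ f), greatest_eq_self hG (hφ g)] at h
      have h' := (hout f).symm.trans ((congrArg (fun x => (x.blocks Finset.univ).outer) h).trans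
        (hout g))
      ext i
      exact congrFun (List.ofFn_injective h') i
    · intro c
      obtain ⟨x, hx, rfl⟩ := exists_eq_mk hG c
      have hle : ((x.blocks Finset.univ).outer : Multiset C) ≤ P := by
        conv_rhs => rw [← outer_add_inner hx]
        exact Multiset.le_add_right _ _
      have hlen := length_outer_univ hx
      have hnd' := Multiset.coe_nodup.1 (Multiset.nodup_of_le hle hnd)
      refine ⟨⟨fun i => ⟨(x.blocks Finset.univ).outer.get (i.cast hlen.symm),
        Multiset.subset_of_le hle (Multiset.mem_coe.2 (List.get_mem _ _))⟩, fun i j hij => ?_⟩, ?_⟩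
      · have := List.nodup_iff_injective_get.1 hnd' (congrArg Subtype.val hij)
        simpa using this
      · refine congrArg (Quot.mk _) (eq_of_outer_eq (hφ _) hx ?_)
        rw [hout]
        refine List.ext_get (by simp [hlen]) fun i h1 h2 => ?_
        rw [List.get_ofFn]
        rfl
  refine (Nat.card_eq_of_bijective _ hbij).symm.trans ?_
  rw [Nat.card_eq_fintype_card, Fintype.card_embedding_eq,
    Fintype.card_fin, Fintype.card_coe]
  rfl

theorem card_eq (hG : G.Connected) (hP : P.card = Fintype.card V - 1) (hnd : P.Nodup) :
    Nat.card (G.ColorfulComponent P) =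
      (Fintype.card V - 1).factorial / (Fintype.card V - G.vertexConnectivity).factorial := by
  have hpos := Fintype.card_pos_iff.2 hG.nonempty
  have hle : G.vertexConnectivity ≤ Fintype.card V - 1 := by
    rw [vertexConnectivity_eq_relConn]
    exact G.relConn_le_card_sub_one Finset.univ Finset.univ
  rw [card_eq_descFactorial hG hP hnd, hP, Nat.descFactorial_eq_div (by omega)]
  -- Connectivity zero occurs only for one node, where the truncated `k - 1` changes the denominator
  -- from `1!` to `0!` without effect. Otherwise `(n - 1) - (k - 1) = n - k`.
  rcases Nat.eq_zero_or_pos G.vertexConnectivity with h | h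
  · rw [h, card_eq_one_of_vertexConnectivity_eq_zero hG h]
    rfl
  · congr 2
    omega

end ColorfulComponent

/-! ### Recoloring -/

namespace ColorTemplate

variable {P : Multiset C}

/-- Recoloring of a template by a permutation of the colors that preserves the palette. -/
def recolor (π : Equiv.Perm C) (hπ : P.map π = P) (x : G.ColorTemplate P) :
    G.ColorTemplate P where
  tubing := x.tubing
  blocks r := (x.blocks r).map π
  blocks_eq_empty t ht := by rw [x.blocks_eq_empty t ht]; rfl
  color_univ := by simp [ColorBlocks.map, x.color_univ]
  color_tube t ht := by simpa [ColorBlocks.map] using x.color_tube t ht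
  length_outer t ht := by simpa [ColorBlocks.map] using x.length_outer t ht
  card_inner t ht := by simpa [ColorBlocks.map] using x.card_inner t ht
  sum_colors := by
    simp only [ColorBlocks.colors_map]
    conv_rhs => rw [← hπ, ← x.sum_colors]
    exact (map_sum (Multiset.mapAddMonoidHom π) _ _).symm

variable {π σ : Equiv.Perm C} {x y : G.ColorTemplate P}

theorem recolor_recolor (hπ : P.map π = P) (hσ : P.map σ = P) (h : ∀ a, σ (π a) = a) :
    (x.recolor π hπ).recolor σ hσ = x := by
  refine ColorTemplate.ext rfl (funext fun r => ?_)
  exact (x.blocks r).map_map_of_leftInverse h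

theorem Step.recolor (hπ : P.map π = P) (h : Step x y) :
    Step (x.recolor π hπ) (y.recolor π hπ) := by
  obtain ⟨t, s, ht, hx, hs, hts, hle, hb, ℓ₁, ℓ₂, h1, h2, h3⟩ := h
  refine ⟨t, s, ht, hx, hs, hts, hle, fun r hrt hrs => congrArg (ColorBlocks.map π) (hb r hrt hrs),
    ℓ₁.map π, ℓ₂.map π, ?_, h2.map π, h3.map π⟩
  rw [← List.map_append]
  exact h1.map π

theorem recolor_le (hπ : P.map π = P) (h : x ≤ y) : x.recolor π hπ ≤ y.recolor π hπ :=
  Relation.ReflTransGen.lift (recolor π hπ) (fun _ _ h => h.recolor hπ) _ _ h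

theorem map_symm_eq (hπ : P.map π = P) : P.map π.symm = P := by
  conv_lhs => rw [← hπ]
  simp

/-- Recoloring as an order isomorphism. -/
def recolorIso (π : Equiv.Perm C) (hπ : P.map π = P) : G.ColorTemplate P ≃o G.ColorTemplate P where
  toFun := recolor π hπ
  invFun := recolor π.symm (map_symm_eq hπ)
  left_inv _ := recolor_recolor hπ _ π.symm_apply_apply
  right_inv _ := recolor_recolor _ hπ π.apply_symm_apply
  map_rel_iff' {x y} := ⟨fun h => by
    have := recolor_le (map_symm_eq hπ) h
    rwa [Equiv.coe_fn_mk, recolor_recolor hπ _ π.symm_apply_apply,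
      recolor_recolor hπ _ π.symm_apply_apply] at this, recolor_le hπ⟩

/-- Any two templates without tubes differ by a recoloring if the palette is full. -/
theorem exists_recolor_eq (hnd : P.Nodup) (hx : x.tubing.tubes = ∅) (hy : y.tubing.tubes = ∅) :
    ∃ (π : Equiv.Perm C) (hπ : P.map π = P), x.recolor π hπ = y := by
  obtain ⟨ℓ, hℓ⟩ := (x.blocks Finset.univ).exists_isListing
  obtain ⟨ℓ', hℓ'⟩ := (y.blocks Finset.univ).exists_isListing
  have e := hℓ.coe_eq.trans (colors_univ hx)
  have e' := hℓ'.coe_eq.trans (colors_univ hy)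
  obtain ⟨π, hπ⟩ := List.exists_perm_map_eq (Multiset.coe_nodup.1 (e ▸ hnd))
    (Multiset.coe_nodup.1 (e' ▸ hnd))
    (Multiset.coe_eq_coe.1 (e.trans e'.symm)).length_eq
  have hP : P.map π = P := by
    conv_lhs => rw [← e]
    rw [Multiset.map_coe, hπ, e']
  refine ⟨π, hP, eq_of_blocks_univ_eq hx hy ?_⟩
  refine blocks_eq_of_isListing (hx.trans hy.symm) (Finset.mem_insert_self _ _) (hℓ.map π) ?_
  rwa [hπ]

end ColorTemplate

/-! ### Isomorphisms between components -/

namespace ColorfulComponent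

open ColorTemplate

variable {P : Multiset C}

/-- For a full palette, all components are isomorphic. -/
theorem nonempty_orderIso (hG : G.Connected) (hnd : P.Nodup) (c d : G.ColorfulComponent P) :
    Nonempty (c.Faces ≃o d.Faces) := by
  obtain ⟨x, hx, rfl⟩ := exists_eq_mk hG c
  obtain ⟨y, hy, rfl⟩ := exists_eq_mk hG d
  obtain ⟨π, hπ, rfl⟩ := exists_recolor_eq hnd hx hy
  -- Recoloring commutes with passing to the greatest face, so it maps one component onto the other.
  have key : ∀ z : G.ColorTemplate P, (Quot.mk _ z : G.ColorfulComponent P) = Quot.mk _ x ↔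
      (Quot.mk _ (z.recolor π hπ) : G.ColorfulComponent P) = Quot.mk _ (x.recolor π hπ) := by
    intro z
    rw [mk_eq_mk_iff hG, mk_eq_mk_iff hG, greatest_eq_self hG hx,
      greatest_eq_self (x := x.recolor π hπ) hG hy,
      greatest_eq_of_le hG (recolor_le hπ (z.le_greatest hG)),
      greatest_eq_self (x := (z.greatest hG).recolor π hπ) hG (z.tubes_greatest hG)]
    exact (recolorIso π hπ).injective.eq_iff.symm
  exact ⟨OrderIso.withBotCongr
    ⟨(recolorIso π hπ).toEquiv.subtypeEquiv key, (recolorIso π hπ).map_rel_iff⟩⟩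

end ColorfulComponent

end SimpleGraph

theorem corollary4p3 {V : Type*} [Fintype V] [DecidableEq V] {C : Type*}
    (G : SimpleGraph V) (hG : G.Connected)
    (P : Multiset C) (hP : P.card = Fintype.card V - 1) :
    -- monochrome palette
    ((∀ a ∈ P, ∀ b ∈ P, a = b) →
      ∃ e : G.ColorTemplate P ≃o G.Tubing, ∀ x, e x = x.tubing) ∧
    -- full palette
    (P.Nodup →
      Nat.card (G.ColorfulComponent P) =
        (Fintype.card V - 1).factorial / (Fintype.card V - G.vertexConnectivity).factorial ∧
      (∀ c : G.ColorfulComponent P, IsAbstractPolytope c.Faces (Fintype.card V - 1)) ∧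
      (∀ c d : G.ColorfulComponent P, Nonempty (c.Faces ≃o d.Faces))) :=
  ⟨SimpleGraph.ColorTemplate.exists_orderIso_tubing hG hP, fun hnd =>
    ⟨SimpleGraph.ColorfulComponent.card_eq hG hP hnd,
      fun c => hP ▸ c.isAbstractPolytope hG,
      fun c d => SimpleGraph.ColorfulComponent.nonempty_orderIso hG hnd c d⟩⟩
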